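/- **Approximation of strain.** *Reference strip.* Let $I=[a,b]$ with $a<b$, let $B:I\to\mathbb R_{>0}$ be smooth, and put $D_\beta=\{(u^1,u^2): u^1\in I,\ |u^2|\le\beta B(u^1)\}$ for $0<\beta\le 1$. Let $g_{[0]}$ be a smooth Riemannian metric on $D=D_1$ such that $(u^1,u^2)$ is a centered global chart: $g_{[0]ij}(u^1,0)=\delta_{ij}$, and the curves $u^1=\mathrm{const}$ are geodesics with unit tangent vector $\partial/\partial u^2$. The breadth-parametrized strip $M_{[0]\beta}$ is $D_\beta$ with the metric $g_{[0]}$. Its normalized coordinates are $s=u^1\in I$, $r=u^2/(\beta B(u^1))\in[-1,1]$, and $K_{[0]}(s)$ is the Gaussian curvature of $g_{[0]}$ at the point $(s,0)$ of the center curve. *Elasticity.* Let $Y>0$ and $-1<\nu<1$ be constants (Young's modulus and Poisson's ratio), $\lambda=\frac{\nu Y}{(1+\nu)(1-\nu)}$, $\mu=\frac{Y}{2(1+\nu)}$, and let $C^{ijkl}=\lambda g_{[0]}^{*ij}g_{[0]}^{*kl}+\mu(g_{[0]}^{*ik}g_{[0]}^{*jl}+g_{[0]}^{*il}g_{[0]}^{*jk})$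 be the isotropic stiffness tensor with constant Lamé parameters, where $(g_{[0]}^{*ij})$ is the inverse matrix of $(g_{[0]ij})$. For an embedding $\boldsymbol p:D_\beta\to\mathbb E^2$ let $g_{[t]ij}=\partial_i\boldsymbol p\cdot\partial_j\boldsymbol p$, let $E=\frac12(g_{[t]}-g_{[0]})$ be Green's strain tensor, $S^{kl}=C^{ijkl}E_{ij}$ the second Piola–Kirchhoff stress tensor, and $W(\boldsymbol p)=\int_{D_\beta}\frac12 C^{ijkl}E_{ij}E_{kl}\sqrt{\det g_{[0]}}\,du^1du^2$ the strain energy. The components $E^{\langle0\rangle}_{ij}$ and $S^{\langle0\rangle ij}$ are taken in the $g_{[0]}$-orthonormal frame $e_1=g_{[0]11}^{-1/2}\,\partial/\partial u^1$, $e_2=\partial/\partial u^2$ and its dual coframe. *Minimizers.* Fix a class $C^k$, $1\le k\le\infty$, and $0<\beta_0\le1$. For every $\beta\in(0,\beta_0)$ let $\boldsymbol p_\beta:D_\beta\to\mathbb E^2$ be a $C^k$ embedding that minimizes $W$ among all $C^k$ embeddings of $D_\beta$ into $\mathbb E^2$. Let $\operatorname{int}I\subseteq J\subseteq I$, and assume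 that the family depends smoothly on $\beta$ up to $\beta=0$ over $J$: after composing each $\boldsymbol p_\beta$ with a suitable isometry of $\mathbb E^2$, the map $(s,r,\beta)\mapsto\boldsymbol p_\beta(s,\beta B(s)r)$ extends to a $C^\infty$ map on $J\times[-1,1]\times[0,\beta_0)$. *Conclusion.* Let $E_\beta,S_\beta$ be the strain and stress of $\boldsymbol p_\beta$. Then, at the point with normalized coordinates $(s,r)$ and as $\beta\to0^+$, $$S_\beta^{\langle0\rangle12},\ S_\beta^{\langle0\rangle21},\ S_\beta^{\langle0\rangle22}\in O(\beta^3),$$ $$E^{\langle0\rangle}_{\beta11}\in\tfrac12K_{[0]}(\beta B)^2\left(r^2-\tfrac13\right)+O(\beta^3),\qquad E^{\langle0\rangle}_{\beta22}\in-\nu E^{\langle0\rangle}_{\beta11}+O(\beta^3),$$ where all the $O(\beta^3)$ are uniform for $r\in[-1,1]$ and for $s$ in compact subsets of $J$. -/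

import Mathlib

open scoped ContDiff

noncomputable section

namespace ElasticStrip

/-- The Euclidean plane into which strips are embedded. -/
abbrev Plane : Type := EuclideanSpace ℝ (Fin 2)

/-! ### Riemannian geometry in a global chart

A metric in the coordinates `(u¹, u²)` is a matrix-valued function `g`.  The indices `1, 2` of
the classical notation are `0, 1 : Fin 2`.  Derivatives are taken within the (closed)
coordinate domain `D`. -/

/-- The coordinate vectors of the coordinate plane `ℝ × ℝ`. -/
def coordVec : Fin 2 → ℝ × ℝ := ![(1, 0), (0, 1)]

/-- The partial derivative `∂f/∂uⁱ` within the domain `D`. -/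
def partialWithin {F : Type*} [NormedAddCommGroup F] [NormedSpace ℝ F]
    (D : Set (ℝ × ℝ)) (i : Fin 2) (f : ℝ × ℝ → F) (u : ℝ × ℝ) : F :=
  fderivWithin ℝ f D u (coordVec i)

/-- A metric on the coordinate domain. -/
abbrev Metric2 : Type := ℝ × ℝ → Matrix (Fin 2) (Fin 2) ℝ

/-- The Christoffel symbol `Γⁱⱼₖ` of `g`. -/
def christoffel (D : Set (ℝ × ℝ)) (g : Metric2) (i j k : Fin 2) (u : ℝ × ℝ) : ℝ :=
  (1 / 2) * ∑ l, (g u)⁻¹ i l *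
    (partialWithin D j (fun v => g v l k) u + partialWithin D k (fun v => g v l j) u
      - partialWithin D l (fun v => g v j k) u)

/-- The component `Rˡₖᵢⱼ` of the curvature tensor, `R(∂ᵢ, ∂ⱼ)∂ₖ = Rˡₖᵢⱼ ∂ₗ`. -/
def riemann (D : Set (ℝ × ℝ)) (g : Metric2) (l k i j : Fin 2) (u : ℝ × ℝ) : ℝ :=
  partialWithin D i (christoffel D g l j k) u - partialWithin D j (christoffel D g l i k) u
    + ∑ m, (christoffel D g l i m u * christoffel D g m j k u
        - christoffel D g l j m u * christoffel D g m i k u)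

/-- The Gaussian curvature `g(R(∂₁, ∂₂)∂₂, ∂₁) / det g`. -/
def gaussCurvature (D : Set (ℝ × ℝ)) (g : Metric2) (u : ℝ × ℝ) : ℝ :=
  (∑ l, g u l 0 * riemann D g l 1 0 1 u) / (g u).det

/-! ### Strips -/

/-- The closed domain `{(u¹, u²) | u¹ ∈ [a, b], |u²| ≤ β B(u¹)}`. -/
def stripDomain (a b : ℝ) (B : ℝ → ℝ) (β : ℝ) : Set (ℝ × ℝ) :=
  {u | u.1 ∈ Set.Icc a b ∧ |u.2| ≤ β * B u.1}

/-- A strip (the reference state) read in a centered global chart: an interval `I = [a, b]`,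
a breadth function `B : I → ℝ_{>0}`, and a Riemannian metric on the coordinate domain
`D = {u¹ ∈ I, |u²| ≤ B(u¹)}` such that the coordinate basis is orthonormal on the center curve
`u² = 0` and the curves `u¹ = const` are geodesics with unit tangent vector `∂/∂u²`. -/
structure CenteredStrip where
  /-- left end of `I` -/
  a : ℝ
  /-- right end of `I` -/
  b : ℝ
  hab : a < b
  /-- the breadth function -/
  B : ℝ → ℝ
  B_pos : ∀ s ∈ Set.Icc a b, 0 < B s
  B_smooth : ContDiffOn ℝ ∞ B (Set.Icc a b)
  /-- the reference metric -/
  g : Metric2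
  g_smooth : ∀ i j, ContDiffOn ℝ ∞ (fun u => g u i j) (stripDomain a b B 1)
  g_posDef : ∀ u ∈ stripDomain a b B 1, (g u).PosDef
  g_center : ∀ s ∈ Set.Icc a b, g (s, 0) = 1
  g_unit : ∀ u ∈ stripDomain a b B 1, g u 1 1 = 1
  /-- The geodesic equation of `τ ↦ (u¹, τ)`: its velocity is `∂/∂u²` and its coordinates have
  vanishing second derivatives, so that the equation reads `Γⁱ₂₂ = 0`. -/
  g_geodesic : ∀ u ∈ stripDomain a b B 1, ∀ i, christoffel (stripDomain a b B 1) g i 1 1 u = 0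

namespace CenteredStrip

variable (M : CenteredStrip)

/-- The interval `I`. -/
def I : Set ℝ := Set.Icc M.a M.b

/-- The domain `D_β` of the narrowed strip of breadth `β B`. -/
def D (β : ℝ) : Set (ℝ × ℝ) := stripDomain M.a M.b M.B β

/-- The Gaussian curvature of the strip at the point `(s, 0)` of the center curve. -/
def K (s : ℝ) : ℝ := gaussCurvature (M.D 1) M.g (s, 0)

/-- The point of `D_β` with normalized coordinates `(s, r)`: `u¹ = s`, `u² = β B(s) r`. -/
def pt (β s r : ℝ) : ℝ × ℝ := (s, β * M.B s * r)

/-! ### Strain, stress, energy -/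

/-- The Lamé parameter `λ` of a two-dimensional isotropic material with Young's modulus `Y`
and Poisson's ratio `ν`. -/
def _root_.ElasticStrip.lameLambda (Y ν : ℝ) : ℝ := ν * Y / ((1 + ν) * (1 - ν))

/-- The Lamé parameter `μ`. -/
def _root_.ElasticStrip.lameMu (Y ν : ℝ) : ℝ := Y / (2 * (1 + ν))

/-- The components `C^{ijkl}` of the isotropic stiffness tensor. -/
def stiffness (Y ν : ℝ) (i j k l : Fin 2) (u : ℝ × ℝ) : ℝ :=
  lameLambda Y ν * ((M.g u)⁻¹ i j * (M.g u)⁻¹ k l)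
    + lameMu Y ν * ((M.g u)⁻¹ i k * (M.g u)⁻¹ j l + (M.g u)⁻¹ i l * (M.g u)⁻¹ j k)

/-- The metric on `D_β` induced by a map into the plane. -/
def inducedMetric (β : ℝ) (p : ℝ × ℝ → Plane) (i j : Fin 2) (u : ℝ × ℝ) : ℝ :=
  inner ℝ (partialWithin (M.D β) i p u) (partialWithin (M.D β) j p u)

/-- The coordinate components of Green's strain tensor `E = (g_t - g_0) / 2`. -/
def strain (β : ℝ) (p : ℝ × ℝ → Plane) (i j : Fin 2) (u : ℝ × ℝ) : ℝ :=
  (M.inducedMetric β p i j u - M.g u i j) / 2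

/-- The coordinate components `S^{kl} = C^{ijkl} E_{ij}` of the second Piola-Kirchhoff
stress tensor. -/
def stress (Y ν β : ℝ) (p : ℝ × ℝ → Plane) (k l : Fin 2) (u : ℝ × ℝ) : ℝ :=
  ∑ i, ∑ j, M.stiffness Y ν i j k l u * M.strain β p i j u

/-- The strain energy `∫ (1/2) C(E, E) dvol` over the narrowed strip. -/
def energy (Y ν β : ℝ) (p : ℝ × ℝ → Plane) : ℝ :=
  ∫ u in M.D β, (1 / 2) * (∑ i, ∑ j, ∑ k, ∑ l,
    M.stiffness Y ν i j k l u * M.strain β p i j u * M.strain β p k l u) * √(M.g u).det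

/-- `frame i k` is the `∂/∂uᵏ`-component of the vector `eᵢ` of the orthonormal frame
`e₁ = (g₁₁)^{-1/2} ∂/∂u¹`, `e₂ = ∂/∂u²` of the reference metric. -/
def frame (u : ℝ × ℝ) : Matrix (Fin 2) (Fin 2) ℝ := !![1 / √(M.g u 0 0), 0; 0, 1]

/-- `coframe i k` is the `duᵏ`-component of the covector `θⁱ` of the dual frame
`θ¹ = (g₁₁)^{1/2} du¹`, `θ² = du²`. -/
def coframe (u : ℝ × ℝ) : Matrix (Fin 2) (Fin 2) ℝ := !![√(M.g u 0 0), 0; 0, 1]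

/-- The components of the strain tensor in the orthonormal frame. -/
def frameStrain (β : ℝ) (p : ℝ × ℝ → Plane) (i j : Fin 2) (u : ℝ × ℝ) : ℝ :=
  ∑ k, ∑ l, M.frame u i k * M.frame u j l * M.strain β p k l u

/-- The components of the stress tensor in the orthonormal frame. -/
def frameStress (Y ν β : ℝ) (p : ℝ × ℝ → Plane) (i j : Fin 2) (u : ℝ × ℝ) : ℝ :=
  ∑ k, ∑ l, M.coframe u i k * M.coframe u j l * M.stress Y ν β p k l u

/-! ### Energy-minimizing embeddings -/

/-- `p` is an embedding of class `C^k` of the narrowed strip into the plane (an injective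
immersion up to the boundary; the strip is compact). -/
structure IsPlaneEmbedding (k : ℕ∞) (β : ℝ) (p : ℝ × ℝ → Plane) : Prop where
  contDiffOn : ContDiffOn ℝ k p (M.D β)
  injOn : Set.InjOn p (M.D β)
  immersion : ∀ u ∈ M.D β, LinearIndependent ℝ fun i => partialWithin (M.D β) i p u

/-- `p` minimizes the strain energy among all `C^k` embeddings of the narrowed strip. -/
structure IsMinimizer (k : ℕ∞) (Y ν β : ℝ) (p : ℝ × ℝ → Plane) : Prop where
  embedding : M.IsPlaneEmbedding k β p
  le : ∀ q, M.IsPlaneEmbedding k β q → M.energy Y ν β p ≤ M.energy Y ν β q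

/-- The maps `p β`, `0 < β < β₀`, read in normalized coordinates and up to rigid motions of the
plane, form a family that is smooth in `(s, r, β)` up to `β = 0`, over the part `s ∈ J` of the
strip. -/
def IsSmoothFamily (J : Set ℝ) (β₀ : ℝ) (p : ℝ → ℝ × ℝ → Plane) : Prop :=
  ∃ (R : ℝ → Plane ≃ᵃⁱ[ℝ] Plane) (P : ℝ × ℝ × ℝ → Plane),
    ContDiffOn ℝ ∞ P (J ×ˢ Set.Icc (-1) 1 ×ˢ Set.Ico 0 β₀) ∧
    ∀ s ∈ J, ∀ r ∈ Set.Icc (-1 : ℝ) 1, ∀ β ∈ Set.Ioo 0 β₀,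
      P (s, r, β) = R β (p β (M.pt β s r))

end CenteredStrip

/-- `f β s r = O(βⁿ)` as `β → 0+`, uniformly for `r ∈ [-1, 1]` and for `s` in compact subsets
of `J`. -/
def IsBigOBreadth (J : Set ℝ) (n : ℕ) (f : ℝ → ℝ → ℝ → ℝ) : Prop :=
  ∀ T ⊆ J, IsCompact T → ∃ c : ℝ, ∃ δ > 0, ∀ β ∈ Set.Ioo 0 δ, ∀ s ∈ T,
    ∀ r ∈ Set.Icc (-1 : ℝ) 1, |f β s r| ≤ c * β ^ n

end ElasticStrip

end

/-! Two facts about minimizers carry the proof: their energy is small and they are in equilibrium.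
Smoothness of the family in the breadth turns both into identities for Taylor coefficients.

Geometry. The geodesic condition makes the reference metric diag(G, 1) with G = 1 on the center
curve. The Gaussian curvature there is K = G'²/4 - G''/2, primes denoting derivatives in u²
(`K_eq`).

A priori bound. The competitor (u¹, u²) ↦ (u¹, u²) has strain O(β) on a strip of area O(β), hence
energy O(β³). As the energy density is coercive, the strain of a minimizer has integrated square
O(β²) in normalized coordinates (`exists_integral_strain_sq_le`). So the limit map depends on s
alone, which makes ∂₂p expandable although it arises through division by β, and the strain vanishes
at β = 0 (`dirWithin_r_zero`, `exists_expansions`, `strain_zero`). The limits a₀, b₀ of ∂₁p, ∂₂p are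
orthonormal and independent of r.

Equilibrium. Small perturbations of an embedding are embeddings, so minimizers satisfy the weak
equilibrium equations (`IsMinimizer.integral_flux_eq_zero`). Three kinds of test fields are used.
The fields χ(u¹) η(u²/β) v show that the leading traction on longitudinal fibers vanishes: S¹² and
S²² are zero at leading order, hence E₂₂ = -ν E₁₁ and S¹¹ = Y E₁₁ there. The fields Θ(u¹) v and
Θ(u¹) `rot p` give balance of force and moment on every cross section: the leading term of E₁₁ has
zero mean and zero first moment in r. This is `leading_strain`; it applies at whichever order the
strain starts.

Compatibility. Write a₁, a₂ and b₁ for the next coefficients of ∂₁p and ∂₂p. At order β the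
component E₁₁ is affine in r, so the two moments kill it, and with it the whole first-order strain.
This in turn yields ∂ᵣa₁ = (G'B/2) a₀ and a b₁ independent of r, so that a₂ is affine in r. Hence at
order β² the component E₁₁ is quadratic in r with top coefficient (G'B/2)²/2 - G''B²/4 = KB²/2. A
quadratic e r² + ... orthogonal to 1 and r on [-1, 1] is e (r² - 1/3), which is the asserted strain
(`hasExpansion_strain_minimizer`). -/

noncomputable section

open Set Filter Topology MeasureTheory

namespace ElasticStrip

namespace CenteredStrip

variable (M : CenteredStrip)

/-! ### The normalized chart -/

/-- The rectangle of normalized coordinates. -/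
def rect : Set (ℝ × ℝ) := Icc M.a M.b ×ˢ Icc (-1) 1

/-- The normalized coordinates as a map from the rectangle to the coordinate plane. -/
def chart (β : ℝ) (x : ℝ × ℝ) : ℝ × ℝ := M.pt β x.1 x.2

/-- The derivative of the breadth function. -/
def dB (s : ℝ) : ℝ := derivWithin M.B (Icc M.a M.b) s

/-- The derivative of the normalized chart. -/
def chartDeriv (β : ℝ) (x : ℝ × ℝ) : ℝ × ℝ →L[ℝ] ℝ × ℝ :=
  (ContinuousLinearMap.fst ℝ ℝ ℝ).prod
    ((β * x.2 * M.dB x.1) • ContinuousLinearMap.fst ℝ ℝ ℝ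
      + (β * M.B x.1) • ContinuousLinearMap.snd ℝ ℝ ℝ)

lemma chartDeriv_apply (β : ℝ) (x v : ℝ × ℝ) :
    M.chartDeriv β x v = (v.1, β * x.2 * M.dB x.1 * v.1 + β * M.B x.1 * v.2) := by
  simp [chartDeriv]

lemma chart_mapsTo {β : ℝ} (hβ : 0 ≤ β) : MapsTo (M.chart β) M.rect (M.D β) := by
  rintro ⟨s, r⟩ ⟨hs, hr⟩
  have hB := M.B_pos s hs
  refine ⟨hs, ?_⟩
  have : |r| ≤ 1 := abs_le.2 hr
  simp only [chart, pt, abs_mul, abs_of_nonneg hβ, abs_of_pos hB]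
  exact mul_le_of_le_one_right (by positivity) this

lemma image_chart {β : ℝ} (hβ : 0 < β) : M.chart β '' M.rect = M.D β := by
  refine Subset.antisymm (M.chart_mapsTo hβ.le).image_subset ?_
  rintro ⟨s, y⟩ ⟨hs, hy⟩
  have hB := M.B_pos s hs
  have hp : 0 < β * M.B s := by positivity
  refine ⟨(s, y / (β * M.B s)), ⟨hs, abs_le.1 ?_⟩, ?_⟩
  · rw [abs_div, abs_of_pos hp]
    exact (div_le_one hp).2 hy
  · simp only [chart, pt, Prod.mk.injEq, true_and]
    field_simp

lemma chart_injOn {β : ℝ} (hβ : 0 < β) : InjOn (M.chart β) M.rect := by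
  rintro ⟨s, r⟩ ⟨hs, hr⟩ ⟨s', r'⟩ ⟨hs', hr'⟩ h
  simp only [chart, pt, Prod.mk.injEq] at h
  obtain ⟨rfl, h⟩ := h
  have hB := M.B_pos s hs
  simpa [hβ.ne', hB.ne'] using h

lemma hasDerivWithinAt_B {x : ℝ} (hx : x ∈ Icc M.a M.b) :
    HasDerivWithinAt M.B (M.dB x) (Icc M.a M.b) x :=
  ((M.B_smooth x hx).differentiableWithinAt (by simp)).hasDerivWithinAt

lemma hasFDerivWithinAt_chart (β : ℝ) {x : ℝ × ℝ} (hx : x ∈ M.rect) :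
    HasFDerivWithinAt (M.chart β) (M.chartDeriv β x) M.rect x := by
  have h1 : HasFDerivWithinAt (fun y : ℝ × ℝ => y.1) (ContinuousLinearMap.fst ℝ ℝ ℝ) M.rect x :=
    hasFDerivWithinAt_fst
  have h2 : HasFDerivWithinAt (fun y : ℝ × ℝ => y.2) (ContinuousLinearMap.snd ℝ ℝ ℝ) M.rect x :=
    hasFDerivWithinAt_snd
  have hB := (M.hasDerivWithinAt_B hx.1).comp_hasFDerivWithinAt x h1
    (fun y hy => hy.1 : MapsTo (fun y : ℝ × ℝ => y.1) M.rect (Icc M.a M.b))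
  refine (h1.prodMk ((hB.const_mul β).mul h2)).congr_fderiv ?_
  ext <;> simp [chartDeriv] ; ring

lemma convex_rect : Convex ℝ M.rect := (convex_Icc _ _).prod (convex_Icc _ _)

lemma isCompact_rect : IsCompact M.rect := isCompact_Icc.prod isCompact_Icc

lemma uniqueDiffOn_rect : UniqueDiffOn ℝ M.rect :=
  (uniqueDiffOn_Icc M.hab).prod (uniqueDiffOn_Icc (by norm_num))

lemma contDiffOn_chart (β : ℝ) : ContDiffOn ℝ ∞ (M.chart β) M.rect := by
  have hB : ContDiffOn ℝ ∞ (fun x : ℝ × ℝ => M.B x.1) M.rect :=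
    M.B_smooth.comp contDiffOn_fst (fun y hy => hy.1)
  exact contDiffOn_fst.prodMk ((contDiffOn_const.mul hB).mul contDiffOn_snd)

lemma chartDeriv_bijective {β : ℝ} (hβ : 0 < β) {x : ℝ × ℝ} (hx : x ∈ M.rect) :
    Function.Bijective (M.chartDeriv β x) := by
  have hp : 0 < β * M.B x.1 := mul_pos hβ (M.B_pos _ hx.1)
  refine ⟨fun v w h => ?_, fun w => ⟨(w.1, (w.2 - β * x.2 * M.dB x.1 * w.1) / (β * M.B x.1)), ?_⟩⟩
  · simp only [chartDeriv_apply, Prod.mk.injEq] at h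
    obtain ⟨h1, h2⟩ := h
    rw [h1] at h2
    exact Prod.ext h1 (mul_left_cancel₀ hp.ne' (add_left_cancel h2))
  · rw [chartDeriv_apply]
    ext
    · rfl
    · have := (M.B_pos _ hx.1).ne'
      simp only []
      field_simp
      ring

/-- The domain has curved sides and need not be convex; unique differentiability is transported from
the rectangle by the chart, whose derivative is bijective. -/
lemma uniqueDiffOn_D {β : ℝ} (hβ : 0 < β) : UniqueDiffOn ℝ (M.D β) := by
  rw [← M.image_chart hβ]
  rintro _ ⟨x, hx, rfl⟩
  exact (M.hasFDerivWithinAt_chart β hx).uniqueDiffWithinAt (M.uniqueDiffOn_rect x hx)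
    (M.chartDeriv_bijective hβ hx).2.denseRange

lemma isCompact_D {β : ℝ} (hβ : 0 < β) : IsCompact (M.D β) := by
  rw [← M.image_chart hβ]
  exact M.isCompact_rect.image_of_continuousOn (M.contDiffOn_chart β).continuousOn

lemma D_subset {β : ℝ} (hβ : β ≤ 1) : M.D β ⊆ M.D 1 := fun _ hu =>
  ⟨hu.1, hu.2.trans (mul_le_mul_of_nonneg_right hβ (M.B_pos _ hu.1).le)⟩

lemma center_mem {s : ℝ} (hs : s ∈ Icc M.a M.b) : (s, (0 : ℝ)) ∈ M.D 1 := by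
  refine ⟨hs, ?_⟩
  simpa using (M.B_pos s hs).le

lemma det_chartDeriv (β : ℝ) (x : ℝ × ℝ) : (M.chartDeriv β x).det = β * M.B x.1 := by
  rw [ContinuousLinearMap.det, ← LinearMap.det_toMatrix (Module.Basis.finTwoProd ℝ),
    Matrix.det_fin_two]
  simp [LinearMap.toMatrix_apply, chartDeriv]

/-- Integrals over a narrowed strip in normalized coordinates. -/
lemma setIntegral_D {F : Type*} [NormedAddCommGroup F] [NormedSpace ℝ F] {β : ℝ} (hβ : 0 < β)
    (f : ℝ × ℝ → F) :
    ∫ u in M.D β, f u = ∫ x in M.rect, (β * M.B x.1) • f (M.chart β x) := by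
  rw [← M.image_chart hβ, integral_image_eq_integral_abs_det_fderiv_smul volume
    M.isCompact_rect.measurableSet (fun x hx => M.hasFDerivWithinAt_chart β hx)
    (M.chart_injOn hβ)]
  refine setIntegral_congr_fun M.isCompact_rect.measurableSet fun x hx => ?_
  have hp : 0 < β * M.B x.1 := mul_pos hβ (M.B_pos _ hx.1)
  simp only [det_chartDeriv, abs_of_pos hp]

/-! ### The reference metric -/

lemma g_symm {u : ℝ × ℝ} (hu : u ∈ M.D 1) : M.g u 0 1 = M.g u 1 0 := by
  have := (M.g_posDef u hu).1.apply 0 1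
  simpa using this.symm

lemma partialWithin_const {F : Type*} [NormedAddCommGroup F] [NormedSpace ℝ F]
    {D : Set (ℝ × ℝ)} {f : ℝ × ℝ → F} {c : F} (h : ∀ u ∈ D, f u = c) {u : ℝ × ℝ} (hu : u ∈ D)
    (i : Fin 2) : partialWithin D i f u = 0 := by
  have : fderivWithin ℝ f D u = fderivWithin ℝ (fun _ => c) D u := fderivWithin_congr h (h u hu)
  simp [partialWithin, this]

lemma partialWithin_congr {F : Type*} [NormedAddCommGroup F] [NormedSpace ℝ F]
    {D : Set (ℝ × ℝ)} {f f' : ℝ × ℝ → F} (h : ∀ u ∈ D, f u = f' u) {u : ℝ × ℝ} (hu : u ∈ D)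
    (i : Fin 2) : partialWithin D i f u = partialWithin D i f' u := by
  simp [partialWithin, fderivWithin_congr h (h u hu)]

/-- Since g₂₂ = 1 is constant, the geodesic equation Γⁱ₂₂ = 0 reduces to gⁱˡ ∂₂g_{l2} = 0, and the
inverse metric can be cancelled. -/
lemma partialWithin_g01 {u : ℝ × ℝ} (hu : u ∈ M.D 1) :
    partialWithin (M.D 1) 1 (fun v => M.g v 0 1) u = 0 := by
  have hdet : IsUnit (M.g u).det := (M.g_posDef u hu).det_pos.ne'.isUnit
  have hc : ∀ i, ∑ l, (M.g u)⁻¹ i l * partialWithin (M.D 1) 1 (fun v => M.g v l 1) u = 0 := by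
    intro i
    have h := M.g_geodesic u hu i
    have h11 : ∀ j, partialWithin (M.D 1) j (fun v => M.g v 1 1) u = 0 :=
      partialWithin_const M.g_unit hu
    simp only [christoffel, Fin.sum_univ_two] at h
    simp only [Fin.sum_univ_two]
    rw [show stripDomain M.a M.b M.B 1 = M.D 1 from rfl] at h
    rw [h11] at h ⊢
    rw [h11] at h
    linarith
  have hv : (M.g u)⁻¹.mulVec (fun l => partialWithin (M.D 1) 1 (fun v => M.g v l 1) u) = 0 :=
    funext fun i => hc i
  have := congrArg (M.g u).mulVec hv
  rw [Matrix.mulVec_mulVec, Matrix.mul_nonsing_inv _ hdet, Matrix.one_mulVec,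
    Matrix.mulVec_zero] at this
  exact congrFun this 0

/-- This is the Gauss lemma: g₁₂ is constant along each transverse geodesic and vanishes where the
geodesic crosses the center curve. -/
lemma g01 {u : ℝ × ℝ} (hu : u ∈ M.D 1) : M.g u 0 1 = 0 := by
  obtain ⟨s, y⟩ := u
  have hB := M.B_pos s hu.1
  have hmaps : MapsTo (fun t : ℝ => (s, t)) (Icc (-M.B s) (M.B s)) (M.D 1) := fun t ht =>
    ⟨hu.1, by simpa using abs_le.2 ht⟩
  have hder : ∀ t ∈ Icc (-M.B s) (M.B s),
      HasDerivWithinAt (fun t => M.g (s, t) 0 1) 0 (Icc (-M.B s) (M.B s)) t := by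
    intro t ht
    have h1 := ((M.g_smooth 0 1 (s, t) (hmaps ht)).differentiableWithinAt
      (by simp)).hasFDerivWithinAt
    have h2 : HasDerivWithinAt (fun t : ℝ => (s, t)) ((0 : ℝ), (1 : ℝ)) (Icc (-M.B s) (M.B s)) t :=
      (hasDerivWithinAt_const _ _ _).prodMk (hasDerivWithinAt_id _ _)
    have h3 := h1.comp_hasDerivWithinAt t h2 hmaps
    have h4 := M.partialWithin_g01 (hmaps ht)
    simp only [partialWithin, coordVec, D, Matrix.cons_val_one, Matrix.cons_val_fin_one] at h4
    rw [h4] at h3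
    exact h3
  have h := (convex_Icc (-M.B s) (M.B s)).norm_image_sub_le_of_norm_hasDerivWithin_le
    (C := 0) hder (by simp) (x := 0) (y := y) ⟨by linarith, hB.le⟩
    (abs_le.1 (by simpa using hu.2))
  have h0 : M.g (s, 0) 0 1 = 0 := by simp [M.g_center s hu.1]
  simpa [h0] using h

lemma g11 {u : ℝ × ℝ} (hu : u ∈ M.D 1) : M.g u 1 1 = 1 := M.g_unit u hu

lemma g10 {u : ℝ × ℝ} (hu : u ∈ M.D 1) : M.g u 1 0 = 0 := by
  rw [← M.g_symm hu, M.g01 hu]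

lemma g_eq {u : ℝ × ℝ} (hu : u ∈ M.D 1) : M.g u = Matrix.diagonal ![M.g u 0 0, 1] := by
  ext i j
  fin_cases i <;> fin_cases j <;> simp [M.g01 hu, M.g10 hu, M.g_unit u hu]

lemma g00_pos {u : ℝ × ℝ} (hu : u ∈ M.D 1) : 0 < M.g u 0 0 := (M.g_posDef u hu).diag_pos

lemma det_g {u : ℝ × ℝ} (hu : u ∈ M.D 1) : (M.g u).det = M.g u 0 0 := by
  rw [Matrix.det_fin_two, M.g01 hu, M.g_unit u hu]; ring

lemma inv_g {u : ℝ × ℝ} (hu : u ∈ M.D 1) :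
    (M.g u)⁻¹ = Matrix.diagonal ![(M.g u 0 0)⁻¹, 1] := by
  refine Matrix.inv_eq_right_inv ?_
  have h := M.g00_pos hu
  rw [M.g_eq hu, Matrix.diagonal_mul_diagonal, ← Matrix.diagonal_one]
  congr 1
  ext i
  fin_cases i <;> simp [h.ne']

/-- The metric coefficient `g₁₁`, the only nontrivial one. -/
def G (u : ℝ × ℝ) : ℝ := M.g u 0 0

/-- The derivative `∂g₁₁/∂u²`. -/
def G' (u : ℝ × ℝ) : ℝ := partialWithin (M.D 1) 1 M.G u

/-- The second derivative `∂²g₁₁/(∂u²)²`. -/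
def G'' (u : ℝ × ℝ) : ℝ := partialWithin (M.D 1) 1 M.G' u

lemma G_smooth : ContDiffOn ℝ ∞ M.G (M.D 1) := M.g_smooth 0 0

lemma partialWithin_smooth {F : Type*} [NormedAddCommGroup F] [NormedSpace ℝ F]
    {D : Set (ℝ × ℝ)} (hD : UniqueDiffOn ℝ D) {f : ℝ × ℝ → F} (hf : ContDiffOn ℝ ∞ f D)
    (i : Fin 2) : ContDiffOn ℝ ∞ (partialWithin D i f) D :=
  (hf.fderivWithin hD (by simp)).clm_apply contDiffOn_const

lemma G'_smooth : ContDiffOn ℝ ∞ M.G' (M.D 1) :=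
  partialWithin_smooth (M.uniqueDiffOn_D one_pos) M.G_smooth 1

lemma G_pos {u : ℝ × ℝ} (hu : u ∈ M.D 1) : 0 < M.G u := M.g00_pos hu

lemma G_center {s : ℝ} (hs : s ∈ Icc M.a M.b) : M.G (s, 0) = 1 := by
  simp [G, M.g_center s hs]

lemma partialWithin_g01_eq_zero {u : ℝ × ℝ} (hu : u ∈ M.D 1) (i : Fin 2) :
    partialWithin (M.D 1) i (fun v => M.g v 0 1) u = 0 :=
  partialWithin_const (fun _ hv => M.g01 hv) hu i

lemma partialWithin_g10_eq_zero {u : ℝ × ℝ} (hu : u ∈ M.D 1) (i : Fin 2) :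
    partialWithin (M.D 1) i (fun v => M.g v 1 0) u = 0 :=
  partialWithin_const (fun _ hv => M.g10 hv) hu i

lemma partialWithin_g11_eq_zero {u : ℝ × ℝ} (hu : u ∈ M.D 1) (i : Fin 2) :
    partialWithin (M.D 1) i (fun v => M.g v 1 1) u = 0 :=
  partialWithin_const (fun _ hv => M.g11 hv) hu i

lemma christoffel_001 {u : ℝ × ℝ} (hu : u ∈ M.D 1) :
    christoffel (M.D 1) M.g 0 0 1 u = M.G' u / (2 * M.G u) := by
  simp only [christoffel, Fin.sum_univ_two, M.inv_g hu, M.partialWithin_g01_eq_zero hu,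
    M.partialWithin_g10_eq_zero hu, M.partialWithin_g11_eq_zero hu]
  have : (fun v => M.g v 0 0) = M.G := rfl
  simp [this, G', G]
  ring

lemma christoffel_010 {u : ℝ × ℝ} (hu : u ∈ M.D 1) :
    christoffel (M.D 1) M.g 0 1 0 u = M.G' u / (2 * M.G u) := by
  simp only [christoffel, Fin.sum_univ_two, M.inv_g hu, M.partialWithin_g01_eq_zero hu,
    M.partialWithin_g10_eq_zero hu, M.partialWithin_g11_eq_zero hu]
  have : (fun v => M.g v 0 0) = M.G := rfl
  simp [this, G', G]
  ring

lemma christoffel_101 {u : ℝ × ℝ} (hu : u ∈ M.D 1) :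
    christoffel (M.D 1) M.g 1 0 1 u = 0 := by
  simp only [christoffel, Fin.sum_univ_two, M.inv_g hu, M.partialWithin_g01_eq_zero hu,
    M.partialWithin_g10_eq_zero hu, M.partialWithin_g11_eq_zero hu]
  simp

/-- The Gaussian curvature on the center curve. -/
lemma K_eq {s : ℝ} (hs : s ∈ Icc M.a M.b) :
    M.K s = M.G' (s, 0) ^ 2 / 4 - M.G'' (s, 0) / 2 := by
  have hu := M.center_mem hs
  have hG := M.G_center hs
  have hder : partialWithin (M.D 1) 1 (christoffel (M.D 1) M.g 0 0 1) (s, 0)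
      = M.G'' (s, 0) / 2 - M.G' (s, 0) ^ 2 / 2 := by
    rw [partialWithin_congr (f' := fun u => M.G' u / (2 * M.G u))
      (fun u hu => M.christoffel_001 hu) hu]
    have h1 := ((M.G'_smooth (s, 0) hu).differentiableWithinAt (by simp)).hasFDerivWithinAt
    have h2 := ((M.G_smooth (s, 0) hu).differentiableWithinAt (by simp)).hasFDerivWithinAt
    have h3 := h1.mul ((hasDerivAt_inv (x := 2 * M.G (s, 0))
      (by rw [hG]; norm_num)).comp_hasFDerivWithinAt (s, (0 : ℝ)) (h2.const_mul 2))
    have h4 := h3.fderivWithin (M.uniqueDiffOn_D one_pos _ hu)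
    simp only [partialWithin, div_eq_mul_inv]
    erw [h4]
    have e1 : fderivWithin ℝ M.G' (M.D 1) (s, 0) (coordVec 1) = M.G'' (s, 0) := rfl
    have e2 : fderivWithin ℝ M.G (M.D 1) (s, 0) (coordVec 1) = M.G' (s, 0) := rfl
    simp [e1, e2, hG]
    ring
  have h11 : ∀ i, ∀ u ∈ M.D 1, christoffel (M.D 1) M.g i 1 1 u = 0 :=
    fun i u hu => M.g_geodesic u hu i
  have hder0 : partialWithin (M.D 1) 0 (christoffel (M.D 1) M.g 0 1 1) (s, 0) = 0 :=
    partialWithin_const (h11 0) hu 0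
  -- As Γⁱ₂₂ = 0, only -∂₂Γ¹₁₂ - (Γ¹₁₂)² survives, with Γ¹₁₂ = G'/(2G).
  simp only [K, gaussCurvature, riemann, Fin.sum_univ_two, M.g_center s hs]
  rw [hder, hder0, h11 0 _ hu, h11 1 _ hu, M.christoffel_001 hu, M.christoffel_010 hu,
    M.christoffel_101 hu, hG]
  simp
  ring

end CenteredStrip

end ElasticStrip
end

noncomputable section

open Set Filter Topology MeasureTheory

namespace ElasticStrip

/-! ### Stability of embeddings -/

section Stability

variable {E F : Type*} [NormedAddCommGroup E] [NormedSpace ℝ E] [FiniteDimensional ℝ E]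
  [NormedAddCommGroup F] [NormedSpace ℝ F]

/-- The norm of f'(x)v is continuous and positive on the compact product of R with the unit sphere;
homogeneity does the rest. -/
lemma exists_lower_bound_of_injective {R : Set E} (hR : IsCompact R) {f' : E → E →L[ℝ] F}
    (hf' : ContinuousOn f' R) (hinj : ∀ x ∈ R, Function.Injective (f' x)) :
    ∃ m > 0, ∀ x ∈ R, ∀ v, m * ‖v‖ ≤ ‖f' x v‖ := by
  have hcont : ContinuousOn (fun z : E × E => ‖f' z.1 z.2‖) (R ×ˢ Metric.sphere 0 1) :=
    ((hf'.comp continuousOn_fst fun z hz => hz.1).clm_apply continuousOn_snd).norm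
  obtain ⟨m, hm, h⟩ := (hR.prod (isCompact_sphere (0 : E) 1)).exists_forall_le' hcont
    (a := 0) (by
      rintro ⟨x, v⟩ ⟨hx, hv⟩
      refine norm_pos_iff.2 fun h0 => ?_
      have : v = 0 := hinj x hx (by simpa using h0)
      simp [this] at hv)
  refine ⟨m, hm, fun x hx v => ?_⟩
  rcases eq_or_ne v 0 with rfl | hv
  · simp
  have hv' : 0 < ‖v‖ := norm_pos_iff.2 hv
  have := h (x, ‖v‖⁻¹ • v) ⟨hx, by simp [norm_smul, hv'.ne']⟩
  simp only [map_smul, norm_smul, norm_inv, norm_norm] at this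
  rwa [← div_eq_inv_mul, le_div_iff₀ hv'] at this

/-- Near the diagonal the derivative is uniformly close to an injective linear map, and the mean
value inequality on a convex piece applies. Away from the diagonal the distance of the images is
bounded below by compactness. -/
lemma exists_antilipschitz {R : Set E} (hR : IsCompact R) (hconv : Convex ℝ R) {f : E → F}
    {f' : E → E →L[ℝ] F} (hf : ∀ x ∈ R, HasFDerivWithinAt f (f' x) R x)
    (hf' : ContinuousOn f' R) (hinj' : ∀ x ∈ R, Function.Injective (f' x)) (hinj : InjOn f R) :
    ∃ c > 0, ∀ x ∈ R, ∀ y ∈ R, c * ‖x - y‖ ≤ ‖f x - f y‖ := by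
  obtain ⟨m, hm, hlow⟩ := exists_lower_bound_of_injective hR hf' hinj'
  obtain ⟨δ, hδ, hunif⟩ := Metric.uniformContinuousOn_iff.1
    (hR.uniformContinuousOn_of_continuous hf') (m / 2) (by positivity)
  have hfc : ContinuousOn f R := fun x hx => (hf x hx).continuousWithinAt
  have hS : IsCompact ((R ×ˢ R) ∩ {z : E × E | δ ≤ ‖z.1 - z.2‖}) :=
    (hR.prod hR).inter_right (isClosed_le continuous_const (by fun_prop))
  have hcont : ContinuousOn (fun z : E × E => ‖f z.1 - f z.2‖)
      ((R ×ˢ R) ∩ {z : E × E | δ ≤ ‖z.1 - z.2‖}) :=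
    ((hfc.comp continuousOn_fst fun z hz => hz.1.1).sub
      (hfc.comp continuousOn_snd fun z hz => hz.1.2)).norm
  obtain ⟨m', hm', hfar⟩ := hS.exists_forall_le' hcont (a := 0) (by
    rintro ⟨x, y⟩ ⟨⟨hx, hy⟩, hxy⟩
    refine norm_pos_iff.2 fun h0 => ?_
    have : x = y := hinj hx hy (sub_eq_zero.1 h0)
    simp only [mem_ofPred_eq, this, sub_self, norm_zero] at hxy
    linarith)
  obtain ⟨d, hd, hdiam⟩ : ∃ d > 0, ∀ x ∈ R, ∀ y ∈ R, ‖x - y‖ ≤ d := by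
    obtain ⟨C, hC, h⟩ := hR.isBounded.exists_pos_norm_le
    exact ⟨C + C, by positivity, fun x hx y hy => (norm_sub_le _ _).trans
      (add_le_add (h x hx) (h y hy))⟩
  refine ⟨min (m / 2) (m' / d), by positivity, fun x hx y hy => ?_⟩
  rcases lt_or_ge ‖x - y‖ δ with hxy | hxy
  · have h1 := Convex.norm_image_sub_le_of_norm_hasFDerivWithin_le' (s := R ∩ Metric.ball y δ)
      (f := f) (f' := f') (φ := f' y) (C := m / 2) (x := y) (y := x)
      (fun z hz => (hf z hz.1).mono inter_subset_left)
      (fun z hz => by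
        have := hunif z hz.1 y hy hz.2
        rw [dist_eq_norm] at this
        exact this.le)
      (hconv.inter (convex_ball y δ)) ⟨hy, Metric.mem_ball_self hδ⟩
      ⟨hx, by rwa [Metric.mem_ball, dist_eq_norm]⟩
    have h2 := hlow y hy (x - y)
    have h3 : ‖f' y (x - y)‖ ≤ ‖f x - f y‖ + ‖f x - f y - f' y (x - y)‖ := by
      have := norm_sub_le (f x - f y) (f x - f y - f' y (x - y))
      rwa [sub_sub_cancel] at this
    have h4 : min (m / 2) (m' / d) * ‖x - y‖ ≤ m / 2 * ‖x - y‖ :=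
      mul_le_mul_of_nonneg_right (min_le_left _ _) (norm_nonneg _)
    linarith
  · have h1 := hfar (x, y) ⟨⟨hx, hy⟩, hxy⟩
    calc min (m / 2) (m' / d) * ‖x - y‖ ≤ m' / d * d := by
          gcongr
          · exact min_le_right _ _
          · exact hdiam x hx y hy
      _ = m' := by field_simp
      _ ≤ _ := h1

/-- On a convex compact set φ is Lipschitz, so ε φ cannot undo the antilipschitz bound of f, nor the
lower bound of its derivative, once ε is small. -/
lemma exists_perturbation_injOn {R : Set E} (hR : IsCompact R) (hconv : Convex ℝ R) {f φ : E → F}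
    {f' φ' : E → E →L[ℝ] F} (hf : ∀ x ∈ R, HasFDerivWithinAt f (f' x) R x)
    (hf' : ContinuousOn f' R) (hinj' : ∀ x ∈ R, Function.Injective (f' x)) (hinj : InjOn f R)
    (hφ : ∀ x ∈ R, HasFDerivWithinAt φ (φ' x) R x) (hφ' : ContinuousOn φ' R) :
    ∃ ε₀ > 0, ∀ ε : ℝ, |ε| < ε₀ → InjOn (fun x => f x + ε • φ x) R ∧
      ∀ x ∈ R, Function.Injective (f' x + ε • φ' x) := by
  obtain ⟨m, hm, hlow⟩ := exists_lower_bound_of_injective hR hf' hinj'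
  obtain ⟨c, hc, hanti⟩ := exists_antilipschitz hR hconv hf hf' hinj' hinj
  obtain ⟨C, hC⟩ := hR.exists_bound_of_continuousOn hφ'
  have hC0 : 0 < |C| + 1 := by positivity
  have hCC : ∀ x ∈ R, ‖φ' x‖ ≤ |C| + 1 := fun x hx =>
    (hC x hx).trans ((le_abs_self C).trans (by linarith))
  refine ⟨min m c / (|C| + 1), by positivity, fun ε hε => ⟨fun x hx y hy hxy => ?_,
    fun x hx => (injective_iff_map_eq_zero _).2 fun v hv => ?_⟩⟩
  · rw [lt_div_iff₀ hC0] at hε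
    have h1 := hanti x hx y hy
    have h2 := hconv.norm_image_sub_le_of_norm_hasFDerivWithin_le hφ hCC hy hx
    have h3 : f x - f y = -(ε • (φ x - φ y)) := by
      simp only [] at hxy
      rw [smul_sub, neg_sub, sub_eq_sub_iff_add_eq_add, hxy]
      abel
    rw [h3, norm_neg, norm_smul, Real.norm_eq_abs] at h1
    by_contra hne
    have hpos : 0 < ‖x - y‖ := norm_pos_iff.2 (sub_ne_zero.2 hne)
    have h4 := mul_le_mul_of_nonneg_left h2 (abs_nonneg ε)
    have h5 : |ε| * (|C| + 1) < c := hε.trans_le (min_le_right _ _)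
    nlinarith
  · rw [lt_div_iff₀ hC0] at hε
    have h1 := hlow x hx v
    have h3 : f' x v = -(ε • φ' x v) := by
      simpa [add_eq_zero_iff_eq_neg] using hv
    rw [h3, norm_neg, norm_smul, Real.norm_eq_abs] at h1
    by_contra hne
    have hpos : 0 < ‖v‖ := norm_pos_iff.2 hne
    have h2 : ‖φ' x v‖ ≤ (|C| + 1) * ‖v‖ := (φ' x).le_of_opNorm_le (hCC x hx) v
    have h4 := mul_le_mul_of_nonneg_left h2 (abs_nonneg ε)
    have h5 : |ε| * (|C| + 1) < m := hε.trans_le (min_le_left _ _)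
    nlinarith

end Stability

/-! ### Partial derivatives on strip domains and perturbed embeddings -/

lemma fderivWithin_eq_partialWithin {F : Type*} [NormedAddCommGroup F] [NormedSpace ℝ F]
    (D : Set (ℝ × ℝ)) (f : ℝ × ℝ → F) (u v : ℝ × ℝ) :
    fderivWithin ℝ f D u v = v.1 • partialWithin D 0 f u + v.2 • partialWithin D 1 f u := by
  simp only [partialWithin, ← map_smul, ← map_add]
  congr 1
  ext <;> simp [coordVec]

lemma linearIndependent_partialWithin_iff {F : Type*} [NormedAddCommGroup F] [NormedSpace ℝ F]
    (D : Set (ℝ × ℝ)) (f : ℝ × ℝ → F) (u : ℝ × ℝ) :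
    (LinearIndependent ℝ fun i => partialWithin D i f u) ↔
      Function.Injective (fderivWithin ℝ f D u) := by
  have : (fun i => partialWithin D i f u) = ![partialWithin D 0 f u, partialWithin D 1 f u] := by
    ext i : 1
    fin_cases i <;> rfl
  rw [this, LinearIndependent.pair_iff]
  constructor
  · intro h
    refine (injective_iff_map_eq_zero _).2 fun v hv => ?_
    rw [fderivWithin_eq_partialWithin] at hv
    obtain ⟨h1, h2⟩ := h _ _ hv
    exact Prod.ext h1 h2
  · intro h s t hst
    have := (injective_iff_map_eq_zero _).1 h (s, t)
      (by rw [fderivWithin_eq_partialWithin]; exact hst)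
    simpa using this

lemma partialWithin_add_smul {F : Type*} [NormedAddCommGroup F] [NormedSpace ℝ F]
    {D : Set (ℝ × ℝ)} (hD : UniqueDiffOn ℝ D) {f φ : ℝ × ℝ → F} (hf : DifferentiableOn ℝ f D)
    (hφ : DifferentiableOn ℝ φ D) (ε : ℝ) {u : ℝ × ℝ} (hu : u ∈ D) (i : Fin 2) :
    partialWithin D i (fun v => f v + ε • φ v) u
      = partialWithin D i f u + ε • partialWithin D i φ u := by
  have := ((hf u hu).hasFDerivWithinAt.add
    ((hφ u hu).hasFDerivWithinAt.const_smul ε)).fderivWithin (hD u hu)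
  simp only [partialWithin]
  erw [this]
  simp

lemma continuousOn_partialWithin {F : Type*} [NormedAddCommGroup F] [NormedSpace ℝ F]
    {D : Set (ℝ × ℝ)} (hD : UniqueDiffOn ℝ D) {f : ℝ × ℝ → F} (hf : ContDiffOn ℝ 1 f D)
    (i : Fin 2) : ContinuousOn (partialWithin D i f) D :=
  (hf.continuousOn_fderivWithin hD le_rfl).clm_apply continuousOn_const

namespace CenteredStrip

variable (M : CenteredStrip)

lemma IsPlaneEmbedding.contDiffOn_one {M : CenteredStrip} {k : ℕ∞} (hk : 1 ≤ k) {β : ℝ}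
    {p : ℝ × ℝ → Plane} (hp : M.IsPlaneEmbedding k β p) : ContDiffOn ℝ 1 p (M.D β) :=
  hp.contDiffOn.of_le (by exact_mod_cast hk)

lemma hasFDerivWithinAt_comp_chart {F : Type*} [NormedAddCommGroup F] [NormedSpace ℝ F] {β : ℝ}
    (hβ : 0 ≤ β) {f : ℝ × ℝ → F} (hf : DifferentiableOn ℝ f (M.D β)) {x : ℝ × ℝ}
    (hx : x ∈ M.rect) :
    HasFDerivWithinAt (fun x => f (M.chart β x))
      ((fderivWithin ℝ f (M.D β) (M.chart β x)).comp (M.chartDeriv β x)) M.rect x :=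
  (hf _ (M.chart_mapsTo hβ hx)).hasFDerivWithinAt.comp x (M.hasFDerivWithinAt_chart β hx)
    (M.chart_mapsTo hβ)

lemma continuousOn_fderivWithin_comp_chart {F : Type*} [NormedAddCommGroup F] [NormedSpace ℝ F]
    {β : ℝ} (hβ : 0 < β) {f : ℝ × ℝ → F} (hf : ContDiffOn ℝ 1 f (M.D β)) :
    ContinuousOn (fun x => (fderivWithin ℝ f (M.D β) (M.chart β x)).comp (M.chartDeriv β x))
      M.rect := by
  refine ((hf.continuousOn_fderivWithin (M.uniqueDiffOn_D hβ) le_rfl).comp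
    (M.contDiffOn_chart β).continuousOn (M.chart_mapsTo hβ.le)).clm_comp ?_
  have h := (M.contDiffOn_chart β).continuousOn_fderivWithin M.uniqueDiffOn_rect (by simp)
  exact h.congr fun x hx =>
    ((M.hasFDerivWithinAt_chart β hx).fderivWithin (M.uniqueDiffOn_rect x hx)).symm

/-- Embeddings of a strip are stable under small perturbations. -/
lemma IsPlaneEmbedding.exists_add_smul {M : CenteredStrip} {k : ℕ∞} (hk : 1 ≤ k) {β : ℝ}
    (hβ : 0 < β) {p φ : ℝ × ℝ → Plane} (hp : M.IsPlaneEmbedding k β p)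
    (hφ : ContDiffOn ℝ k φ (M.D β)) :
    ∃ ε₀ > 0, ∀ ε : ℝ, |ε| < ε₀ → M.IsPlaneEmbedding k β (fun u => p u + ε • φ u) := by
  have hp1 := hp.contDiffOn_one hk
  have hφ1 : ContDiffOn ℝ 1 φ (M.D β) := hφ.of_le (by exact_mod_cast hk)
  have hD := M.uniqueDiffOn_D hβ
  have hmaps := M.chart_mapsTo hβ.le
  -- The stability lemma needs a convex domain, so it is applied to the composites with the chart on
  -- the rectangle.
  obtain ⟨ε₀, hε₀, h⟩ := exists_perturbation_injOn M.isCompact_rect M.convex_rect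
    (fun x hx => M.hasFDerivWithinAt_comp_chart hβ.le (hp1.differentiableOn one_ne_zero) hx)
    (M.continuousOn_fderivWithin_comp_chart hβ hp1)
    (fun x hx => by
      have h1 := (linearIndependent_partialWithin_iff _ _ _).1 (hp.immersion _ (hmaps hx))
      have h2 := h1.comp (M.chartDeriv_bijective hβ hx).1
      exact h2)
    (fun x hx y hy hxy => M.chart_injOn hβ hx hy (hp.injOn (hmaps hx) (hmaps hy) hxy))
    (fun x hx => M.hasFDerivWithinAt_comp_chart hβ.le (hφ1.differentiableOn one_ne_zero) hx)
    (M.continuousOn_fderivWithin_comp_chart hβ hφ1)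
  refine ⟨ε₀, hε₀, fun ε hε => ⟨hp.contDiffOn.add (hφ.const_smul ε), ?_, ?_⟩⟩
  · rw [← M.image_chart hβ]
    rintro _ ⟨x, hx, rfl⟩ _ ⟨y, hy, rfl⟩ hxy
    rw [(h ε hε).1 hx hy hxy]
  · rw [← M.image_chart hβ]
    rintro _ ⟨x, hx, rfl⟩
    rw [M.image_chart hβ]
    have hpu := (hp1.differentiableOn one_ne_zero _ (hmaps hx)).hasFDerivWithinAt
    have hφu := (hφ1.differentiableOn one_ne_zero _ (hmaps hx)).hasFDerivWithinAt
    have hd := (hpu.add (hφu.const_smul ε)).fderivWithin (hD _ (hmaps hx))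
    refine (linearIndependent_partialWithin_iff _ _ _).2 ?_
    erw [hd]
    intro v w hvw
    obtain ⟨v, rfl⟩ := (M.chartDeriv_bijective hβ hx).2 v
    obtain ⟨w, rfl⟩ := (M.chartDeriv_bijective hβ hx).2 w
    rw [(h ε hε).2 x hx (a₁ := v) (a₂ := w) hvw]

end CenteredStrip

end ElasticStrip
end

noncomputable section

open Set Filter Topology MeasureTheory

namespace ElasticStrip

namespace CenteredStrip

variable (M : CenteredStrip)

/-! ### Energy, stress and the first variation -/

/-- The bilinear form whose quadratic form is the energy density. -/
def density (Y ν : ℝ) (E F : Fin 2 → Fin 2 → ℝ) (u : ℝ × ℝ) : ℝ :=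
  1 / 2 * (lameLambda Y ν * (((M.G u)⁻¹ * E 0 0 + E 1 1) * ((M.G u)⁻¹ * F 0 0 + F 1 1))
    + 2 * lameMu Y ν * ((M.G u)⁻¹ ^ 2 * (E 0 0 * F 0 0) + 2 * (M.G u)⁻¹ * (E 0 1 * F 0 1)
      + E 1 1 * F 1 1)) * √(M.G u)

lemma strain_symm (β : ℝ) (p : ℝ × ℝ → Plane) {u : ℝ × ℝ} (hu : u ∈ M.D 1) :
    M.strain β p 1 0 u = M.strain β p 0 1 u := by
  simp only [strain, inducedMetric, M.g01 hu, M.g10 hu]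
  rw [real_inner_comm]

lemma energy_eq (Y ν : ℝ) {β : ℝ} (hβ : 0 < β) (hβ' : β ≤ 1) (p : ℝ × ℝ → Plane) :
    M.energy Y ν β p = ∫ u in M.D β,
      M.density Y ν (fun i j => M.strain β p i j u) (fun i j => M.strain β p i j u) u := by
  refine setIntegral_congr_fun (M.isCompact_D hβ).measurableSet fun u hu => ?_
  have hu := M.D_subset hβ' hu
  simp only [density, stiffness, Fin.sum_univ_two, M.inv_g hu, M.det_g hu, M.strain_symm β p hu, G]
  simp
  left
  ring

lemma stress_00 (Y ν β : ℝ) (p : ℝ × ℝ → Plane) {u : ℝ × ℝ} (hu : u ∈ M.D 1) :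
    M.stress Y ν β p 0 0 u = (M.G u)⁻¹ * (lameLambda Y ν * ((M.G u)⁻¹ * M.strain β p 0 0 u
      + M.strain β p 1 1 u) + 2 * lameMu Y ν * ((M.G u)⁻¹ * M.strain β p 0 0 u)) := by
  simp only [stress, stiffness, Fin.sum_univ_two, M.inv_g hu, M.strain_symm β p hu, G]
  simp
  ring

lemma stress_01 (Y ν β : ℝ) (p : ℝ × ℝ → Plane) {u : ℝ × ℝ} (hu : u ∈ M.D 1) :
    M.stress Y ν β p 0 1 u = 2 * lameMu Y ν * ((M.G u)⁻¹ * M.strain β p 0 1 u) := by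
  simp only [stress, stiffness, Fin.sum_univ_two, M.inv_g hu, M.strain_symm β p hu, G]
  simp
  ring

lemma stress_10 (Y ν β : ℝ) (p : ℝ × ℝ → Plane) {u : ℝ × ℝ} (hu : u ∈ M.D 1) :
    M.stress Y ν β p 1 0 u = 2 * lameMu Y ν * ((M.G u)⁻¹ * M.strain β p 0 1 u) := by
  simp only [stress, stiffness, Fin.sum_univ_two, M.inv_g hu, M.strain_symm β p hu, G]
  simp
  ring

lemma stress_11 (Y ν β : ℝ) (p : ℝ × ℝ → Plane) {u : ℝ × ℝ} (hu : u ∈ M.D 1) :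
    M.stress Y ν β p 1 1 u = lameLambda Y ν * ((M.G u)⁻¹ * M.strain β p 0 0 u
      + M.strain β p 1 1 u) + 2 * lameMu Y ν * M.strain β p 1 1 u := by
  simp only [stress, stiffness, Fin.sum_univ_two, M.inv_g hu, M.strain_symm β p hu, G]
  simp
  ring

/-- The densitized first Piola-Kirchhoff stress `√(det g) Sⁱʲ ∂ᵢp`. -/
def flux (Y ν β : ℝ) (p : ℝ × ℝ → Plane) (j : Fin 2) (u : ℝ × ℝ) : Plane :=
  √(M.G u) • (M.stress Y ν β p 0 j u • partialWithin (M.D β) 0 p u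
    + M.stress Y ν β p 1 j u • partialWithin (M.D β) 1 p u)

/-- The first variation of the strain tensor of `p` in the direction `φ`. -/
def strainVariation (β : ℝ) (p φ : ℝ × ℝ → Plane) (i j : Fin 2) (u : ℝ × ℝ) : ℝ :=
  (inner ℝ (partialWithin (M.D β) i p u) (partialWithin (M.D β) j φ u)
    + inner ℝ (partialWithin (M.D β) i φ u) (partialWithin (M.D β) j p u)) / 2

/-- Symmetry of the stress turns its pairing with the symmetrized variation of the strain into a
pairing of the first Piola-Kirchhoff stress with the gradient of φ. -/
lemma two_mul_density_strainVariation (Y ν β : ℝ) (p φ : ℝ × ℝ → Plane) {u : ℝ × ℝ}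
    (hu : u ∈ M.D 1) :
    2 * M.density Y ν (fun i j => M.strain β p i j u) (fun i j => M.strainVariation β p φ i j u) u
      = inner ℝ (M.flux Y ν β p 0 u) (partialWithin (M.D β) 0 φ u)
        + inner ℝ (M.flux Y ν β p 1 u) (partialWithin (M.D β) 1 φ u) := by
  simp only [flux, M.stress_00 Y ν β p hu, M.stress_01 Y ν β p hu, M.stress_10 Y ν β p hu,
    M.stress_11 Y ν β p hu, real_inner_smul_left, inner_add_left, density, strainVariation]
  rw [real_inner_comm (partialWithin (M.D β) 0 p u) (partialWithin (M.D β) 0 φ u),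
    real_inner_comm (partialWithin (M.D β) 1 p u) (partialWithin (M.D β) 1 φ u),
    real_inner_comm (partialWithin (M.D β) 1 p u) (partialWithin (M.D β) 0 φ u)]
  ring

/-- The expansion in ε is exact because the strain is quadratic in the map. -/
lemma strain_add_smul {β : ℝ} (hβ : 0 < β) {p φ : ℝ × ℝ → Plane}
    (hp : DifferentiableOn ℝ p (M.D β)) (hφ : DifferentiableOn ℝ φ (M.D β)) (ε : ℝ) {u : ℝ × ℝ}
    (hu : u ∈ M.D β) (i j : Fin 2) :
    M.strain β (fun v => p v + ε • φ v) i j u = M.strain β p i j u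
      + ε * M.strainVariation β p φ i j u
      + ε ^ 2 * (M.inducedMetric β φ i j u / 2) := by
  simp only [strain, strainVariation, inducedMetric,
    partialWithin_add_smul (M.uniqueDiffOn_D hβ) hp hφ ε hu, inner_add_left, inner_add_right,
    real_inner_smul_left, real_inner_smul_right]
  ring

lemma continuousOn_G {β : ℝ} (hβ : β ≤ 1) : ContinuousOn M.G (M.D β) :=
  M.G_smooth.continuousOn.mono (M.D_subset hβ)

lemma continuousOn_inv_G {β : ℝ} (hβ : β ≤ 1) : ContinuousOn (fun u => (M.G u)⁻¹) (M.D β) :=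
  (M.continuousOn_G hβ).inv₀ fun _ hu => (M.G_pos (M.D_subset hβ hu)).ne'

lemma continuousOn_density (Y ν : ℝ) {β : ℝ} (hβ : β ≤ 1) {E F : Fin 2 → Fin 2 → ℝ × ℝ → ℝ}
    (hE : ∀ i j, ContinuousOn (E i j) (M.D β)) (hF : ∀ i j, ContinuousOn (F i j) (M.D β)) :
    ContinuousOn (fun u => M.density Y ν (fun i j => E i j u) (fun i j => F i j u) u) (M.D β) := by
  have h1 := M.continuousOn_inv_G hβ
  have h2 := (M.continuousOn_G hβ).sqrt
  have h3 := hE 0 0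
  have h4 := hE 0 1
  have h5 := hE 1 1
  have h6 := hF 0 0
  have h7 := hF 0 1
  have h8 := hF 1 1
  unfold density
  fun_prop

lemma continuousOn_inducedMetric {β : ℝ} (hβ : 0 < β) {p : ℝ × ℝ → Plane}
    (hp : ContDiffOn ℝ 1 p (M.D β)) (i j : Fin 2) : ContinuousOn (M.inducedMetric β p i j) (M.D β) :=
  (continuousOn_partialWithin (M.uniqueDiffOn_D hβ) hp i).inner
    (continuousOn_partialWithin (M.uniqueDiffOn_D hβ) hp j)

lemma continuousOn_strain {β : ℝ} (hβ : 0 < β) (hβ' : β ≤ 1) {p : ℝ × ℝ → Plane}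
    (hp : ContDiffOn ℝ 1 p (M.D β)) (i j : Fin 2) : ContinuousOn (M.strain β p i j) (M.D β) :=
  ((M.continuousOn_inducedMetric hβ hp i j).sub
    ((M.g_smooth i j).continuousOn.mono (M.D_subset hβ'))).div_const 2

lemma continuousOn_strainVariation {β : ℝ} (hβ : 0 < β) {p φ : ℝ × ℝ → Plane}
    (hp : ContDiffOn ℝ 1 p (M.D β)) (hφ : ContDiffOn ℝ 1 φ (M.D β)) (i j : Fin 2) :
    ContinuousOn (M.strainVariation β p φ i j) (M.D β) :=
  (((continuousOn_partialWithin (M.uniqueDiffOn_D hβ) hp i).inner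
    (continuousOn_partialWithin (M.uniqueDiffOn_D hβ) hφ j)).add
    ((continuousOn_partialWithin (M.uniqueDiffOn_D hβ) hφ i).inner
    (continuousOn_partialWithin (M.uniqueDiffOn_D hβ) hp j))).div_const 2

lemma continuousOn_flux (Y ν : ℝ) {β : ℝ} (hβ : 0 < β) (hβ' : β ≤ 1) {p : ℝ × ℝ → Plane}
    (hp : ContDiffOn ℝ 1 p (M.D β)) (j : Fin 2) : ContinuousOn (M.flux Y ν β p j) (M.D β) := by
  have h1 := M.continuousOn_inv_G hβ'
  have h2 := (M.continuousOn_G hβ').sqrt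
  have h3 := M.continuousOn_strain hβ hβ' hp
  have h4 := h3 0 0
  have h5 := h3 0 1
  have h6 := h3 1 1
  have hs : ∀ i, ContinuousOn (M.stress Y ν β p i j) (M.D β) := by
    intro i
    fin_cases i <;> fin_cases j
    · exact ContinuousOn.congr (by fun_prop) fun u hu => M.stress_00 Y ν β p (M.D_subset hβ' hu)
    · exact ContinuousOn.congr (by fun_prop) fun u hu => M.stress_01 Y ν β p (M.D_subset hβ' hu)
    · exact ContinuousOn.congr (by fun_prop) fun u hu => M.stress_10 Y ν β p (M.D_subset hβ' hu)
    · exact ContinuousOn.congr (by fun_prop) fun u hu => M.stress_11 Y ν β p (M.D_subset hβ' hu)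
  have hd := continuousOn_partialWithin (M.uniqueDiffOn_D hβ) hp
  exact h2.smul (((hs 0).smul (hd 0)).add ((hs 1).smul (hd 1)))

lemma density_expand (Y ν ε : ℝ) (E F H : Fin 2 → Fin 2 → ℝ) (u : ℝ × ℝ) :
    M.density Y ν (fun i j => E i j + ε * F i j + ε ^ 2 * H i j)
      (fun i j => E i j + ε * F i j + ε ^ 2 * H i j) u
    = M.density Y ν E E u + ε * (2 * M.density Y ν E F u)
      + ε ^ 2 * (M.density Y ν F F u + 2 * M.density Y ν E H u)
      + ε ^ 3 * (2 * M.density Y ν F H u) + ε ^ 4 * M.density Y ν H H u := by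
  unfold density
  ring

lemma integral_quartic {α : Type*} [MeasurableSpace α] {μ : Measure α} {f₀ f₁ f₂ f₃ f₄ : α → ℝ}
    (h₀ : Integrable f₀ μ) (h₁ : Integrable f₁ μ) (h₂ : Integrable f₂ μ) (h₃ : Integrable f₃ μ)
    (h₄ : Integrable f₄ μ) (ε : ℝ) :
    ∫ x, (f₀ x + ε * f₁ x + ε ^ 2 * f₂ x + ε ^ 3 * f₃ x + ε ^ 4 * f₄ x) ∂μ
      = ∫ x, f₀ x ∂μ + ε * ∫ x, f₁ x ∂μ + ε ^ 2 * ∫ x, f₂ x ∂μ + ε ^ 3 * ∫ x, f₃ x ∂μ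
        + ε ^ 4 * ∫ x, f₄ x ∂μ := by
  have a₁ : Integrable (fun x => f₀ x + ε * f₁ x) μ := h₀.add (h₁.const_mul _)
  have a₂ : Integrable (fun x => f₀ x + ε * f₁ x + ε ^ 2 * f₂ x) μ := a₁.add (h₂.const_mul _)
  have a₃ : Integrable (fun x => f₀ x + ε * f₁ x + ε ^ 2 * f₂ x + ε ^ 3 * f₃ x) μ :=
    a₂.add (h₃.const_mul _)
  rw [integral_add a₃ (h₄.const_mul _), integral_add a₂ (h₃.const_mul _),
    integral_add a₁ (h₂.const_mul _), integral_add h₀ (h₁.const_mul _), integral_const_mul,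
    integral_const_mul, integral_const_mul, integral_const_mul]

/-- The weak equilibrium equations satisfied by a minimizer. -/
theorem IsMinimizer.integral_flux_eq_zero {M : CenteredStrip} {k : ℕ∞} (hk : 1 ≤ k)
    {Y ν β : ℝ} (hβ : 0 < β) (hβ' : β ≤ 1) {p : ℝ × ℝ → Plane} (hp : M.IsMinimizer k Y ν β p)
    {φ : ℝ × ℝ → Plane} (hφ : ContDiffOn ℝ k φ (M.D β)) :
    ∫ u in M.D β, (inner ℝ (M.flux Y ν β p 0 u) (partialWithin (M.D β) 0 φ u)
      + inner ℝ (M.flux Y ν β p 1 u) (partialWithin (M.D β) 1 φ u)) = 0 := by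
  obtain ⟨ε₀, hε₀, hemb⟩ := hp.embedding.exists_add_smul hk hβ hφ
  have hp1 := hp.embedding.contDiffOn_one hk
  have hφ1 : ContDiffOn ℝ 1 φ (M.D β) := hφ.of_le (by exact_mod_cast hk)
  have hms := (M.isCompact_D hβ).measurableSet
  have hE := M.continuousOn_strain hβ hβ' hp1
  have hF := M.continuousOn_strainVariation hβ hp1 hφ1
  have hH : ∀ i j, ContinuousOn (fun u => M.inducedMetric β φ i j u / 2) (M.D β) := fun i j =>
    (M.continuousOn_inducedMetric hβ hφ1 i j).div_const 2
  have hint : ∀ {f : ℝ × ℝ → ℝ}, ContinuousOn f (M.D β) → IntegrableOn f (M.D β) :=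
    fun hf => hf.integrableOn_compact (M.isCompact_D hβ)
  have i0 := hint (M.continuousOn_density Y ν hβ' hE hE)
  have i1 := (hint (M.continuousOn_density Y ν hβ' hE hF)).const_mul 2
  have i2 := (hint (M.continuousOn_density Y ν hβ' hF hF)).add
    ((hint (M.continuousOn_density Y ν hβ' hE hH)).const_mul 2)
  have i3 := (hint (M.continuousOn_density Y ν hβ' hF hH)).const_mul 2
  have i4 := hint (M.continuousOn_density Y ν hβ' hH hH)
  obtain ⟨W1, hW1⟩ : ∃ c, c = ∫ u in M.D β, 2 * M.density Y ν (fun i j => M.strain β p i j u)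
    (fun i j => M.strainVariation β p φ i j u) u := ⟨_, rfl⟩
  -- The energy along the segment is exactly a quartic polynomial in ε, so no differentiation under
  -- the integral sign is needed; only the linear coefficient `W1` matters.
  have hexp : ∃ W2 W3 W4 : ℝ, ∀ ε : ℝ, M.energy Y ν β (fun u => p u + ε • φ u)
      = M.energy Y ν β p + ε * W1 + ε ^ 2 * W2 + ε ^ 3 * W3 + ε ^ 4 * W4 := by
    rw [hW1, M.energy_eq Y ν hβ hβ' p]
    refine ⟨_, _, _, fun ε => Eq.trans ?_ (integral_quartic i0 i1 i2 i3 i4 ε)⟩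
    rw [M.energy_eq Y ν hβ hβ']
    refine setIntegral_congr_fun hms fun u hu => ?_
    simp only [M.strain_add_smul hβ (hp1.differentiableOn one_ne_zero)
      (hφ1.differentiableOn one_ne_zero) ε hu]
    exact M.density_expand Y ν ε _ _ _ u
  obtain ⟨W2, W3, W4, hW⟩ := hexp
  have hmin : IsLocalMin (fun ε : ℝ => M.energy Y ν β p + ε * W1 + ε ^ 2 * W2 + ε ^ 3 * W3
      + ε ^ 4 * W4) 0 := by
    filter_upwards [Metric.ball_mem_nhds (0 : ℝ) hε₀] with ε hε
    have := hp.le _ (hemb ε (by simpa using hε))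
    rw [hW] at this
    simpa using this
  have hder : HasDerivAt (fun ε : ℝ => M.energy Y ν β p + ε * W1 + ε ^ 2 * W2 + ε ^ 3 * W3
      + ε ^ 4 * W4) W1 0 := by
    have := (((((hasDerivAt_id (0 : ℝ)).mul_const W1).const_add (M.energy Y ν β p)).add
      ((hasDerivAt_pow 2 (0 : ℝ)).mul_const W2)).add
      ((hasDerivAt_pow 3 (0 : ℝ)).mul_const W3)).add ((hasDerivAt_pow 4 (0 : ℝ)).mul_const W4)
    refine this.congr_deriv ?_
    simp
  have h0 : W1 = 0 := hmin.hasDerivAt_eq_zero hder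
  rw [← h0, hW1]
  exact setIntegral_congr_fun hms fun u hu =>
    (M.two_mul_density_strainVariation Y ν β p φ (M.D_subset hβ' hu)).symm

/-- The weak equilibrium equations in normalized coordinates. -/
theorem IsMinimizer.integral_rect_flux_eq_zero {M : CenteredStrip} {k : ℕ∞} (hk : 1 ≤ k)
    {Y ν β : ℝ} (hβ : 0 < β) (hβ' : β ≤ 1) {p : ℝ × ℝ → Plane} (hp : M.IsMinimizer k Y ν β p)
    {φ : ℝ × ℝ → Plane} (hφ : ContDiffOn ℝ k φ (M.D β)) :
    ∫ x in M.rect, M.B x.1 *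
      (inner ℝ (M.flux Y ν β p 0 (M.chart β x)) (partialWithin (M.D β) 0 φ (M.chart β x))
        + inner ℝ (M.flux Y ν β p 1 (M.chart β x)) (partialWithin (M.D β) 1 φ (M.chart β x)))
      = 0 := by
  have h := hp.integral_flux_eq_zero hk hβ hβ' hφ
  rw [M.setIntegral_D hβ] at h
  simp only [smul_eq_mul, mul_assoc] at h
  rw [integral_const_mul] at h
  exact (mul_eq_zero.1 h).resolve_left hβ.ne'

end CenteredStrip

end ElasticStrip
end

noncomputable section

open Set Filter Topology MeasureTheory

namespace ElasticStrip

/-! ### Fundamental lemma of the calculus of variations -/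

/-- Test functions supported inside give vanishing almost everywhere; continuity extends it to every
point, the endpoints included. -/
lemma eqOn_zero_of_integral_contDiff_mul_eq_zero {a b : ℝ} (hab : a < b) {H : ℝ → ℝ}
    (hH : ContinuousOn H (Icc a b))
    (h : ∀ χ : ℝ → ℝ, ContDiff ℝ ∞ χ → tsupport χ ⊆ Ioo a b → ∫ x in Icc a b, χ x * H x = 0) :
    ∀ x ∈ Icc a b, H x = 0 := by
  have hae := isOpen_Ioo.ae_eq_zero_of_integral_contDiff_smul_eq_zero (U := Ioo a b)
    (μ := volume) (f := H)
    ((hH.mono Ioo_subset_Icc_self).locallyIntegrableOn measurableSet_Ioo)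
    (fun χ hχ _ hsupp => by
      rw [← h χ hχ hsupp]
      refine (setIntegral_eq_integral_of_forall_compl_eq_zero fun x hx => ?_).symm
      have : χ x = 0 := image_eq_zero_of_notMem_tsupport fun h' => hx
        (Ioo_subset_Icc_self (hsupp h'))
      simp [this])
  refine Measure.eqOn_of_ae_eq (μ := volume) (f := H) (g := fun _ => 0) ?_ hH
    continuousOn_const ?_
  · rw [← Measure.restrict_congr_set Ioo_ae_eq_Icc]
    exact (ae_restrict_iff' measurableSet_Ioo).2 hae
  · rw [interior_Icc, closure_Ioo hab.ne]

/-- Test fields are built from antiderivatives because the weak equations see the derivative of the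
profile, which is the function to be prescribed. -/
lemma exists_contDiff_hasDerivAt {χ : ℝ → ℝ} (hχ : ContDiff ℝ ∞ χ) :
    ∃ Θ : ℝ → ℝ, ContDiff ℝ ∞ Θ ∧ ∀ x, HasDerivAt Θ (χ x) x := by
  have hd : ∀ x, HasDerivAt (fun x => ∫ t in (0 : ℝ)..x, χ t) (χ x) x := fun x =>
    hχ.continuous.integral_hasStrictDerivAt 0 x |>.hasDerivAt
  refine ⟨_, contDiff_infty_iff_deriv.2 ⟨fun x => (hd x).differentiableAt, ?_⟩, hd⟩
  rwa [show deriv (fun x => ∫ t in (0 : ℝ)..x, χ t) = χ from funext fun x => (hd x).deriv]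

lemma continuousOn_setIntegral_snd {F : Type*} [NormedAddCommGroup F] [NormedSpace ℝ F]
    {T R : Set ℝ} (hT : IsCompact T) (hR : IsCompact R) {f : ℝ × ℝ → F}
    (hf : ContinuousOn f (T ×ˢ R)) : ContinuousOn (fun s => ∫ r in R, f (s, r)) T := by
  obtain ⟨C, hC⟩ := (hT.prod hR).exists_bound_of_continuousOn hf
  refine continuousOn_of_dominated (bound := fun _ => C) (fun s hs => ?_) (fun s hs => ?_) ?_ ?_
  · exact (hf.comp (by fun_prop) fun r hr => ⟨hs, hr⟩ : ContinuousOn (fun r => f (s, r)) R)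
      |>.aestronglyMeasurable_of_isCompact hR hR.measurableSet
  · exact (ae_restrict_iff' hR.measurableSet).2 (ae_of_all _ fun r hr => hC _ ⟨hs, hr⟩)
  · have : IsFiniteMeasure (volume.restrict R) := ⟨by simpa using hR.measure_lt_top⟩
    exact integrable_const C
  · exact (ae_restrict_iff' hR.measurableSet).2 (ae_of_all _ fun r hr =>
      hf.comp (by fun_prop) fun s hs => ⟨hs, hr⟩)

/-! ### The quarter turn of the plane -/

/-- The rotation of the plane by a right angle. -/
def rot : Plane →L[ℝ] Plane :=
  LinearMap.toContinuousLinearMap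
    { toFun := fun v => !₂[-v 1, v 0]
      map_add' := fun v w => by ext i; fin_cases i <;> simp; ring
      map_smul' := fun c v => by ext i; fin_cases i <;> simp }

@[simp] lemma rot_apply_zero (v : Plane) : rot v 0 = -v 1 := by simp [rot]

@[simp] lemma rot_apply_one (v : Plane) : rot v 1 = v 0 := by simp [rot]

lemma inner_plane (v w : Plane) : inner ℝ v w = v 0 * w 0 + v 1 * w 1 := by
  simp [PiLp.inner_apply, mul_comm]

lemma inner_rot_self (v : Plane) : inner ℝ v (rot v) = 0 := by
  simp [inner_plane]; ring

lemma inner_rot_comm (v w : Plane) : inner ℝ v (rot w) = -inner ℝ w (rot v) := by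
  simp [inner_plane]; ring

lemma partialWithin_eq_of_hasFDerivWithinAt {F : Type*} [NormedAddCommGroup F] [NormedSpace ℝ F]
    {D : Set (ℝ × ℝ)} (hD : UniqueDiffOn ℝ D) {f : ℝ × ℝ → F} {f' : ℝ × ℝ →L[ℝ] F} {u : ℝ × ℝ}
    (hu : u ∈ D) (hf : HasFDerivWithinAt f f' D u) (i : Fin 2) :
    partialWithin D i f u = f' (coordVec i) := by
  rw [partialWithin, hf.fderivWithin (hD u hu)]

/-! ### Balance laws on cross sections and transverse test fields -/

namespace CenteredStrip

variable {M : CenteredStrip} {k : ℕ∞} {Y ν β : ℝ} {p : ℝ × ℝ → Plane}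

lemma rect_eq (M : CenteredStrip) : M.rect = Icc M.a M.b ×ˢ Icc (-1) 1 := rfl

lemma hasFDerivWithinAt_smul_fst {F : Type*} [NormedAddCommGroup F] [NormedSpace ℝ F]
    {D : Set (ℝ × ℝ)} {Θ : ℝ → ℝ} {c : ℝ} {ψ : ℝ × ℝ → F} {u : ℝ × ℝ}
    (hΘ : HasDerivAt Θ c u.1) (hψ : DifferentiableWithinAt ℝ ψ D u) :
    HasFDerivWithinAt (fun u => Θ u.1 • ψ u)
      (Θ u.1 • fderivWithin ℝ ψ D u
        + (c • ContinuousLinearMap.fst ℝ ℝ ℝ).smulRight (ψ u)) D u := by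
  have h1 : HasFDerivWithinAt (fun u : ℝ × ℝ => Θ u.1) (c • ContinuousLinearMap.fst ℝ ℝ ℝ) D u :=
    hΘ.comp_hasFDerivWithinAt u hasFDerivWithinAt_fst
  exact h1.smul hψ.hasFDerivWithinAt

/-- A vector field that does no work to first order is balanced on every cross section. -/
theorem IsMinimizer.integral_flux_inner_eq_zero (hk : 1 ≤ k) (hβ : 0 < β) (hβ' : β ≤ 1)
    (hp : M.IsMinimizer k Y ν β p) {ψ : ℝ × ℝ → Plane} (hψ : ContDiffOn ℝ k ψ (M.D β))
    (hwork : ∀ u ∈ M.D β, inner ℝ (M.flux Y ν β p 0 u) (partialWithin (M.D β) 0 ψ u)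
      + inner ℝ (M.flux Y ν β p 1 u) (partialWithin (M.D β) 1 ψ u) = 0) {s : ℝ}
    (hs : s ∈ Icc M.a M.b) :
    ∫ r in Icc (-1) 1, inner ℝ (M.flux Y ν β p 0 (M.chart β (s, r))) (ψ (M.chart β (s, r))) = 0 := by
  have hp1 := hp.embedding.contDiffOn_one hk
  have hψ1 : ContDiffOn ℝ 1 ψ (M.D β) := hψ.of_le (by exact_mod_cast hk)
  have hmaps := M.chart_mapsTo hβ.le
  have hchart := (M.contDiffOn_chart β).continuousOn
  have hf : ContinuousOn (fun x => inner ℝ (M.flux Y ν β p 0 (M.chart β x)) (ψ (M.chart β x)))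
      M.rect := ((M.continuousOn_flux Y ν hβ hβ' hp1 0).comp hchart hmaps).inner
    (hψ.continuousOn.comp hchart hmaps)
  have hB : ContinuousOn M.B (Icc M.a M.b) := M.B_smooth.continuousOn
  have hB' : ContinuousOn (fun x : ℝ × ℝ => M.B x.1) M.rect :=
    hB.comp continuousOn_fst fun x hx => hx.1
  have hHc := hB.mul (continuousOn_setIntegral_snd isCompact_Icc isCompact_Icc hf)
  have key := eqOn_zero_of_integral_contDiff_mul_eq_zero M.hab hHc (fun χ hχ _ => ?_) s hs
  · exact (mul_eq_zero.1 key).resolve_left (M.B_pos s hs).ne'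
  -- Testing with Θ(u¹) ψ, where Θ' = χ: the terms with Θ itself are Θ times the work of ψ and
  -- vanish, leaving χ times the pairing of the flux with ψ. The ends of the strip are free, so Θ
  -- need not vanish there.
  obtain ⟨Θ, hΘ, hΘ'⟩ := exists_contDiff_hasDerivAt hχ
  have hφ : ContDiffOn ℝ k (fun u : ℝ × ℝ => Θ u.1 • ψ u) (M.D β) :=
    ((hΘ.of_le (by exact_mod_cast le_top)).comp contDiff_fst).contDiffOn.smul hψ
  have hEL := hp.integral_rect_flux_eq_zero hk hβ hβ' hφ
  have hEL' : ∫ x in M.rect, χ x.1 * (M.B x.1 *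
      inner ℝ (M.flux Y ν β p 0 (M.chart β x)) (ψ (M.chart β x))) = 0 := by
    rw [← hEL]
    refine setIntegral_congr_fun M.isCompact_rect.measurableSet fun x hx => ?_
    have hu := hmaps hx
    have hd := hasFDerivWithinAt_smul_fst (D := M.D β) (ψ := ψ) (hΘ' (M.chart β x).1)
      (hψ1.differentiableOn one_ne_zero _ hu)
    have hw := hwork _ hu
    have e0 := partialWithin_eq_of_hasFDerivWithinAt (M.uniqueDiffOn_D hβ) hu hd 0
    have e1 := partialWithin_eq_of_hasFDerivWithinAt (M.uniqueDiffOn_D hβ) hu hd 1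
    simp only [e0, e1]
    simp only [coordVec, add_apply, smul_apply,
      ContinuousLinearMap.smulRight_apply, ContinuousLinearMap.coe_fst', Matrix.cons_val_zero,
      Matrix.cons_val_one, Matrix.cons_val_fin_one, smul_eq_mul, mul_one, mul_zero, zero_smul,
      add_zero, inner_add_right, real_inner_smul_right]
    have e2 : partialWithin (M.D β) 0 ψ (M.chart β x)
      = fderivWithin ℝ ψ (M.D β) (M.chart β x) (1, 0) := rfl
    have e3 : partialWithin (M.D β) 1 ψ (M.chart β x)
      = fderivWithin ℝ ψ (M.D β) (M.chart β x) (0, 1) := rfl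
    rw [e2, e3] at hw
    have e4 : (M.chart β x).1 = x.1 := rfl
    rw [e4]
    linear_combination (-(M.B x.1) * Θ x.1) * hw
  rw [rect_eq, Measure.volume_eq_prod, setIntegral_prod] at hEL'
  · rw [← hEL']
    refine setIntegral_congr_fun measurableSet_Icc fun s hs => ?_
    simp only [integral_const_mul]
    rfl
  · rw [← Measure.volume_eq_prod]
    refine ContinuousOn.integrableOn_compact M.isCompact_rect ?_
    exact (hχ.continuous.comp continuous_fst).continuousOn.mul (hB'.mul hf)

/-- Balance of forces on every cross section. -/
theorem IsMinimizer.force_balance (hk : 1 ≤ k) (hβ : 0 < β) (hβ' : β ≤ 1)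
    (hp : M.IsMinimizer k Y ν β p) (v : Plane) {s : ℝ} (hs : s ∈ Icc M.a M.b) :
    ∫ r in Icc (-1) 1, inner ℝ (M.flux Y ν β p 0 (M.chart β (s, r))) v = 0 := by
  refine hp.integral_flux_inner_eq_zero hk hβ hβ' (ψ := fun _ => v) contDiffOn_const
    (fun u hu => ?_) hs
  simp [partialWithin]

/-- Balance of moments on every cross section. -/
theorem IsMinimizer.moment_balance (hk : 1 ≤ k) (hβ : 0 < β) (hβ' : β ≤ 1)
    (hp : M.IsMinimizer k Y ν β p) {s : ℝ} (hs : s ∈ Icc M.a M.b) :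
    ∫ r in Icc (-1) 1, inner ℝ (M.flux Y ν β p 0 (M.chart β (s, r)))
      (rot (p (M.chart β (s, r)))) = 0 := by
  have hp1 := hp.embedding.contDiffOn_one hk
  refine hp.integral_flux_inner_eq_zero hk hβ hβ' (ψ := fun u => rot (p u))
    (rot.contDiff.comp_contDiffOn hp.embedding.contDiffOn) (fun u hu => ?_) hs
  have hd := rot.hasFDerivAt.comp_hasFDerivWithinAt u
    (hp1.differentiableOn one_ne_zero u hu).hasFDerivWithinAt
  have e : ∀ i, partialWithin (M.D β) i (fun u => rot (p u)) u
      = rot (partialWithin (M.D β) i p u) := fun i =>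
    partialWithin_eq_of_hasFDerivWithinAt (M.uniqueDiffOn_D hβ) hu hd i
  have hu1 := M.D_subset hβ' hu
  simp only [e, flux, real_inner_smul_left, inner_add_left, inner_rot_self,
    M.stress_01 Y ν β p hu1, M.stress_10 Y ν β p hu1]
  -- An infinitesimal rotation does no work: the diagonal terms vanish since v is orthogonal to its
  -- quarter turn, and the mixed terms cancel because the stress is symmetric and the quarter turn
  -- skew.
  rw [inner_rot_comm (partialWithin (M.D β) 1 p u) (partialWithin (M.D β) 0 p u)]
  ring

/-- The weak equilibrium equations for product test fields that oscillate across the strip. -/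
theorem IsMinimizer.integral_transverse (hk : 1 ≤ k) (hβ : 0 < β) (hβ' : β ≤ 1)
    (hp : M.IsMinimizer k Y ν β p) {χ χ' η η' : ℝ → ℝ} (hχ : ContDiff ℝ ∞ χ)
    (hχ' : ∀ x, HasDerivAt χ (χ' x) x) (hη : ContDiff ℝ ∞ η) (hη' : ∀ x, HasDerivAt η (η' x) x)
    (v : Plane) :
    ∫ x in M.rect, M.B x.1 *
      (β * (χ' x.1 * η (M.B x.1 * x.2) * inner ℝ (M.flux Y ν β p 0 (M.chart β x)) v)
        + χ x.1 * η' (M.B x.1 * x.2) * inner ℝ (M.flux Y ν β p 1 (M.chart β x)) v) = 0 := by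
  -- The profile depends on u²/β = B r rather than on r: its u¹-derivative then vanishes, and its
  -- u²-derivative carries the factor 1/β that puts the transverse flux in front.
  have hη1 : ContDiff ℝ ∞ (fun y => η (y / β)) := hη.comp (contDiff_id.div_const β)
  have hφ : ContDiff ℝ ∞ (fun u : ℝ × ℝ => χ u.1 • (η (u.2 / β) • v)) :=
    (hχ.comp contDiff_fst).smul ((hη1.comp contDiff_snd).smul contDiff_const)
  have hEL := hp.integral_rect_flux_eq_zero hk hβ hβ'
    (hφ.of_le (by exact_mod_cast le_top)).contDiffOn
  rw [← mul_zero β, ← hEL, ← integral_const_mul]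
  refine setIntegral_congr_fun M.isCompact_rect.measurableSet fun x hx => ?_
  have hu := M.chart_mapsTo hβ.le hx
  have h1 : HasFDerivWithinAt (fun u : ℝ × ℝ => η (u.2 / β) • v)
      ((((η' (M.B x.1 * x.2)) * (1 / β)) • ContinuousLinearMap.snd ℝ ℝ ℝ).smulRight v)
      (M.D β) (M.chart β x) := by
    have e : (M.chart β x).2 / β = M.B x.1 * x.2 := by
      simp only [chart, pt]
      field_simp
    have h2 : HasDerivAt (fun y => η (y / β)) (η' (M.B x.1 * x.2) * (1 / β)) (M.chart β x).2 := by
      have := HasDerivAt.comp (M.chart β x).2 (h₂ := η) (h := fun y => y / β)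
        (hη' _) ((hasDerivAt_id _).div_const β)
      rwa [e] at this
    have h3 : HasFDerivWithinAt (fun u : ℝ × ℝ => u.2) (ContinuousLinearMap.snd ℝ ℝ ℝ) (M.D β)
      (M.chart β x) := hasFDerivWithinAt_snd
    exact (h2.comp_hasFDerivWithinAt _ h3).smul_const v
  have hd := hasFDerivWithinAt_smul_fst (hχ' (M.chart β x).1) h1.differentiableWithinAt
  rw [h1.fderivWithin (M.uniqueDiffOn_D hβ _ hu)] at hd
  have e0 := partialWithin_eq_of_hasFDerivWithinAt (M.uniqueDiffOn_D hβ) hu hd 0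
  have e1 := partialWithin_eq_of_hasFDerivWithinAt (M.uniqueDiffOn_D hβ) hu hd 1
  simp only [e0, e1]
  have e : (M.chart β x).2 / β = M.B x.1 * x.2 := by
    simp only [chart, pt]
    field_simp
  have e4 : (M.chart β x).1 = x.1 := rfl
  simp only [coordVec, add_apply, smul_apply,
    ContinuousLinearMap.smulRight_apply, ContinuousLinearMap.coe_fst',
    ContinuousLinearMap.coe_snd', Matrix.cons_val_zero,
    Matrix.cons_val_one, Matrix.cons_val_fin_one, smul_eq_mul, mul_one, mul_zero, zero_smul,
    add_zero, zero_add, smul_zero, real_inner_smul_right, e, e4]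
  field_simp

end CenteredStrip

end ElasticStrip
end

noncomputable section

open Set Filter Topology MeasureTheory

namespace ElasticStrip

/-! ### Uniform expansions to second order -/

/-- `f x β = c₀ x + β c₁ x + β² c₂ x + O(β³)` as `β → 0+`, uniformly for `x ∈ K`, with continuous
coefficients. -/
structure HasExpansion {E : Type*} [NormedAddCommGroup E] [NormedSpace ℝ E] (K : Set (ℝ × ℝ))
    (f : ℝ × ℝ → ℝ → E) (c₀ c₁ c₂ : ℝ × ℝ → E) : Prop where
  cont₀ : ContinuousOn c₀ K
  cont₁ : ContinuousOn c₁ K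
  cont₂ : ContinuousOn c₂ K
  bound : ∃ C, ∃ δ > 0, ∀ x ∈ K, ∀ β ∈ Ioo 0 δ,
    ‖f x β - (c₀ x + β • c₁ x + β ^ 2 • c₂ x)‖ ≤ C * β ^ 3

lemma norm_smul_le_of_le_one {V : Type*} [NormedAddCommGroup V] [NormedSpace ℝ V] {t m : ℝ} {v : V}
    (ht : 0 ≤ t) (ht' : t ≤ 1) (hv : ‖v‖ ≤ m) : ‖t • v‖ ≤ m := by
  rw [norm_smul, Real.norm_eq_abs, abs_of_nonneg ht]
  exact (mul_le_of_le_one_left (norm_nonneg _) ht').trans hv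

section Algebra

variable {E F H : Type*} [NormedAddCommGroup E] [NormedSpace ℝ E] [NormedAddCommGroup F]
  [NormedSpace ℝ F] [NormedAddCommGroup H] [NormedSpace ℝ H] {K : Set (ℝ × ℝ)}
  {f f' : ℝ × ℝ → ℝ → E} {c₀ c₁ c₂ d₀ d₁ d₂ : ℝ × ℝ → E}

lemma HasExpansion.congr (h : HasExpansion K f c₀ c₁ c₂) {δ : ℝ} (hδ : 0 < δ)
    (hf : ∀ x ∈ K, ∀ β ∈ Ioo 0 δ, f' x β = f x β) (h₀ : ∀ x ∈ K, d₀ x = c₀ x)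
    (h₁ : ∀ x ∈ K, d₁ x = c₁ x) (h₂ : ∀ x ∈ K, d₂ x = c₂ x) : HasExpansion K f' d₀ d₁ d₂ := by
  obtain ⟨C, δ', hδ', hC⟩ := h.bound
  refine ⟨h.cont₀.congr h₀, h.cont₁.congr h₁, h.cont₂.congr h₂, C, min δ δ', lt_min hδ hδ',
    fun x hx β hβ => ?_⟩
  rw [hf x hx β ⟨hβ.1, hβ.2.trans_le (min_le_left _ _)⟩, h₀ x hx, h₁ x hx, h₂ x hx]
  exact hC x hx β ⟨hβ.1, hβ.2.trans_le (min_le_right _ _)⟩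

lemma HasExpansion.add (h : HasExpansion K f c₀ c₁ c₂) (h' : HasExpansion K f' d₀ d₁ d₂) :
    HasExpansion K (fun x β => f x β + f' x β) (fun x => c₀ x + d₀ x) (fun x => c₁ x + d₁ x)
      (fun x => c₂ x + d₂ x) := by
  obtain ⟨C, δ, hδ, hC⟩ := h.bound
  obtain ⟨C', δ', hδ', hC'⟩ := h'.bound
  refine ⟨h.cont₀.add h'.cont₀, h.cont₁.add h'.cont₁, h.cont₂.add h'.cont₂, C + C', min δ δ',
    lt_min hδ hδ', fun x hx β hβ => ?_⟩
  have h1 := hC x hx β ⟨hβ.1, hβ.2.trans_le (min_le_left _ _)⟩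
  have h2 := hC' x hx β ⟨hβ.1, hβ.2.trans_le (min_le_right _ _)⟩
  rw [add_mul]
  refine le_trans (le_of_eq ?_) ((norm_add_le _ _).trans (add_le_add h1 h2))
  congr 1
  module

lemma HasExpansion.clm (h : HasExpansion K f c₀ c₁ c₂) (L : E →L[ℝ] F) :
    HasExpansion K (fun x β => L (f x β)) (fun x => L (c₀ x)) (fun x => L (c₁ x))
      (fun x => L (c₂ x)) := by
  obtain ⟨C, δ, hδ, hC⟩ := h.bound
  refine ⟨L.continuous.comp_continuousOn h.cont₀, L.continuous.comp_continuousOn h.cont₁,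
    L.continuous.comp_continuousOn h.cont₂, ‖L‖ * C, δ, hδ, fun x hx β hβ => ?_⟩
  simp only [← map_smul, ← map_add, ← map_sub, mul_assoc]
  exact (L.le_opNorm _).trans (mul_le_mul_of_nonneg_left (hC x hx β hβ) (norm_nonneg _))

lemma hasExpansion_const (hc : ContinuousOn c₀ K) :
    HasExpansion K (fun x _ => c₀ x) c₀ (fun _ => 0) (fun _ => 0) :=
  ⟨hc, continuousOn_const, continuousOn_const, 0, 1, one_pos, by simp⟩

/-- One product rule serves for products of scalars, scalar multiples of vectors, and inner
products. Compactness supplies the bounds for the coefficients that multiply remainders. -/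
lemma HasExpansion.bilin (hK : IsCompact K) {g : ℝ × ℝ → ℝ → F} {e₀ e₁ e₂ : ℝ × ℝ → F}
    (h : HasExpansion K f c₀ c₁ c₂) (h' : HasExpansion K g e₀ e₁ e₂) (L : E →L[ℝ] F →L[ℝ] H) :
    HasExpansion K (fun x β => L (f x β) (g x β)) (fun x => L (c₀ x) (e₀ x))
      (fun x => L (c₀ x) (e₁ x) + L (c₁ x) (e₀ x))
      (fun x => L (c₀ x) (e₂ x) + L (c₁ x) (e₁ x) + L (c₂ x) (e₀ x)) := by
  have hL : ∀ {a : ℝ × ℝ → E} {b : ℝ × ℝ → F}, ContinuousOn a K → ContinuousOn b K →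
      ContinuousOn (fun x => L (a x) (b x)) K := fun ha hb =>
    (L.continuous.comp_continuousOn ha).clm_apply hb
  obtain ⟨C, δ, hδ, hC⟩ := h.bound
  obtain ⟨C', δ', hδ', hC'⟩ := h'.bound
  have hb : ∀ {a : ℝ × ℝ → E}, ContinuousOn a K → ∃ m, 0 ≤ m ∧ ∀ x ∈ K, ‖a x‖ ≤ m := fun ha => by
    obtain ⟨m, hm⟩ := hK.exists_bound_of_continuousOn ha
    exact ⟨|m|, abs_nonneg m, fun x hx => (hm x hx).trans (le_abs_self m)⟩
  have hb' : ∀ {a : ℝ × ℝ → F}, ContinuousOn a K → ∃ m, 0 ≤ m ∧ ∀ x ∈ K, ‖a x‖ ≤ m := fun ha => by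
    obtain ⟨m, hm⟩ := hK.exists_bound_of_continuousOn ha
    exact ⟨|m|, abs_nonneg m, fun x hx => (hm x hx).trans (le_abs_self m)⟩
  obtain ⟨m₀, hm₀, hc₀⟩ := hb h.cont₀
  obtain ⟨m₁, hm₁, hc₁⟩ := hb h.cont₁
  obtain ⟨m₂, hm₂, hc₂⟩ := hb h.cont₂
  obtain ⟨n₀, hn₀, he₀⟩ := hb' h'.cont₀
  obtain ⟨n₁, hn₁, he₁⟩ := hb' h'.cont₁
  obtain ⟨n₂, hn₂, he₂⟩ := hb' h'.cont₂
  refine ⟨hL h.cont₀ h'.cont₀, (hL h.cont₀ h'.cont₁).add (hL h.cont₁ h'.cont₀),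
    ((hL h.cont₀ h'.cont₂).add (hL h.cont₁ h'.cont₁)).add (hL h.cont₂ h'.cont₀),
    ‖L‖ * (m₀ + m₁ + m₂) * |C'| + ‖L‖ * |C| * (n₀ + n₁ + n₂ + |C'|)
      + (‖L‖ * m₁ * n₂ + ‖L‖ * m₂ * n₁ + ‖L‖ * m₂ * n₂), min (min δ δ') 1,
    lt_min (lt_min hδ hδ') one_pos, fun x hx β hβ => ?_⟩
  have hβ0 : 0 ≤ β := hβ.1.le
  have hβ1 : β ≤ 1 := (hβ.2.trans_le (min_le_right _ _)).le
  have hβ2 : β ^ 2 ≤ 1 := pow_le_one₀ hβ0 hβ1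
  have hβ3 : β ^ 3 ≤ 1 := pow_le_one₀ hβ0 hβ1
  have k1 := hC x hx β ⟨hβ.1, hβ.2.trans_le ((min_le_left _ _).trans (min_le_left _ _))⟩
  have k2 := hC' x hx β ⟨hβ.1, hβ.2.trans_le ((min_le_left _ _).trans (min_le_right _ _))⟩
  set pf := c₀ x + β • c₁ x + β ^ 2 • c₂ x with hpf
  set pg := e₀ x + β • e₁ x + β ^ 2 • e₂ x with hpg
  have k1' : ‖f x β - pf‖ ≤ |C| * β ^ 3 :=
    k1.trans (mul_le_mul_of_nonneg_right (le_abs_self C) (by positivity))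
  have k2' : ‖g x β - pg‖ ≤ |C'| * β ^ 3 :=
    k2.trans (mul_le_mul_of_nonneg_right (le_abs_self C') (by positivity))
  have kpf : ‖pf‖ ≤ m₀ + m₁ + m₂ := (norm_add₃_le).trans (add_le_add (add_le_add (hc₀ x hx)
    (norm_smul_le_of_le_one hβ0 hβ1 (hc₁ x hx))) (norm_smul_le_of_le_one (by positivity) hβ2 (hc₂ x hx)))
  have kpg : ‖pg‖ ≤ n₀ + n₁ + n₂ := (norm_add₃_le).trans (add_le_add (add_le_add (he₀ x hx)
    (norm_smul_le_of_le_one hβ0 hβ1 (he₁ x hx))) (norm_smul_le_of_le_one (by positivity) hβ2 (he₂ x hx)))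
  have kg : ‖g x β‖ ≤ n₀ + n₁ + n₂ + |C'| := by
    have := norm_add_le pg (g x β - pg)
    rw [add_sub_cancel] at this
    have h3 : |C'| * β ^ 3 ≤ |C'| := mul_le_of_le_one_right (abs_nonneg _) hβ3
    linarith
  -- Remainder of one factor times the other, plus the terms of degree at least 3 in the product of
  -- the two quadratic polynomials.
  have split : L (f x β) (g x β) - (L (c₀ x) (e₀ x) + β • (L (c₀ x) (e₁ x) + L (c₁ x) (e₀ x))
      + β ^ 2 • (L (c₀ x) (e₂ x) + L (c₁ x) (e₁ x) + L (c₂ x) (e₀ x)))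
      = L pf (g x β - pg) + L (f x β - pf) (g x β)
        + β ^ 3 • (L (c₁ x) (e₂ x) + L (c₂ x) (e₁ x) + β • L (c₂ x) (e₂ x)) := by
    simp only [hpf, hpg, map_add, map_sub, map_smul, add_apply, sub_apply,
      smul_apply]
    module
  rw [split]
  have l1 : ‖L pf (g x β - pg)‖ ≤ ‖L‖ * (m₀ + m₁ + m₂) * (|C'| * β ^ 3) :=
    (L.le_opNorm₂ _ _).trans (by gcongr)
  have l2 : ‖L (f x β - pf) (g x β)‖ ≤ ‖L‖ * (|C| * β ^ 3) * (n₀ + n₁ + n₂ + |C'|) :=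
    (L.le_opNorm₂ _ _).trans (by gcongr)
  have l3 : ‖L (c₁ x) (e₂ x) + L (c₂ x) (e₁ x) + β • L (c₂ x) (e₂ x)‖
      ≤ ‖L‖ * m₁ * n₂ + ‖L‖ * m₂ * n₁ + ‖L‖ * m₂ * n₂ := by
    refine norm_add₃_le.trans (add_le_add (add_le_add ((L.le_opNorm₂ _ _).trans ?_)
      ((L.le_opNorm₂ _ _).trans ?_)) (norm_smul_le_of_le_one hβ0 hβ1 ((L.le_opNorm₂ _ _).trans ?_)))
    · gcongr
      exacts [hc₁ x hx, he₂ x hx]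
    · gcongr
      exacts [hc₂ x hx, he₁ x hx]
    · gcongr
      exacts [hc₂ x hx, he₂ x hx]
  have l4 : ‖β ^ 3 • (L (c₁ x) (e₂ x) + L (c₂ x) (e₁ x) + β • L (c₂ x) (e₂ x))‖
      ≤ β ^ 3 * (‖L‖ * m₁ * n₂ + ‖L‖ * m₂ * n₁ + ‖L‖ * m₂ * n₂) := by
    rw [norm_smul, Real.norm_eq_abs, abs_of_nonneg (by positivity : (0 : ℝ) ≤ β ^ 3)]
    gcongr
  refine norm_add₃_le.trans ((add_le_add (add_le_add l1 l2) l4).trans (le_of_eq ?_))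
  ring

lemma HasExpansion.mul (hK : IsCompact K) {f g : ℝ × ℝ → ℝ → ℝ} {c₀ c₁ c₂ e₀ e₁ e₂ : ℝ × ℝ → ℝ}
    (h : HasExpansion K f c₀ c₁ c₂) (h' : HasExpansion K g e₀ e₁ e₂) :
    HasExpansion K (fun x β => f x β * g x β) (fun x => c₀ x * e₀ x)
      (fun x => c₀ x * e₁ x + c₁ x * e₀ x)
      (fun x => c₀ x * e₂ x + c₁ x * e₁ x + c₂ x * e₀ x) :=
  h.bilin hK h' (ContinuousLinearMap.mul ℝ ℝ)

lemma HasExpansion.smul (hK : IsCompact K) {g : ℝ × ℝ → ℝ → ℝ} {e₀ e₁ e₂ : ℝ × ℝ → ℝ}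
    (h : HasExpansion K g e₀ e₁ e₂) (h' : HasExpansion K f c₀ c₁ c₂) :
    HasExpansion K (fun x β => g x β • f x β) (fun x => e₀ x • c₀ x)
      (fun x => e₀ x • c₁ x + e₁ x • c₀ x)
      (fun x => e₀ x • c₂ x + e₁ x • c₁ x + e₂ x • c₀ x) :=
  h.bilin hK h' (ContinuousLinearMap.lsmul ℝ ℝ)

lemma HasExpansion.inner (hK : IsCompact K) {f g : ℝ × ℝ → ℝ → Plane}
    {c₀ c₁ c₂ e₀ e₁ e₂ : ℝ × ℝ → Plane} (h : HasExpansion K f c₀ c₁ c₂)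
    (h' : HasExpansion K g e₀ e₁ e₂) :
    HasExpansion K (fun x β => inner ℝ (f x β) (g x β)) (fun x => inner ℝ (c₀ x) (e₀ x))
      (fun x => inner ℝ (c₀ x) (e₁ x) + inner ℝ (c₁ x) (e₀ x))
      (fun x => inner ℝ (c₀ x) (e₂ x) + inner ℝ (c₁ x) (e₁ x) + inner ℝ (c₂ x) (e₀ x)) :=
  h.bilin hK h' (innerSL ℝ)

lemma HasExpansion.const_smul (h : HasExpansion K f c₀ c₁ c₂) (a : ℝ) :
    HasExpansion K (fun x β => a • f x β) (fun x => a • c₀ x) (fun x => a • c₁ x)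
      (fun x => a • c₂ x) :=
  h.clm (a • ContinuousLinearMap.id ℝ E)

lemma HasExpansion.sub (h : HasExpansion K f c₀ c₁ c₂) (h' : HasExpansion K f' d₀ d₁ d₂) :
    HasExpansion K (fun x β => f x β - f' x β) (fun x => c₀ x - d₀ x) (fun x => c₁ x - d₁ x)
      (fun x => c₂ x - d₂ x) := by
  simpa only [sub_eq_add_neg, neg_one_smul] using h.add (h'.const_smul (-1))

/-- A bound on the remainder of the leading term. -/
lemma HasExpansion.bound_one (hK : IsCompact K) (h : HasExpansion K f c₀ c₁ c₂) :
    ∃ C, ∃ δ > 0, ∀ x ∈ K, ∀ β ∈ Ioo 0 δ, ‖f x β - c₀ x‖ ≤ C * β := by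
  obtain ⟨C, δ, hδ, hC⟩ := h.bound
  obtain ⟨m₁, hm₁⟩ := hK.exists_bound_of_continuousOn h.cont₁
  obtain ⟨m₂, hm₂⟩ := hK.exists_bound_of_continuousOn h.cont₂
  refine ⟨|C| + |m₁| + |m₂|, min δ 1, lt_min hδ one_pos, fun x hx β hβ => ?_⟩
  have hβ0 : 0 < β := hβ.1
  have hβ1 : β ≤ 1 := (hβ.2.trans_le (min_le_right _ _)).le
  have k := hC x hx β ⟨hβ.1, hβ.2.trans_le (min_le_left _ _)⟩
  have k1 := (hm₁ x hx).trans (le_abs_self m₁)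
  have k2 := (hm₂ x hx).trans (le_abs_self m₂)
  have e : f x β - c₀ x
      = (f x β - (c₀ x + β • c₁ x + β ^ 2 • c₂ x)) + β • c₁ x + β ^ 2 • c₂ x := by module
  rw [e]
  refine norm_add₃_le.trans ?_
  rw [norm_smul, norm_smul, Real.norm_eq_abs, Real.norm_eq_abs, abs_of_pos hβ0,
    abs_of_pos (by positivity : (0 : ℝ) < β ^ 2)]
  have h3 : β ^ 3 ≤ β := by
    simpa using pow_le_pow_of_le_one hβ0.le hβ1 (show 1 ≤ 3 by norm_num)
  have h2 : β ^ 2 ≤ β := by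
    simpa using pow_le_pow_of_le_one hβ0.le hβ1 (show 1 ≤ 2 by norm_num)
  have a1 : C * β ^ 3 ≤ |C| * β := mul_le_mul (le_abs_self C) h3 (by positivity) (abs_nonneg C)
  have a2 : β * ‖c₁ x‖ ≤ β * |m₁| := by gcongr
  have a3 : β ^ 2 * ‖c₂ x‖ ≤ β * |m₂| := by gcongr
  linarith

/-- The leading term of an expansion that starts at first order. -/
lemma HasExpansion.bound_two (hK : IsCompact K) (h : HasExpansion K f c₀ c₁ c₂)
    (h₀ : ∀ x ∈ K, c₀ x = 0) :
    ∃ C, ∃ δ > 0, ∀ x ∈ K, ∀ β ∈ Ioo 0 δ, ‖f x β - β ^ 1 • c₁ x‖ ≤ C * β ^ (1 + 1) := by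
  obtain ⟨C, δ, hδ, hC⟩ := h.bound
  obtain ⟨m₂, hm₂⟩ := hK.exists_bound_of_continuousOn h.cont₂
  refine ⟨|C| + |m₂|, min δ 1, lt_min hδ one_pos, fun x hx β hβ => ?_⟩
  have hβ0 : 0 < β := hβ.1
  have hβ1 : β ≤ 1 := (hβ.2.trans_le (min_le_right _ _)).le
  have k := hC x hx β ⟨hβ.1, hβ.2.trans_le (min_le_left _ _)⟩
  have k2 := (hm₂ x hx).trans (le_abs_self m₂)
  have e : f x β - β ^ 1 • c₁ x
      = (f x β - (c₀ x + β • c₁ x + β ^ 2 • c₂ x)) + β ^ 2 • c₂ x := by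
    rw [h₀ x hx]; module
  rw [e]
  refine (norm_add_le _ _).trans ?_
  rw [norm_smul, Real.norm_eq_abs, abs_of_pos (by positivity : (0 : ℝ) < β ^ 2)]
  have h3 : β ^ 3 ≤ β ^ 2 := pow_le_pow_of_le_one hβ0.le hβ1 (by norm_num)
  have a1 : C * β ^ 3 ≤ |C| * β ^ 2 := mul_le_mul (le_abs_self C) h3 (by positivity) (abs_nonneg C)
  have a3 : β ^ 2 * ‖c₂ x‖ ≤ β ^ 2 * |m₂| := by gcongr
  norm_num
  linarith

/-- The leading term of an expansion that starts at second order. -/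
lemma HasExpansion.bound_three (h : HasExpansion K f c₀ c₁ c₂)
    (h₀ : ∀ x ∈ K, c₀ x = 0) (h₁ : ∀ x ∈ K, c₁ x = 0) :
    ∃ C, ∃ δ > 0, ∀ x ∈ K, ∀ β ∈ Ioo 0 δ, ‖f x β - β ^ 2 • c₂ x‖ ≤ C * β ^ (2 + 1) := by
  obtain ⟨C, δ, hδ, hC⟩ := h.bound
  refine ⟨C, δ, hδ, fun x hx β hβ => ?_⟩
  have k := hC x hx β hβ
  rw [h₀ x hx, h₁ x hx] at k
  simpa using k

end Algebra

/-! ### Taylor expansions on a box -/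

/-- The derivative of `f` in the direction `v` within the domain `X`. -/
def dirWithin {V E : Type*} [NormedAddCommGroup V] [NormedSpace ℝ V] [NormedAddCommGroup E]
    [NormedSpace ℝ E] (X : Set V) (v : V) (f : V → E) (x : V) : E := fderivWithin ℝ f X x v

section Dir

variable {V E : Type*} [NormedAddCommGroup V] [NormedSpace ℝ V] [NormedAddCommGroup E]
    [NormedSpace ℝ E] {X : Set V} {f : V → E}

lemma contDiffOn_dirWithin (hX : UniqueDiffOn ℝ X) (hf : ContDiffOn ℝ ∞ f X) (v : V) :
    ContDiffOn ℝ ∞ (dirWithin X v f) X :=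
  (hf.fderivWithin hX (by simp)).clm_apply contDiffOn_const

lemma dirWithin_congr {f' : V → E} (h : ∀ x ∈ X, f x = f' x) {x : V} (hx : x ∈ X) (v : V) :
    dirWithin X v f x = dirWithin X v f' x := by
  simp [dirWithin, fderivWithin_congr h (h x hx)]

/-- Symmetry of the second derivative extends to boundary points because the domain lies in the
closure of its interior. -/
lemma dirWithin_comm (hX : UniqueDiffOn ℝ X) (hX' : X ⊆ closure (interior X))
    (hf : ContDiffOn ℝ ∞ f X) (v w : V) {x : V} (hx : x ∈ X) :
    dirWithin X v (dirWithin X w f) x = dirWithin X w (dirWithin X v f) x := by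
  have hd := ((hf.fderivWithin (m := 1) hX (by norm_cast)).differentiableOn one_ne_zero x
    hx).hasFDerivWithinAt
  have key : ∀ v w, dirWithin X v (dirWithin X w f) x
      = fderivWithin ℝ (fderivWithin ℝ f X) X x v w := by
    intro v w
    have := (hd.clm_apply (hasFDerivWithinAt_const w x X)).fderivWithin (hX x hx)
    unfold dirWithin
    erw [this]
    simp
  rw [key, key]
  exact (hf x hx).isSymmSndFDerivWithinAt (by simpa using WithTop.coe_le_coe.2 (le_top : (2 : ℕ∞) ≤ ⊤)) hX (hX' hx) hx v w

end Dir

end ElasticStrip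
end

/-! ### The parameter box and Taylor's formula in the breadth -/

noncomputable section

open Set Filter Topology MeasureTheory

namespace ElasticStrip

/-- The rectangle of the normalized coordinates `(s, r)` with `s ∈ [s₁, s₂]`. -/
def base (s₁ s₂ : ℝ) : Set (ℝ × ℝ) := Icc s₁ s₂ ×ˢ Icc (-1) 1

/-- The box of the parameters `(s, r, β)` with `s ∈ [s₁, s₂]` and `β ∈ [0, β₁]`. -/
def box (s₁ s₂ β₁ : ℝ) : Set (ℝ × ℝ × ℝ) := Icc s₁ s₂ ×ˢ Icc (-1) 1 ×ˢ Icc 0 β₁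

/-- The derivative with respect to the breadth parameter. -/
def dirBeta {E : Type*} [NormedAddCommGroup E] [NormedSpace ℝ E] (s₁ s₂ β₁ : ℝ)
    (f : ℝ × ℝ × ℝ → E) : ℝ × ℝ × ℝ → E := dirWithin (box s₁ s₂ β₁) (0, 0, 1) f

section Base

variable {s₁ s₂ β₁ : ℝ}

lemma isCompact_base : IsCompact (base s₁ s₂) := isCompact_Icc.prod isCompact_Icc

lemma uniqueDiffOn_base (hs : s₁ < s₂) : UniqueDiffOn ℝ (base s₁ s₂) :=
  (uniqueDiffOn_Icc hs).prod (uniqueDiffOn_Icc (by norm_num))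

lemma uniqueDiffOn_box (hs : s₁ < s₂) (hβ : 0 < β₁) : UniqueDiffOn ℝ (box s₁ s₂ β₁) :=
  (uniqueDiffOn_Icc hs).prod ((uniqueDiffOn_Icc (by norm_num)).prod (uniqueDiffOn_Icc hβ))

lemma base_subset_closure_interior (hs : s₁ < s₂) :
    base s₁ s₂ ⊆ closure (interior (base s₁ s₂)) := by
  rw [base, interior_prod_eq, closure_prod_eq, interior_Icc, interior_Icc, closure_Ioo hs.ne,
    closure_Ioo (by norm_num)]

lemma box_subset_closure_interior (hs : s₁ < s₂) (hβ : 0 < β₁) :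
    box s₁ s₂ β₁ ⊆ closure (interior (box s₁ s₂ β₁)) := by
  rw [box, interior_prod_eq, closure_prod_eq, interior_prod_eq, closure_prod_eq, interior_Icc,
    interior_Icc, interior_Icc, closure_Ioo hs.ne, closure_Ioo (by norm_num), closure_Ioo hβ.ne]

lemma isCompact_box : IsCompact (box s₁ s₂ β₁) :=
  isCompact_Icc.prod (isCompact_Icc.prod isCompact_Icc)

lemma mk_mem_box {x : ℝ × ℝ} (hx : x ∈ base s₁ s₂) {β : ℝ} (hβ : β ∈ Icc 0 β₁) :
    (x.1, x.2, β) ∈ box s₁ s₂ β₁ := ⟨hx.1, hx.2, hβ⟩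

variable {E : Type*} [NormedAddCommGroup E] [NormedSpace ℝ E] {f : ℝ × ℝ × ℝ → E}

lemma hasDerivWithinAt_line (hf : DifferentiableOn ℝ f (box s₁ s₂ β₁)) {x : ℝ × ℝ}
    (hx : x ∈ base s₁ s₂) {β : ℝ} (hβ : β ∈ Icc 0 β₁) :
    HasDerivWithinAt (fun β => f (x.1, x.2, β)) (dirBeta s₁ s₂ β₁ f (x.1, x.2, β))
      (Icc 0 β₁) β := by
  have h1 : HasDerivWithinAt (fun β : ℝ => (x.1, x.2, β)) ((0 : ℝ), (0 : ℝ), (1 : ℝ))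
      (Icc 0 β₁) β :=
    (hasDerivWithinAt_const _ _ _).prodMk
      ((hasDerivWithinAt_const _ _ _).prodMk (hasDerivWithinAt_id _ _))
  exact (hf _ (mk_mem_box hx hβ)).hasFDerivWithinAt.comp_hasDerivWithinAt β h1
    fun β hβ => mk_mem_box hx hβ

/-- One-sided derivatives within [0, β₁] are unique, so a derivative computed along the line
identifies the directional derivative, also at β = 0. -/
lemma dirBeta_eq (hβ₁ : 0 < β₁) (hf : DifferentiableOn ℝ f (box s₁ s₂ β₁)) {x : ℝ × ℝ}
    (hx : x ∈ base s₁ s₂) {β : ℝ} (hβ : β ∈ Icc 0 β₁) {c : E}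
    (h : HasDerivWithinAt (fun β => f (x.1, x.2, β)) c (Icc 0 β₁) β) :
    dirBeta s₁ s₂ β₁ f (x.1, x.2, β) = c :=
  (uniqueDiffOn_Icc hβ₁ β hβ).eq_deriv _ (hasDerivWithinAt_line hf hx hβ) h

/-- The inclusion of the slice `β = const` into the box, as a linear map. -/
def sliceDeriv : ℝ × ℝ →L[ℝ] ℝ × ℝ × ℝ :=
  (ContinuousLinearMap.fst ℝ ℝ ℝ).prod ((ContinuousLinearMap.snd ℝ ℝ ℝ).prod 0)

lemma hasFDerivWithinAt_slice (hf : DifferentiableOn ℝ f (box s₁ s₂ β₁)) {x : ℝ × ℝ}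
    (hx : x ∈ base s₁ s₂) {β : ℝ} (hβ : β ∈ Icc 0 β₁) :
    HasFDerivWithinAt (fun x : ℝ × ℝ => f (x.1, x.2, β))
      ((fderivWithin ℝ f (box s₁ s₂ β₁) (x.1, x.2, β)).comp sliceDeriv) (base s₁ s₂) x := by
  have h1 : HasFDerivWithinAt (fun x : ℝ × ℝ => (x.1, x.2, β)) sliceDeriv (base s₁ s₂) x :=
    hasFDerivWithinAt_fst.prodMk (hasFDerivWithinAt_snd.prodMk (hasFDerivWithinAt_const _ _ _))
  exact (hf _ (mk_mem_box hx hβ)).hasFDerivWithinAt.comp x h1 fun x hx => mk_mem_box hx hβ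

lemma contDiffOn_slice (hf : ContDiffOn ℝ ∞ f (box s₁ s₂ β₁)) {β : ℝ} (hβ : β ∈ Icc 0 β₁) :
    ContDiffOn ℝ ∞ (fun x : ℝ × ℝ => f (x.1, x.2, β)) (base s₁ s₂) :=
  hf.comp (contDiff_fst.prodMk (contDiff_snd.prodMk contDiff_const)).contDiffOn
    fun _ hx => mk_mem_box hx hβ

lemma partialWithin_slice_zero (hs : s₁ < s₂) (hf : DifferentiableOn ℝ f (box s₁ s₂ β₁))
    {x : ℝ × ℝ} (hx : x ∈ base s₁ s₂) {β : ℝ} (hβ : β ∈ Icc 0 β₁) :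
    partialWithin (base s₁ s₂) 0 (fun x : ℝ × ℝ => f (x.1, x.2, β)) x
      = dirWithin (box s₁ s₂ β₁) (1, 0, 0) f (x.1, x.2, β) := by
  rw [partialWithin_eq_of_hasFDerivWithinAt (uniqueDiffOn_base hs) hx
    (hasFDerivWithinAt_slice hf hx hβ)]
  simp [dirWithin, sliceDeriv, coordVec]

lemma partialWithin_slice_one (hs : s₁ < s₂) (hf : DifferentiableOn ℝ f (box s₁ s₂ β₁))
    {x : ℝ × ℝ} (hx : x ∈ base s₁ s₂) {β : ℝ} (hβ : β ∈ Icc 0 β₁) :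
    partialWithin (base s₁ s₂) 1 (fun x : ℝ × ℝ => f (x.1, x.2, β)) x
      = dirWithin (box s₁ s₂ β₁) (0, 1, 0) f (x.1, x.2, β) := by
  rw [partialWithin_eq_of_hasFDerivWithinAt (uniqueDiffOn_base hs) hx
    (hasFDerivWithinAt_slice hf hx hβ)]
  simp [dirWithin, sliceDeriv, coordVec]

lemma contDiffOn_dirBeta (hs : s₁ < s₂) (hβ₁ : 0 < β₁) (hf : ContDiffOn ℝ ∞ f (box s₁ s₂ β₁)) :
    ContDiffOn ℝ ∞ (dirBeta s₁ s₂ β₁ f) (box s₁ s₂ β₁) :=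
  contDiffOn_dirWithin (uniqueDiffOn_box hs hβ₁) hf _

/-- Taylor's formula in the breadth parameter, uniformly on a box. -/
lemma exists_taylor_bound (hs : s₁ < s₂) (hβ₁ : 0 < β₁) (hf : ContDiffOn ℝ ∞ f (box s₁ s₂ β₁))
    (n : ℕ) :
    ∃ C, ∀ x ∈ base s₁ s₂, ∀ β ∈ Icc 0 β₁,
      ‖f (x.1, x.2, β) - ∑ i ∈ Finset.range n,
        (β ^ i / i.factorial) • ((dirBeta s₁ s₂ β₁)^[i] f) (x.1, x.2, 0)‖ ≤ C * β ^ n := by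
  induction n generalizing f with
  | zero =>
    obtain ⟨C, hC⟩ := isCompact_box.exists_bound_of_continuousOn hf.continuousOn
    exact ⟨C, fun x hx β hβ => by simpa using hC _ (mk_mem_box hx hβ)⟩
  | succ n ih =>
    -- The remainder of order n + 1 vanishes at β = 0 and its β-derivative is the remainder of order
    -- n of ∂f/∂β. The mean value inequality on [0, β] gains a factor β with the same constant.
    obtain ⟨C, hC⟩ := ih (contDiffOn_dirBeta hs hβ₁ hf)
    refine ⟨C, fun x hx β hβ => ?_⟩
    have hsub : Icc 0 β ⊆ Icc 0 β₁ := Icc_subset_Icc_right hβ.2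
    have hC0 : 0 ≤ C * β ^ n := (norm_nonneg _).trans (hC x hx β hβ)
    have hder : ∀ t ∈ Icc 0 β, HasDerivWithinAt (fun t => f (x.1, x.2, t)
        - ∑ i ∈ Finset.range (n + 1),
          (t ^ i / i.factorial) • ((dirBeta s₁ s₂ β₁)^[i] f) (x.1, x.2, 0))
        (dirBeta s₁ s₂ β₁ f (x.1, x.2, t) - ∑ i ∈ Finset.range n, (t ^ i / i.factorial) •
          ((dirBeta s₁ s₂ β₁)^[i] (dirBeta s₁ s₂ β₁ f)) (x.1, x.2, 0)) (Icc 0 β) t := by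
      intro t ht
      refine ((hasDerivWithinAt_line (hf.differentiableOn (by simp)) hx (hsub ht)).mono hsub).sub
        (?_ : HasDerivWithinAt (fun t : ℝ => ∑ i ∈ Finset.range (n + 1), (t ^ i / i.factorial : ℝ) •
          ((dirBeta s₁ s₂ β₁)^[i] f) (x.1, x.2, 0)) _ _ _)
      simp only [Finset.sum_range_succ', pow_zero]
      have hterm : ∀ i ∈ Finset.range n, HasDerivWithinAt
          (fun t : ℝ => (t ^ (i + 1) / (i + 1).factorial : ℝ) •
            ((dirBeta s₁ s₂ β₁)^[i + 1] f) (x.1, x.2, 0))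
          ((t ^ i / i.factorial : ℝ) • ((dirBeta s₁ s₂ β₁)^[i] (dirBeta s₁ s₂ β₁ f)) (x.1, x.2, 0))
          (Icc 0 β) t := by
        intro i _
        suffices hi : HasDerivWithinAt (fun t : ℝ => t ^ (i + 1) / ((i + 1).factorial : ℝ))
          (t ^ i / i.factorial) (Icc 0 β) t from hi.smul_const _
        refine (((hasDerivAt_pow (i + 1) t).div_const _).congr_deriv ?_).hasDerivWithinAt
        rw [Nat.factorial_succ]
        push_cast
        have : (i.factorial : ℝ) ≠ 0 := by positivity
        field_simp
      exact (HasDerivWithinAt.fun_sum hterm).add_const _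
    have h := (convex_Icc 0 β).norm_image_sub_le_of_norm_hasDerivWithin_le (C := C * β ^ n) hder
      (fun t ht => (hC x hx t (hsub ht)).trans ?_) (left_mem_Icc.2 hβ.1) (right_mem_Icc.2 hβ.1)
    · have e : (f (x.1, x.2, 0) - ∑ i ∈ Finset.range (n + 1),
          ((0 : ℝ) ^ i / i.factorial) • ((dirBeta s₁ s₂ β₁)^[i] f) (x.1, x.2, 0)) = 0 := by
        simp [Finset.sum_range_succ']
      rw [e, sub_zero, sub_zero, Real.norm_eq_abs, abs_of_nonneg hβ.1] at h
      rwa [pow_succ, ← mul_assoc]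
    -- The induction does not record the sign of C; the bound at β₁ > 0 reveals it. It is needed to
    -- pass from tⁿ to βⁿ.
    · have hC' : 0 ≤ C := by
        by_contra hneg
        have := (norm_nonneg _).trans (hC x hx β₁ ⟨hβ₁.le, le_rfl⟩)
        have h2 : C * β₁ ^ n < 0 := mul_neg_of_neg_of_pos (not_le.1 hneg) (by positivity)
        linarith
      have := ht.1
      have := ht.2
      gcongr

lemma hasExpansion_of_contDiffOn (hs : s₁ < s₂) (hβ₁ : 0 < β₁)
    (hf : ContDiffOn ℝ ∞ f (box s₁ s₂ β₁)) :
    HasExpansion (base s₁ s₂) (fun x β => f (x.1, x.2, β)) (fun x => f (x.1, x.2, 0))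
      (fun x => dirBeta s₁ s₂ β₁ f (x.1, x.2, 0))
      (fun x => (1 / 2 : ℝ) • dirBeta s₁ s₂ β₁ (dirBeta s₁ s₂ β₁ f) (x.1, x.2, 0)) := by
  have h0 : (0 : ℝ) ∈ Icc 0 β₁ := ⟨le_rfl, hβ₁.le⟩
  have hd := contDiffOn_dirBeta hs hβ₁ hf
  obtain ⟨C, hC⟩ := exists_taylor_bound hs hβ₁ hf 3
  refine ⟨(contDiffOn_slice hf h0).continuousOn, (contDiffOn_slice hd h0).continuousOn,
    (contDiffOn_slice (contDiffOn_dirBeta hs hβ₁ hd) h0).continuousOn.const_smul _, C, β₁, hβ₁,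
    fun x hx β hβ => ?_⟩
  have := hC x hx β ⟨hβ.1.le, hβ.2.le⟩
  simp only [Finset.sum_range_succ, Finset.range_zero, Finset.sum_empty] at this
  convert this using 3
  simp [Nat.factorial, smul_smul, div_eq_mul_inv]

/-- The expansion of `f / β` for a smooth function `f` that vanishes at `β = 0`. -/
lemma hasExpansion_inv_smul (hs : s₁ < s₂) (hβ₁ : 0 < β₁)
    (hf : ContDiffOn ℝ ∞ f (box s₁ s₂ β₁)) (hf0 : ∀ x ∈ base s₁ s₂, f (x.1, x.2, 0) = 0) :
    ∃ c, HasExpansion (base s₁ s₂) (fun x β => β⁻¹ • f (x.1, x.2, β))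
      (fun x => dirBeta s₁ s₂ β₁ f (x.1, x.2, 0))
      (fun x => (1 / 2 : ℝ) • dirBeta s₁ s₂ β₁ (dirBeta s₁ s₂ β₁ f) (x.1, x.2, 0)) c := by
  have h0 : (0 : ℝ) ∈ Icc 0 β₁ := ⟨le_rfl, hβ₁.le⟩
  have hd := contDiffOn_dirBeta hs hβ₁ hf
  have hdd := contDiffOn_dirBeta hs hβ₁ hd
  have hddd := contDiffOn_dirBeta hs hβ₁ hdd
  -- Order 4 instead of 3, since dividing by β costs one order.
  obtain ⟨C, hC⟩ := exists_taylor_bound hs hβ₁ hf 4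
  refine ⟨fun x => (1 / 6 : ℝ) •
    dirBeta s₁ s₂ β₁ (dirBeta s₁ s₂ β₁ (dirBeta s₁ s₂ β₁ f)) (x.1, x.2, 0),
    (contDiffOn_slice hd h0).continuousOn, (contDiffOn_slice hdd h0).continuousOn.const_smul _,
    (contDiffOn_slice hddd h0).continuousOn.const_smul _, C, β₁, hβ₁, fun x hx β hβ => ?_⟩
  have hβ0 : 0 < β := hβ.1
  have := hC x hx β ⟨hβ.1.le, hβ.2.le⟩
  simp only [Finset.sum_range_succ, Finset.range_zero, Finset.sum_empty, Function.iterate_succ,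
    Function.iterate_zero, Function.comp, id, hf0 x hx, smul_zero, zero_add] at this
  rw [← mul_le_mul_iff_of_pos_left hβ0]
  calc β * _ = ‖f (x.1, x.2, β) - ((β ^ 1 / (Nat.factorial 1 : ℕ)) •
          dirBeta s₁ s₂ β₁ f (x.1, x.2, 0)
        + (β ^ 2 / (Nat.factorial 2 : ℕ)) • dirBeta s₁ s₂ β₁ (dirBeta s₁ s₂ β₁ f) (x.1, x.2, 0)
        + (β ^ 3 / (Nat.factorial 3 : ℕ)) •
          dirBeta s₁ s₂ β₁ (dirBeta s₁ s₂ β₁ (dirBeta s₁ s₂ β₁ f)) (x.1, x.2, 0))‖ := by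
        rw [← abs_of_pos hβ0, ← Real.norm_eq_abs, ← norm_smul, Real.norm_eq_abs, abs_of_pos hβ0]
        congr 1
        simp only [smul_sub, smul_add, smul_smul, mul_inv_cancel₀ hβ0.ne', one_smul]
        norm_num [Nat.factorial]
        module
    _ ≤ C * β ^ 4 := this
    _ = β * (C * β ^ 3) := by ring

/-- The coefficients of the expansions of the first partial derivatives are the partial
derivatives of the coefficients. -/
lemma hasExpansion_dirWithin_zero (hs : s₁ < s₂) (hβ₁ : 0 < β₁)
    (hf : ContDiffOn ℝ ∞ f (box s₁ s₂ β₁)) :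
    HasExpansion (base s₁ s₂)
      (fun x β => dirWithin (box s₁ s₂ β₁) (1, 0, 0) f (x.1, x.2, β))
      (partialWithin (base s₁ s₂) 0 (fun x => f (x.1, x.2, 0)))
      (partialWithin (base s₁ s₂) 0 (fun x => dirBeta s₁ s₂ β₁ f (x.1, x.2, 0)))
      (fun x => (1 / 2 : ℝ) • partialWithin (base s₁ s₂) 0
        (fun x => dirBeta s₁ s₂ β₁ (dirBeta s₁ s₂ β₁ f) (x.1, x.2, 0)) x) := by
  have h0 : (0 : ℝ) ∈ Icc 0 β₁ := ⟨le_rfl, hβ₁.le⟩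
  have hX := uniqueDiffOn_box hs hβ₁
  have hX' := box_subset_closure_interior hs hβ₁
  have hd := contDiffOn_dirBeta hs hβ₁ hf
  have hdd := contDiffOn_dirBeta hs hβ₁ hd
  have hcomm : ∀ y ∈ box s₁ s₂ β₁, dirBeta s₁ s₂ β₁ (dirWithin (box s₁ s₂ β₁) (1, 0, 0) f) y
      = dirWithin (box s₁ s₂ β₁) (1, 0, 0) (dirBeta s₁ s₂ β₁ f) y := fun y hy =>
    dirWithin_comm hX hX' hf _ _ hy
  refine (hasExpansion_of_contDiffOn hs hβ₁ (contDiffOn_dirWithin hX hf (1, 0, 0))).congr hβ₁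
    (fun _ _ _ _ => rfl) (fun x hx => ?_) (fun x hx => ?_) fun x hx => ?_
  · exact partialWithin_slice_zero hs (hf.differentiableOn (by simp)) hx h0
  · rw [hcomm _ (mk_mem_box hx h0)]
    exact partialWithin_slice_zero hs (hd.differentiableOn (by simp)) hx h0
  · rw [partialWithin_slice_zero hs (hdd.differentiableOn (by simp)) hx h0]
    congr 1
    exact ((dirWithin_congr hcomm (mk_mem_box hx h0) _).trans
      (dirWithin_comm hX hX' hd _ _ (mk_mem_box hx h0))).symm

lemma dirBeta_dirWithin_one (hs : s₁ < s₂) (hβ₁ : 0 < β₁)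
    (hf : ContDiffOn ℝ ∞ f (box s₁ s₂ β₁)) {x : ℝ × ℝ} (hx : x ∈ base s₁ s₂) :
    dirBeta s₁ s₂ β₁ (dirWithin (box s₁ s₂ β₁) (0, 1, 0) f) (x.1, x.2, 0)
      = partialWithin (base s₁ s₂) 1 (fun x => dirBeta s₁ s₂ β₁ f (x.1, x.2, 0)) x := by
  have h0 : (0 : ℝ) ∈ Icc 0 β₁ := ⟨le_rfl, hβ₁.le⟩
  have hd := contDiffOn_dirBeta hs hβ₁ hf
  rw [partialWithin_slice_one hs (hd.differentiableOn (by simp)) hx h0]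
  exact dirWithin_comm (uniqueDiffOn_box hs hβ₁) (box_subset_closure_interior hs hβ₁) hf _ _
    (mk_mem_box hx h0)

lemma dirBeta_dirBeta_dirWithin_one (hs : s₁ < s₂) (hβ₁ : 0 < β₁)
    (hf : ContDiffOn ℝ ∞ f (box s₁ s₂ β₁)) {x : ℝ × ℝ} (hx : x ∈ base s₁ s₂) :
    dirBeta s₁ s₂ β₁ (dirBeta s₁ s₂ β₁ (dirWithin (box s₁ s₂ β₁) (0, 1, 0) f)) (x.1, x.2, 0)
      = partialWithin (base s₁ s₂) 1
        (fun x => dirBeta s₁ s₂ β₁ (dirBeta s₁ s₂ β₁ f) (x.1, x.2, 0)) x := by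
  have h0 : (0 : ℝ) ∈ Icc 0 β₁ := ⟨le_rfl, hβ₁.le⟩
  have hd := contDiffOn_dirBeta hs hβ₁ hf
  have hX := uniqueDiffOn_box hs hβ₁
  have hX' := box_subset_closure_interior hs hβ₁
  rw [← dirBeta_dirWithin_one hs hβ₁ hd hx]
  exact dirWithin_congr (fun y hy => dirWithin_comm hX hX' hf _ _ hy) (mk_mem_box hx h0) _

end Base

end ElasticStrip
end

noncomputable section

open Set Filter Topology MeasureTheory

namespace ElasticStrip

/-! ### Passing to the limit in integrals -/

/-- βⁿ |∫c| is at most the integrated remainder plus |∫f|, both of order βⁿ⁺¹; divide by βⁿ and let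
β tend to 0. Every exact integral identity for minimizers passes to leading terms in this way. -/
lemma setIntegral_leading_eq_zero {α : Type*} [MeasurableSpace α] {μ : Measure α} {S : Set α}
    (hμ : μ S < ⊤) {f : α → ℝ → ℝ} {c : α → ℝ} {n : ℕ} {C C' δ : ℝ}
    (hδ : 0 < δ) (hf : ∀ β ∈ Ioo 0 δ, IntegrableOn (fun x => f x β) S μ) (hc : IntegrableOn c S μ)
    (hbound : ∀ x ∈ S, ∀ β ∈ Ioo 0 δ, ‖f x β - β ^ n • c x‖ ≤ C * β ^ (n + 1))
    (hint : ∀ β ∈ Ioo 0 δ, |∫ x in S, f x β ∂μ| ≤ C' * β ^ (n + 1)) :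
    ∫ x in S, c x ∂μ = 0 := by
  have key : ∀ β ∈ Ioo 0 δ, |∫ x in S, c x ∂μ| ≤ (C * μ.real S + C') * β := by
    intro β hβ
    have hβ0 : 0 < β := hβ.1
    have h1 := norm_setIntegral_le_of_norm_le_const hμ (fun x hx => hbound x hx β hβ)
    rw [integral_sub (g := fun x => β ^ n • c x) (hf β hβ) (hc.smul (β ^ n)), integral_smul, smul_eq_mul,
      Real.norm_eq_abs] at h1
    have h2 := hint β hβ
    have h3 : β ^ n * |∫ x in S, c x ∂μ| ≤ β ^ n * ((C * μ.real S + C') * β) := by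
      rw [← abs_of_pos (pow_pos hβ0 n), ← abs_mul, abs_of_pos (pow_pos hβ0 n)]
      have h4 := abs_sub_abs_le_abs_sub (β ^ n * ∫ x in S, c x ∂μ) (∫ x in S, f x β ∂μ)
      rw [abs_sub_comm] at h4
      have h5 : β ^ n * ((C * μ.real S + C') * β)
        = C * β ^ (n + 1) * μ.real S + C' * β ^ (n + 1) := by ring
      linarith
    exact le_of_mul_le_mul_left h3 (pow_pos hβ0 n)
  have hlim : Tendsto (fun β : ℝ => (C * μ.real S + C') * β) (𝓝[>] 0) (𝓝 0) := by
    have : Tendsto (fun β : ℝ => (C * μ.real S + C') * β) (𝓝 0)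
        (𝓝 ((C * μ.real S + C') * 0)) := tendsto_id.const_mul _
    rw [mul_zero] at this
    exact this.mono_left nhdsWithin_le_nhds
  have h0 : |∫ x in S, c x ∂μ| ≤ 0 :=
    ge_of_tendsto hlim (by filter_upwards [Ioo_mem_nhdsGT hδ] with β hβ using key β hβ)
  exact abs_nonpos_iff.1 h0

lemma eq_zero_of_setIntegral_eq_zero {s₁ s₂ : ℝ} (hs : s₁ < s₂) {c : ℝ × ℝ → ℝ}
    (hc : ContinuousOn c (base s₁ s₂)) (h0 : ∀ x, 0 ≤ c x) (hint : ∫ x in base s₁ s₂, c x = 0) :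
    ∀ x ∈ base s₁ s₂, c x = 0 := by
  have hi : IntegrableOn c (base s₁ s₂) := hc.integrableOn_compact isCompact_base
  have hae := (integral_eq_zero_iff_of_nonneg h0 hi).1 hint
  exact Measure.eqOn_of_ae_eq hae hc continuousOn_const (base_subset_closure_interior hs)

/-- If the square of an expansion has small integral, its leading term vanishes. -/
lemma HasExpansion.eq_zero_of_integral_sq_le {s₁ s₂ : ℝ} (hs : s₁ < s₂) {f : ℝ × ℝ → ℝ → ℝ}
    {c₀ c₁ c₂ : ℝ × ℝ → ℝ} (h : HasExpansion (base s₁ s₂) f c₀ c₁ c₂) {C δ : ℝ} (hδ : 0 < δ)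
    (hf : ∀ β ∈ Ioo 0 δ, ContinuousOn (fun x => f x β) (base s₁ s₂))
    (hint : ∀ β ∈ Ioo 0 δ, ∫ x in base s₁ s₂, f x β ^ 2 ≤ C * β) :
    ∀ x ∈ base s₁ s₂, c₀ x = 0 := by
  obtain ⟨C', δ', hδ', hC'⟩ := (h.mul isCompact_base h).bound_one isCompact_base
  have hc := h.cont₀.mul h.cont₀
  have key := setIntegral_leading_eq_zero (μ := volume) (n := 0) (C := C') (C' := C)
    (f := fun x β => f x β * f x β) (c := fun x => c₀ x * c₀ x)
    isCompact_base.measure_lt_top (lt_min hδ hδ')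
    (fun β hβ => ContinuousOn.integrableOn_compact isCompact_base
      ((hf β ⟨hβ.1, hβ.2.trans_le (min_le_left _ _)⟩).mul
      (hf β ⟨hβ.1, hβ.2.trans_le (min_le_left _ _)⟩)))
    (ContinuousOn.integrableOn_compact isCompact_base hc)
    (fun x hx β hβ => by
      simpa using hC' x hx β ⟨hβ.1, hβ.2.trans_le (min_le_right _ _)⟩)
    (fun β hβ => by
      have := hint β ⟨hβ.1, hβ.2.trans_le (min_le_left _ _)⟩
      simp only [pow_two] at this
      rw [abs_of_nonneg (integral_nonneg fun x => mul_self_nonneg _)]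
      simpa using this)
  intro x hx
  exact mul_self_eq_zero.1 (eq_zero_of_setIntegral_eq_zero hs hc
    (fun x => mul_self_nonneg (c₀ x)) key x hx)

namespace CenteredStrip

variable (M : CenteredStrip)

/-! ### Expansion of the reference metric -/

lemma contDiffOn_comp_chart {s₁ s₂ β₁ : ℝ} (hsub : Icc s₁ s₂ ⊆ Icc M.a M.b) (hβ₁ : β₁ ≤ 1)
    {F : ℝ × ℝ → ℝ} (hF : ContDiffOn ℝ ∞ F (M.D 1)) :
    ContDiffOn ℝ ∞ (fun y : ℝ × ℝ × ℝ => F (M.chart y.2.2 (y.1, y.2.1))) (box s₁ s₂ β₁) := by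
  have hB : ContDiffOn ℝ ∞ (fun y : ℝ × ℝ × ℝ => M.B y.1) (box s₁ s₂ β₁) :=
    M.B_smooth.comp contDiffOn_fst fun y hy => hsub hy.1
  have hc : ContDiffOn ℝ ∞ (fun y : ℝ × ℝ × ℝ => M.chart y.2.2 (y.1, y.2.1)) (box s₁ s₂ β₁) :=
    contDiffOn_fst.prodMk (((contDiff_snd.comp contDiff_snd).contDiffOn.mul hB).mul
      (contDiff_fst.comp contDiff_snd).contDiffOn)
  exact hF.comp hc fun y hy => M.D_subset (hy.2.2.2.trans hβ₁)
    (M.chart_mapsTo hy.2.2.1 ⟨hsub hy.1, hy.2.1⟩)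

lemma dirBeta_comp_chart {s₁ s₂ β₁ : ℝ} (hsub : Icc s₁ s₂ ⊆ Icc M.a M.b) (hβ₁ : 0 < β₁)
    (hβ₁' : β₁ ≤ 1) {F : ℝ × ℝ → ℝ} (hF : ContDiffOn ℝ ∞ F (M.D 1)) {x : ℝ × ℝ}
    (hx : x ∈ base s₁ s₂) {β : ℝ} (hβ : β ∈ Icc 0 β₁) :
    dirBeta s₁ s₂ β₁ (fun y : ℝ × ℝ × ℝ => F (M.chart y.2.2 (y.1, y.2.1))) (x.1, x.2, β)
      = partialWithin (M.D 1) 1 F (M.chart β x) * (M.B x.1 * x.2) := by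
  refine dirBeta_eq hβ₁ ((M.contDiffOn_comp_chart hsub hβ₁' hF).differentiableOn (by simp)) hx hβ ?_
  have hmaps : MapsTo (fun β => M.chart β x) (Icc 0 β₁) (M.D 1) := fun β hβ =>
    M.D_subset (hβ.2.trans hβ₁') (M.chart_mapsTo hβ.1 ⟨hsub hx.1, hx.2⟩)
  have h1 : HasDerivWithinAt (fun β => M.chart β x) (0, M.B x.1 * x.2) (Icc 0 β₁) β := by
    refine (hasDerivWithinAt_const _ _ _).prodMk ?_
    have := (((hasDerivAt_id β).mul_const (M.B x.1)).mul_const x.2).hasDerivWithinAt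
      (s := Icc 0 β₁)
    simpa using this
  have h2 := ((hF _ (hmaps hβ)).differentiableWithinAt
    (by simp)).hasFDerivWithinAt.comp_hasDerivWithinAt β h1 hmaps
  refine h2.congr_deriv ?_
  rw [fderivWithin_eq_partialWithin]
  simp [mul_comm]

/-- At fixed (s, r) the chart moves in β along u² with speed B r, so each β-derivative is a
u²-derivative times B r. -/
lemma hasExpansion_G {s₁ s₂ β₁ : ℝ} (hs : s₁ < s₂) (hsub : Icc s₁ s₂ ⊆ Icc M.a M.b)
    (hβ₁ : 0 < β₁) (hβ₁' : β₁ ≤ 1) :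
    HasExpansion (base s₁ s₂) (fun x β => M.G (M.chart β x)) (fun _ => 1)
      (fun x => M.G' (x.1, 0) * (M.B x.1 * x.2))
      (fun x => 1 / 2 * (M.G'' (x.1, 0) * (M.B x.1 * x.2) ^ 2)) := by
  have h0 : (0 : ℝ) ∈ Icc 0 β₁ := ⟨le_rfl, hβ₁.le⟩
  have hchart : ∀ x : ℝ × ℝ, M.chart 0 x = (x.1, 0) := fun x => by simp [chart, pt]
  refine (hasExpansion_of_contDiffOn hs hβ₁ (M.contDiffOn_comp_chart hsub hβ₁' M.G_smooth)).congr
    hβ₁ (fun x _ β _ => rfl) (fun x hx => ?_) (fun x hx => ?_) fun x hx => ?_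
  · simp [hchart, M.G_center (hsub hx.1)]
  · rw [M.dirBeta_comp_chart hsub hβ₁ hβ₁' M.G_smooth hx h0, hchart]
    rfl
  · have hX := uniqueDiffOn_box hs hβ₁
    have hcongr : ∀ y ∈ box s₁ s₂ β₁,
        dirBeta s₁ s₂ β₁ (fun y : ℝ × ℝ × ℝ => M.G (M.chart y.2.2 (y.1, y.2.1))) y
          = M.G' (M.chart y.2.2 (y.1, y.2.1)) * (M.B y.1 * y.2.1) := fun y hy =>
      M.dirBeta_comp_chart hsub hβ₁ hβ₁' M.G_smooth (x := (y.1, y.2.1)) ⟨hy.1, hy.2.1⟩ hy.2.2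
    have hd := contDiffOn_dirBeta hs hβ₁ (M.contDiffOn_comp_chart hsub hβ₁' M.G_smooth)
    have hG' := (M.contDiffOn_comp_chart hsub hβ₁' M.G'_smooth).differentiableOn (by simp)
    have h1 := hasDerivWithinAt_line hG' hx h0
    rw [M.dirBeta_comp_chart hsub hβ₁ hβ₁' M.G'_smooth hx h0] at h1
    have h2 := dirBeta_eq hβ₁ (hd.differentiableOn (by simp)) hx h0
      ((h1.mul_const (M.B x.1 * x.2)).congr (fun β hβ => hcongr _ (mk_mem_box hx hβ))
        (hcongr _ (mk_mem_box hx h0)))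
    rw [h2, smul_eq_mul, hchart]
    have e : partialWithin (M.D 1) 1 M.G' (x.1, 0) = M.G'' (x.1, 0) := rfl
    rw [e]
    ring

/-- Only the leading coefficient is computed: this factor always multiplies quantities whose leading
term is what is sought. The same applies to the square root below. -/
lemma hasExpansion_inv_G {s₁ s₂ β₁ : ℝ} (hs : s₁ < s₂) (hsub : Icc s₁ s₂ ⊆ Icc M.a M.b)
    (hβ₁ : 0 < β₁) (hβ₁' : β₁ ≤ 1) :
    ∃ c₁ c₂, HasExpansion (base s₁ s₂) (fun x β => (M.G (M.chart β x))⁻¹) (fun _ => 1) c₁ c₂ := by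
  have h := M.G_smooth.inv fun u hu => (M.G_pos hu).ne'
  refine ⟨_, _, (hasExpansion_of_contDiffOn hs hβ₁ (M.contDiffOn_comp_chart hsub hβ₁' h)).congr
    hβ₁ (fun x _ β _ => rfl) (fun x hx => ?_) (fun x hx => rfl) fun x hx => rfl⟩
  simp [chart, pt, M.G_center (hsub hx.1)]

lemma hasExpansion_sqrt_G {s₁ s₂ β₁ : ℝ} (hs : s₁ < s₂) (hsub : Icc s₁ s₂ ⊆ Icc M.a M.b)
    (hβ₁ : 0 < β₁) (hβ₁' : β₁ ≤ 1) :
    ∃ c₁ c₂, HasExpansion (base s₁ s₂) (fun x β => √(M.G (M.chart β x))) (fun _ => 1) c₁ c₂ := by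
  have h := M.G_smooth.sqrt fun u hu => (M.G_pos hu).ne'
  refine ⟨_, _, (hasExpansion_of_contDiffOn hs hβ₁ (M.contDiffOn_comp_chart hsub hβ₁' h)).congr
    hβ₁ (fun x _ β _ => rfl) (fun x hx => ?_) (fun x hx => rfl) fun x hx => rfl⟩
  simp [chart, pt, M.G_center (hsub hx.1)]

/-! ### The energy of minimizers -/

/-- The flat embedding that straightens the center curve. -/
def flat (u : ℝ × ℝ) : Plane := !₂[u.1, u.2]

lemma flat_eq : ∃ L : ℝ × ℝ →L[ℝ] Plane, flat = L := by
  refine ⟨LinearMap.toContinuousLinearMap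
    { toFun := flat, map_add' := fun u v => ?_, map_smul' := fun c u => ?_ }, rfl⟩ <;>
  · ext i
    fin_cases i <;> simp [flat]

lemma partialWithin_flat {β : ℝ} (hβ : 0 < β) {u : ℝ × ℝ} (hu : u ∈ M.D β) (i : Fin 2) :
    partialWithin (M.D β) i flat u = flat (coordVec i) := by
  obtain ⟨L, hL⟩ := flat_eq
  rw [hL]
  exact partialWithin_eq_of_hasFDerivWithinAt (M.uniqueDiffOn_D hβ) hu
    L.hasFDerivAt.hasFDerivWithinAt i

lemma isPlaneEmbedding_flat (k : ℕ∞) {β : ℝ} (hβ : 0 < β) : M.IsPlaneEmbedding k β flat := by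
  have hinj : Function.Injective flat := fun u v h => by
    have h0 := congrArg (fun w : Plane => w 0) h
    have h1 := congrArg (fun w : Plane => w 1) h
    exact Prod.ext (by simpa [flat] using h0) (by simpa [flat] using h1)
  obtain ⟨L, hL⟩ := flat_eq
  refine ⟨?_, hinj.injOn, fun u hu => ?_⟩
  · rw [hL]; exact L.contDiff.contDiffOn
  · refine (linearIndependent_partialWithin_iff _ _ _).2 ?_
    rw [hL, L.fderivWithin (M.uniqueDiffOn_D hβ u hu), ← hL]
    exact hinj

lemma density_flat (Y ν : ℝ) {β : ℝ} (hβ : 0 < β) (hβ' : β ≤ 1) {u : ℝ × ℝ} (hu : u ∈ M.D β) :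
    M.density Y ν (fun i j => M.strain β flat i j u) (fun i j => M.strain β flat i j u) u
      = (lameLambda Y ν + 2 * lameMu Y ν) / 8 * (M.G u)⁻¹ ^ 2 * √(M.G u) * (M.G u - 1) ^ 2 := by
  have hu1 := M.D_subset hβ' hu
  have h00 : M.strain β flat 0 0 u = (1 - M.G u) / 2 := by
    simp [strain, inducedMetric, M.partialWithin_flat hβ hu, flat, coordVec, inner_plane, G,
      -inner_self_eq_norm_sq_to_K]
  have h01 : M.strain β flat 0 1 u = 0 := by
    simp [strain, inducedMetric, M.partialWithin_flat hβ hu, flat, coordVec, inner_plane,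
      M.g01 hu1]
  have h11 : M.strain β flat 1 1 u = 0 := by
    simp [strain, inducedMetric, M.partialWithin_flat hβ hu, flat, coordVec, inner_plane,
      M.g11 hu1, -inner_self_eq_norm_sq_to_K]
  simp only [density, h00, h01, h11]
  ring

/-- The only strain of the flat competitor is (1 - G)/2, which is O(β) as G = 1 on the center curve.
Its square gives β², the area element of the narrowed strip one more β. -/
lemma exists_energy_flat_le (Y ν : ℝ) :
    ∃ C, ∃ δ > 0, ∀ β ∈ Ioo 0 δ, M.energy Y ν β flat ≤ C * β ^ 3 := by
  obtain ⟨C₁, δ, hδ, hC₁⟩ := (M.hasExpansion_G M.hab Subset.rfl one_pos le_rfl).bound_one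
    isCompact_base
  have hG : ContinuousOn M.G (M.D 1) := M.G_smooth.continuousOn
  obtain ⟨C₂, hC₂⟩ := (M.isCompact_D one_pos).exists_bound_of_continuousOn
    ((continuousOn_const (c := (lameLambda Y ν + 2 * lameMu Y ν) / 8)).mul
      ((M.continuousOn_inv_G le_rfl).pow 2) |>.mul hG.sqrt)
  obtain ⟨C₃, hC₃⟩ := isCompact_Icc.exists_bound_of_continuousOn M.B_smooth.continuousOn
  refine ⟨C₃ * (|C₂| * C₁ ^ 2) * volume.real M.rect, min δ 1, lt_min hδ one_pos, fun β hβ => ?_⟩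
  have hβ0 : 0 < β := hβ.1
  have hβ1 : β ≤ 1 := (hβ.2.trans_le (min_le_right _ _)).le
  rw [M.energy_eq Y ν hβ0 hβ1, M.setIntegral_D hβ0]
  refine (le_abs_self _).trans ?_
  rw [← Real.norm_eq_abs]
  refine (norm_setIntegral_le_of_norm_le_const (C := C₃ * (|C₂| * C₁ ^ 2) * β ^ 3)
    M.isCompact_rect.measure_lt_top fun x hx => ?_).trans (le_of_eq (by ring))
  have hu := M.chart_mapsTo hβ0.le hx
  rw [M.density_flat Y ν hβ0 hβ1 hu, norm_smul, norm_mul, norm_mul, norm_pow, Real.norm_eq_abs β,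
    abs_of_pos hβ0]
  have h1 := hC₁ x hx β ⟨hβ0, hβ.2.trans_le (min_le_left _ _)⟩
  have h2 := (hC₂ _ (M.D_subset hβ1 hu)).trans (le_abs_self C₂)
  have h3 := hC₃ x.1 hx.1
  calc β * ‖M.B x.1‖ * (_ * ‖M.G (M.chart β x) - 1‖ ^ 2)
      ≤ β * C₃ * (|C₂| * (C₁ * β) ^ 2) := by
        gcongr
        · exact mul_nonneg hβ0.le ((norm_nonneg _).trans h3)
        · exact h2
    _ = _ := by ring

/-- The range of ν makes the energy density positive definite; compactness of the full strip makes
the constant uniform in β and in the point. -/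
lemma exists_density_ge {Y ν : ℝ} (hY : 0 < Y) (hν : -1 < ν) (hν' : ν < 1) :
    ∃ c > 0, ∀ u ∈ M.D 1, ∀ E : Fin 2 → Fin 2 → ℝ,
      c * (E 0 0 ^ 2 + E 0 1 ^ 2 + E 1 1 ^ 2) ≤ M.density Y ν E E u := by
  have hG : ContinuousOn M.G (M.D 1) := M.G_smooth.continuousOn
  obtain ⟨w, hw, hwG⟩ := (M.isCompact_D one_pos).exists_forall_le' (M.continuousOn_inv_G le_rfl)
    (a := 0) fun u hu => inv_pos.2 (M.G_pos hu)
  obtain ⟨h, hh, hhG⟩ := (M.isCompact_D one_pos).exists_forall_le' hG.sqrt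
    (a := 0) fun u hu => Real.sqrt_pos.2 (M.G_pos hu)
  have h1 : 0 < 1 + ν := by linarith
  have h2 : 0 < 1 - ν := by linarith
  -- A common factor of the Lamé parameters, chosen so that the moduli below become 1 + ν and 1 - ν.
  set κ := Y / (2 * ((1 + ν) * (1 - ν))) with hκ
  have hκ0 : 0 < κ := by positivity
  have hlam : lameLambda Y ν = 2 * κ * ν := by
    rw [lameLambda, hκ]; field_simp
  have hmu : lameMu Y ν = κ * (1 - ν) := by
    rw [lameMu, hκ]; field_simp
  set m := min (1 + ν) (1 - ν) with hm
  have hm0 : 0 < m := lt_min h1 h2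
  have hm1 : m ≤ 1 + ν := min_le_left _ _
  have hm2 : m ≤ 1 - ν := min_le_right _ _
  refine ⟨κ * m * min (min (w ^ 2) w) 1 * h, by positivity, fun u hu E => ?_⟩
  set t := (M.G u)⁻¹ with ht
  have htw : w ≤ t := hwG u hu
  have ht0 : 0 < t := hw.trans_le htw
  have hq : κ * (m * ((t * E 0 0) ^ 2 + t * E 0 1 ^ 2 + E 1 1 ^ 2)) ≤
      1 / 2 * (lameLambda Y ν * ((t * E 0 0 + E 1 1) * (t * E 0 0 + E 1 1))
        + 2 * lameMu Y ν * (t ^ 2 * (E 0 0 * E 0 0) + 2 * t * (E 0 1 * E 0 1)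
          + E 1 1 * E 1 1)) := by
    -- Diagonalization: trace with weight 1 + ν, difference of the principal entries and shear with
    -- weight 1 - ν.
    have e : 1 / 2 * (lameLambda Y ν * ((t * E 0 0 + E 1 1) * (t * E 0 0 + E 1 1))
        + 2 * lameMu Y ν * (t ^ 2 * (E 0 0 * E 0 0) + 2 * t * (E 0 1 * E 0 1) + E 1 1 * E 1 1))
        = κ * ((1 + ν) * ((t * E 0 0 + E 1 1) ^ 2 / 2) + (1 - ν) * ((t * E 0 0 - E 1 1) ^ 2 / 2)
          + (1 - ν) * (2 * (t * E 0 1 ^ 2))) := by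
      rw [hlam, hmu]; ring
    rw [e]
    refine mul_le_mul_of_nonneg_left ?_ hκ0.le
    have q1 := mul_le_mul_of_nonneg_right hm1
      (by positivity : 0 ≤ (t * E 0 0 + E 1 1) ^ 2 / 2)
    have q2 := mul_le_mul_of_nonneg_right hm2
      (by positivity : 0 ≤ (t * E 0 0 - E 1 1) ^ 2 / 2)
    have q3 := mul_le_mul_of_nonneg_right hm2 (by positivity : 0 ≤ 2 * (t * E 0 1 ^ 2))
    have q4 : 0 ≤ m * (t * E 0 1 ^ 2) := by positivity
    have q5 : m * ((t * E 0 0) ^ 2 + t * E 0 1 ^ 2 + E 1 1 ^ 2)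
      = m * ((t * E 0 0 + E 1 1) ^ 2 / 2) + m * ((t * E 0 0 - E 1 1) ^ 2 / 2)
        + m * (2 * (t * E 0 1 ^ 2)) - m * (t * E 0 1 ^ 2) := by ring
    linarith
  have hmin : min (min (w ^ 2) w) 1 * (E 0 0 ^ 2 + E 0 1 ^ 2 + E 1 1 ^ 2)
      ≤ (t * E 0 0) ^ 2 + t * E 0 1 ^ 2 + E 1 1 ^ 2 := by
    have k1 : min (min (w ^ 2) w) 1 ≤ t ^ 2 :=
      ((min_le_left _ _).trans (min_le_left _ _)).trans (by gcongr)
    have k2 : min (min (w ^ 2) w) 1 ≤ t := ((min_le_left _ _).trans (min_le_right _ _)).trans htw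
    have k3 : min (min (w ^ 2) w) 1 ≤ 1 := min_le_right _ _
    have j1 := mul_le_mul_of_nonneg_right k1 (sq_nonneg (E 0 0))
    have j2 := mul_le_mul_of_nonneg_right k2 (sq_nonneg (E 0 1))
    have j3 := mul_le_mul_of_nonneg_right k3 (sq_nonneg (E 1 1))
    rw [mul_pow]
    linarith
  calc κ * m * min (min (w ^ 2) w) 1 * h * (E 0 0 ^ 2 + E 0 1 ^ 2 + E 1 1 ^ 2)
      = κ * (m * (min (min (w ^ 2) w) 1 * (E 0 0 ^ 2 + E 0 1 ^ 2 + E 1 1 ^ 2))) * h := by ring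
    _ ≤ κ * (m * ((t * E 0 0) ^ 2 + t * E 0 1 ^ 2 + E 1 1 ^ 2)) * √(M.G u) := by
        gcongr
        exact hhG u hu
    _ ≤ _ := mul_le_mul_of_nonneg_right hq (Real.sqrt_nonneg _)

/-- The strain of minimizers is small in mean square. -/
lemma exists_integral_strain_sq_le {k : ℕ∞} (hk : 1 ≤ k) {Y ν : ℝ} (hY : 0 < Y) (hν : -1 < ν)
    (hν' : ν < 1) {s₁ s₂ : ℝ} (hsub : Icc s₁ s₂ ⊆ Icc M.a M.b) :
    ∃ C, ∃ δ > 0, ∀ β ∈ Ioo 0 δ, ∀ p, M.IsMinimizer k Y ν β p →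
      ∫ x in base s₁ s₂, (M.strain β p 0 0 (M.chart β x) ^ 2 + M.strain β p 0 1 (M.chart β x) ^ 2
        + M.strain β p 1 1 (M.chart β x) ^ 2) ≤ C * β ^ 2 := by
  obtain ⟨C, δ, hδ, hC⟩ := M.exists_energy_flat_le Y ν
  obtain ⟨c, hc, hcoer⟩ := M.exists_density_ge hY hν hν'
  obtain ⟨B₀, hB₀, hB⟩ := isCompact_Icc.exists_forall_le' M.B_smooth.continuousOn M.B_pos
  refine ⟨C / (c * B₀), min δ 1, lt_min hδ one_pos, fun β hβ p hp => ?_⟩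
  have hβ0 : 0 < β := hβ.1
  have hβ1 : β ≤ 1 := (hβ.2.trans_le (min_le_right _ _)).le
  have hp1 := hp.embedding.contDiffOn_one hk
  have hstr := M.continuousOn_strain hβ0 hβ1 hp1
  have hchart := (M.contDiffOn_chart β).continuousOn
  have hmaps := M.chart_mapsTo hβ0.le
  have hcs : ∀ i j, ContinuousOn (fun x => M.strain β p i j (M.chart β x)) M.rect := fun i j =>
    (hstr i j).comp hchart hmaps
  have hbr : base s₁ s₂ ⊆ M.rect := prod_mono hsub Subset.rfl
  have hBc : ContinuousOn (fun x : ℝ × ℝ => M.B x.1) M.rect :=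
    M.B_smooth.continuousOn.comp continuousOn_fst fun x hx => hx.1
  have hen := (hp.le _ (M.isPlaneEmbedding_flat k hβ0)).trans
    (hC β ⟨hβ0, hβ.2.trans_le (min_le_left _ _)⟩)
  rw [M.energy_eq Y ν hβ0 hβ1, M.setIntegral_D hβ0] at hen
  set S : ℝ × ℝ → ℝ := fun x => M.strain β p 0 0 (M.chart β x) ^ 2
    + M.strain β p 0 1 (M.chart β x) ^ 2 + M.strain β p 1 1 (M.chart β x) ^ 2 with hS
  have hSc : ContinuousOn S M.rect :=
    (((hcs 0 0).pow 2).add ((hcs 0 1).pow 2)).add ((hcs 1 1).pow 2)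
  have hSi : IntegrableOn S M.rect := hSc.integrableOn_compact M.isCompact_rect
  have h1 : ∫ x in base s₁ s₂, S x ≤ ∫ x in M.rect, S x :=
    setIntegral_mono_set hSi (ae_of_all _ fun x => by simp only [hS]; positivity)
      hbr.eventuallyLE
  have h2 : β * B₀ * c * ∫ x in M.rect, S x ≤ C * β ^ 3 := by
    refine le_trans ?_ hen
    rw [← integral_const_mul]
    refine setIntegral_mono_on (hSi.const_mul _) ?_ M.isCompact_rect.measurableSet fun x hx => ?_
    · refine ContinuousOn.integrableOn_compact M.isCompact_rect ?_
      exact (continuousOn_const.mul hBc).smul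
        ((M.continuousOn_density Y ν hβ1 hstr hstr).comp hchart hmaps)
    · have k1 := hcoer _ (M.D_subset hβ1 (hmaps hx)) fun i j => M.strain β p i j (M.chart β x)
      have k2 := hB x.1 hx.1
      rw [smul_eq_mul, mul_assoc]
      have hS0 : 0 ≤ S x := by simp only [hS]; positivity
      have hB0 : 0 ≤ β * M.B x.1 := mul_nonneg hβ0.le (hB₀.le.trans k2)
      gcongr
  have hden : 0 < β * B₀ * c := by positivity
  calc ∫ x in base s₁ s₂, S x ≤ ∫ x in M.rect, S x := h1
    _ ≤ C * β ^ 3 / (β * B₀ * c) := by rwa [le_div_iff₀ hden, mul_comm]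
    _ = C / (c * B₀) * β ^ 2 := by field_simp

end CenteredStrip

end ElasticStrip
end

/-! ### Smooth families of minimizers and expansion of their derivatives -/

noncomputable section

open Set Filter Topology MeasureTheory

namespace ElasticStrip

/-- Needed for (s, r) ↦ (s, 0), to expand positions relative to the center curve. -/
lemma HasExpansion.comp {E : Type*} [NormedAddCommGroup E] [NormedSpace ℝ E] {K : Set (ℝ × ℝ)}
    {f : ℝ × ℝ → ℝ → E} {c₀ c₁ c₂ : ℝ × ℝ → E} (h : HasExpansion K f c₀ c₁ c₂)
    {φ : ℝ × ℝ → ℝ × ℝ} (hφ : ContinuousOn φ K) (hK : MapsTo φ K K) :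
    HasExpansion K (fun x β => f (φ x) β) (fun x => c₀ (φ x)) (fun x => c₁ (φ x))
      (fun x => c₂ (φ x)) := by
  obtain ⟨C, δ, hδ, hC⟩ := h.bound
  exact ⟨h.cont₀.comp hφ hK, h.cont₁.comp hφ hK, h.cont₂.comp hφ hK, C, δ, hδ,
    fun x hx β hβ => hC _ (hK hx) β hβ⟩

namespace CenteredStrip

/-- A family of energy-minimizing embeddings that is smooth, in normalized coordinates and over
`[s₁, s₂]`, up to `β = 0`. -/
structure MinimizingFamily (M : CenteredStrip) (k : ℕ∞) (Y ν s₁ s₂ β₁ : ℝ)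
    (p : ℝ → ℝ × ℝ → Plane) (P : ℝ × ℝ × ℝ → Plane) : Prop where
  one_le : 1 ≤ k
  Y_pos : 0 < Y
  neg_one_lt : -1 < ν
  lt_one : ν < 1
  lt : s₁ < s₂
  sub : Icc s₁ s₂ ⊆ Icc M.a M.b
  pos : 0 < β₁
  le_one : β₁ ≤ 1
  smooth : ContDiffOn ℝ ∞ P (box s₁ s₂ β₁)
  isMinimizer : ∀ β ∈ Ioc 0 β₁, M.IsMinimizer k Y ν β (p β)
  eq : ∀ x ∈ base s₁ s₂, ∀ β ∈ Ioc 0 β₁, p β (M.chart β x) = P (x.1, x.2, β)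

namespace MinimizingFamily

variable {M : CenteredStrip} {k : ℕ∞} {Y ν s₁ s₂ β₁ : ℝ} {p : ℝ → ℝ × ℝ → Plane}
  {P : ℝ × ℝ × ℝ → Plane}

lemma base_subset (h : MinimizingFamily M k Y ν s₁ s₂ β₁ p P) : base s₁ s₂ ⊆ M.rect :=
  prod_mono h.sub Subset.rfl

lemma contDiffOn_one (h : MinimizingFamily M k Y ν s₁ s₂ β₁ p P) {β : ℝ} (hβ : β ∈ Ioc 0 β₁) :
    ContDiffOn ℝ 1 (p β) (M.D β) := (h.isMinimizer β hβ).embedding.contDiffOn_one h.one_le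

lemma B_pos (h : MinimizingFamily M k Y ν s₁ s₂ β₁ p P) {x : ℝ × ℝ} (hx : x ∈ base s₁ s₂) :
    0 < M.B x.1 := M.B_pos _ (h.sub hx.1)

lemma continuousOn_B (h : MinimizingFamily M k Y ν s₁ s₂ β₁ p P) :
    ContinuousOn (fun x : ℝ × ℝ => M.B x.1) (base s₁ s₂) :=
  M.B_smooth.continuousOn.comp continuousOn_fst fun _ hx => h.sub hx.1

/-- The chain rule for the embeddings in normalized coordinates. -/
lemma fderivWithin_slice (h : MinimizingFamily M k Y ν s₁ s₂ β₁ p P) {x : ℝ × ℝ}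
    (hx : x ∈ base s₁ s₂) {β : ℝ} (hβ : β ∈ Ioc 0 β₁) :
    (fderivWithin ℝ P (box s₁ s₂ β₁) (x.1, x.2, β)).comp sliceDeriv
      = (fderivWithin ℝ (p β) (M.D β) (M.chart β x)).comp (M.chartDeriv β x) := by
  have h1 := hasFDerivWithinAt_slice (h.smooth.differentiableOn (by simp)) hx
    (Ioc_subset_Icc_self hβ)
  have h2 := (M.hasFDerivWithinAt_comp_chart hβ.1.le
    ((h.contDiffOn_one hβ).differentiableOn one_ne_zero) (h.base_subset hx)).mono h.base_subset
  -- The same map on the rectangle is differentiated once through the smooth family and once through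
  -- the chart.
  exact (uniqueDiffOn_base h.lt x hx).eq h1
    (h2.congr (fun y hy => (h.eq y hy β hβ).symm) (h.eq x hx β hβ).symm)

lemma dirWithin_r (h : MinimizingFamily M k Y ν s₁ s₂ β₁ p P) {x : ℝ × ℝ}
    (hx : x ∈ base s₁ s₂) {β : ℝ} (hβ : β ∈ Ioc 0 β₁) :
    dirWithin (box s₁ s₂ β₁) (0, 1, 0) P (x.1, x.2, β)
      = (β * M.B x.1) • partialWithin (M.D β) 1 (p β) (M.chart β x) := by
  have := congrArg (fun L => L ((0 : ℝ), (1 : ℝ))) (h.fderivWithin_slice hx hβ)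
  simpa [chartDeriv_apply, sliceDeriv, fderivWithin_eq_partialWithin, dirWithin] using this

lemma partialWithin_one (h : MinimizingFamily M k Y ν s₁ s₂ β₁ p P) {x : ℝ × ℝ}
    (hx : x ∈ base s₁ s₂) {β : ℝ} (hβ : β ∈ Ioc 0 β₁) :
    partialWithin (M.D β) 1 (p β) (M.chart β x)
      = (M.B x.1)⁻¹ • β⁻¹ • dirWithin (box s₁ s₂ β₁) (0, 1, 0) P (x.1, x.2, β) := by
  have hB := (h.B_pos hx).ne'
  have hβ0 := hβ.1.ne'
  rw [h.dirWithin_r hx hβ, smul_smul, smul_smul]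
  rw [show (M.B x.1)⁻¹ * β⁻¹ * (β * M.B x.1) = 1 by field_simp, one_smul]

/-- Moving along u¹ at fixed u² changes r at the rate -(B'/B) r, which produces the second term. -/
lemma partialWithin_zero (h : MinimizingFamily M k Y ν s₁ s₂ β₁ p P) {x : ℝ × ℝ}
    (hx : x ∈ base s₁ s₂) {β : ℝ} (hβ : β ∈ Ioc 0 β₁) :
    partialWithin (M.D β) 0 (p β) (M.chart β x)
      = dirWithin (box s₁ s₂ β₁) (1, 0, 0) P (x.1, x.2, β)
        - (M.dB x.1 / M.B x.1 * x.2) • dirWithin (box s₁ s₂ β₁) (0, 1, 0) P (x.1, x.2, β) := by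
  have hB := (h.B_pos hx).ne'
  have := congrArg (fun L => L ((1 : ℝ), (0 : ℝ))) (h.fderivWithin_slice hx hβ)
  have h1 : dirWithin (box s₁ s₂ β₁) (1, 0, 0) P (x.1, x.2, β)
      = partialWithin (M.D β) 0 (p β) (M.chart β x)
        + (β * x.2 * M.dB x.1) • partialWithin (M.D β) 1 (p β) (M.chart β x) := by
    simpa [chartDeriv_apply, sliceDeriv, fderivWithin_eq_partialWithin, dirWithin] using this
  rw [h1, h.dirWithin_r hx hβ, smul_smul,
    show M.dB x.1 / M.B x.1 * x.2 * (β * M.B x.1) = β * x.2 * M.dB x.1 by field_simp]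
  simp

/-- The limit of the embeddings as `β → 0` does not depend on the transverse coordinate. -/
lemma dirWithin_r_zero (h : MinimizingFamily M k Y ν s₁ s₂ β₁ p P) {x : ℝ × ℝ}
    (hx : x ∈ base s₁ s₂) : dirWithin (box s₁ s₂ β₁) (0, 1, 0) P (x.1, x.2, 0) = 0 := by
  have hPr := contDiffOn_dirWithin (uniqueDiffOn_box h.lt h.pos) h.smooth (0, 1, 0)
  have hB : ContDiffOn ℝ ∞ (fun y : ℝ × ℝ × ℝ => M.B y.1) (box s₁ s₂ β₁) :=
    M.B_smooth.comp contDiffOn_fst fun y hy => h.sub hy.1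
  -- This function equals 2 (βB)² E₂₂ for β > 0. Unlike E₂₂, which involves division by β, it is
  -- visibly smooth up to β = 0. The energy bound makes it small in mean square, so its value |∂ᵣP|²
  -- at β = 0 vanishes.
  have hF : ContDiffOn ℝ ∞ (fun y : ℝ × ℝ × ℝ =>
      inner ℝ (dirWithin (box s₁ s₂ β₁) (0, 1, 0) P y) (dirWithin (box s₁ s₂ β₁) (0, 1, 0) P y)
        - (y.2.2 * M.B y.1) ^ 2) (box s₁ s₂ β₁) :=
    (hPr.inner ℝ hPr).sub (((contDiff_snd.comp contDiff_snd).contDiffOn.mul hB).pow 2)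
  obtain ⟨C, δ, hδ, hC⟩ := M.exists_integral_strain_sq_le h.one_le h.Y_pos h.neg_one_lt h.lt_one
    h.sub
  obtain ⟨m, hm⟩ := isCompact_base.exists_bound_of_continuousOn h.continuousOn_B
  have hexp := hasExpansion_of_contDiffOn h.lt h.pos hF
  have key := hexp.eq_zero_of_integral_sq_le h.lt (C := 4 * m ^ 4 * |C|) (lt_min hδ h.pos)
    (fun β hβ => (contDiffOn_slice hF
      ⟨hβ.1.le, (hβ.2.trans_le (min_le_right _ _)).le⟩).continuousOn)
    (fun β hβ => by
      have hβ0 : 0 < β := hβ.1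
      have hβ' : β ∈ Ioc 0 β₁ := ⟨hβ.1, (hβ.2.trans_le (min_le_right _ _)).le⟩
      have hβ1 : β ≤ 1 := hβ'.2.trans h.le_one
      have hint := hC β ⟨hβ.1, hβ.2.trans_le (min_le_left _ _)⟩ (p β) (h.isMinimizer β hβ')
      have hcs : ∀ i j, ContinuousOn (fun x => M.strain β (p β) i j (M.chart β x)) (base s₁ s₂) :=
        fun i j => ((M.continuousOn_strain hβ0 hβ1 (h.contDiffOn_one hβ') i j).comp
          (M.contDiffOn_chart β).continuousOn (M.chart_mapsTo hβ0.le)).mono h.base_subset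
      calc _ ≤ ∫ x in base s₁ s₂, 4 * m ^ 4 * β ^ 4 *
            (M.strain β (p β) 0 0 (M.chart β x) ^ 2 + M.strain β (p β) 0 1 (M.chart β x) ^ 2
              + M.strain β (p β) 1 1 (M.chart β x) ^ 2) := by
            refine setIntegral_mono_on ?_ ?_ isCompact_base.measurableSet fun x hx => ?_
            · exact ContinuousOn.integrableOn_compact isCompact_base
                ((contDiffOn_slice hF (Ioc_subset_Icc_self hβ')).continuousOn.pow 2)
            · exact ContinuousOn.integrableOn_compact isCompact_base (continuousOn_const.mul
                ((((hcs 0 0).pow 2).add ((hcs 0 1).pow 2)).add ((hcs 1 1).pow 2)))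
            · have hu := M.D_subset hβ1 (M.chart_mapsTo hβ0.le (h.base_subset hx))
              have hBx := h.B_pos hx
              have hBm : M.B x.1 ≤ m := (le_abs_self _).trans (hm x hx)
              have e : inner ℝ (dirWithin (box s₁ s₂ β₁) (0, 1, 0) P (x.1, x.2, β))
                  (dirWithin (box s₁ s₂ β₁) (0, 1, 0) P (x.1, x.2, β)) - (β * M.B x.1) ^ 2
                  = (β * M.B x.1) ^ 2 * (2 * M.strain β (p β) 1 1 (M.chart β x)) := by
                rw [h.dirWithin_r hx hβ', real_inner_smul_left, real_inner_smul_right, strain,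
                  inducedMetric, M.g11 hu]
                ring
              simp only [e]
              have e2 : ((β * M.B x.1) ^ 2 * (2 * M.strain β (p β) 1 1 (M.chart β x))) ^ 2
                = 4 * (M.B x.1) ^ 4 * β ^ 4 * M.strain β (p β) 1 1 (M.chart β x) ^ 2 := by ring
              rw [e2]
              have k1 : (M.B x.1) ^ 4 ≤ m ^ 4 := by gcongr
              have k2 : M.strain β (p β) 1 1 (M.chart β x) ^ 2 ≤
                M.strain β (p β) 0 0 (M.chart β x) ^ 2 + M.strain β (p β) 0 1 (M.chart β x) ^ 2
                + M.strain β (p β) 1 1 (M.chart β x) ^ 2 := by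
                linarith [sq_nonneg (M.strain β (p β) 0 0 (M.chart β x)),
                  sq_nonneg (M.strain β (p β) 0 1 (M.chart β x))]
              gcongr
        _ ≤ 4 * m ^ 4 * β ^ 4 * (C * β ^ 2) := by
            rw [integral_const_mul]
            gcongr
        _ ≤ 4 * m ^ 4 * (|C| * β) := by
            have k1 : β ^ 6 ≤ β := by
              simpa using pow_le_pow_of_le_one hβ0.le hβ1 (show 1 ≤ 6 by norm_num)
            have k2 : C * β ^ 6 ≤ |C| * β :=
              mul_le_mul (le_abs_self C) k1 (by positivity) (abs_nonneg C)
            have e : 4 * m ^ 4 * β ^ 4 * (C * β ^ 2) = 4 * m ^ 4 * (C * β ^ 6) := by ring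
            rw [e]
            gcongr
        _ = _ := by ring) x hx
  simpa using key

/-- The expansions of the embeddings and of their first derivatives. -/
lemma exists_expansions (h : MinimizingFamily M k Y ν s₁ s₂ β₁ p P) :
    ∃ p₀ p₁ p₂ b₂ : ℝ × ℝ → Plane, ContDiffOn ℝ ∞ p₀ (base s₁ s₂) ∧
      ContDiffOn ℝ ∞ p₁ (base s₁ s₂) ∧ ContDiffOn ℝ ∞ p₂ (base s₁ s₂) ∧
      (∀ x ∈ base s₁ s₂, partialWithin (base s₁ s₂) 1 p₀ x = 0) ∧
      HasExpansion (base s₁ s₂) (fun x β => p β (M.chart β x)) p₀ p₁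
        (fun x => (1 / 2 : ℝ) • p₂ x) ∧
      HasExpansion (base s₁ s₂) (fun x β => partialWithin (M.D β) 0 (p β) (M.chart β x))
        (partialWithin (base s₁ s₂) 0 p₀)
        (fun x => partialWithin (base s₁ s₂) 0 p₁ x
          - (M.dB x.1 / M.B x.1 * x.2) • partialWithin (base s₁ s₂) 1 p₁ x)
        (fun x => (1 / 2 : ℝ) • (partialWithin (base s₁ s₂) 0 p₂ x
          - (M.dB x.1 / M.B x.1 * x.2) • partialWithin (base s₁ s₂) 1 p₂ x)) ∧
      HasExpansion (base s₁ s₂) (fun x β => partialWithin (M.D β) 1 (p β) (M.chart β x))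
        (fun x => (M.B x.1)⁻¹ • partialWithin (base s₁ s₂) 1 p₁ x)
        (fun x => (M.B x.1)⁻¹ • (1 / 2 : ℝ) • partialWithin (base s₁ s₂) 1 p₂ x) b₂ := by
  have h0 : (0 : ℝ) ∈ Icc 0 β₁ := ⟨le_rfl, h.pos.le⟩
  have hd := contDiffOn_dirBeta h.lt h.pos h.smooth
  have hdd := contDiffOn_dirBeta h.lt h.pos hd
  have hPr := contDiffOn_dirWithin (uniqueDiffOn_box h.lt h.pos) h.smooth (0, 1, 0)
  -- ∂₂p is ∂ᵣP divided by βB; as ∂ᵣP vanishes at β = 0, the quotient still has an expansion.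
  obtain ⟨c, hc⟩ := hasExpansion_inv_smul h.lt h.pos hPr fun x hx => h.dirWithin_r_zero hx
  have hBi : ContinuousOn (fun x : ℝ × ℝ => (M.B x.1)⁻¹) (base s₁ s₂) :=
    h.continuousOn_B.inv₀ fun x hx => (h.B_pos hx).ne'
  have hdB : ContinuousOn (fun x : ℝ × ℝ => M.dB x.1 / M.B x.1 * x.2) (base s₁ s₂) := by
    refine ContinuousOn.mul (ContinuousOn.div ?_ h.continuousOn_B fun x hx => (h.B_pos hx).ne')
      continuousOn_snd
    exact (M.B_smooth.continuousOn_derivWithin (uniqueDiffOn_Icc M.hab) (by simp)).comp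
      continuousOn_fst fun x hx => h.sub hx.1
  refine ⟨fun x => P (x.1, x.2, 0), fun x => dirBeta s₁ s₂ β₁ P (x.1, x.2, 0),
    fun x => dirBeta s₁ s₂ β₁ (dirBeta s₁ s₂ β₁ P) (x.1, x.2, 0),
    fun x => (M.B x.1)⁻¹ • c x,
    contDiffOn_slice h.smooth h0, contDiffOn_slice hd h0, contDiffOn_slice hdd h0,
    fun x hx => ?_, ?_, ?_, ?_⟩
  · rw [partialWithin_slice_one h.lt (h.smooth.differentiableOn (by simp)) hx h0]
    exact h.dirWithin_r_zero hx
  · exact (hasExpansion_of_contDiffOn h.lt h.pos h.smooth).congr h.pos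
      (fun x hx β hβ => h.eq x hx β ⟨hβ.1, hβ.2.le⟩) (fun _ _ => rfl) (fun _ _ => rfl)
      (fun _ _ => rfl)
  · refine ((hasExpansion_dirWithin_zero h.lt h.pos h.smooth).sub
      ((hasExpansion_const hdB).smul isCompact_base
        (hasExpansion_of_contDiffOn h.lt h.pos hPr))).congr h.pos
      (fun x hx β hβ => h.partialWithin_zero hx ⟨hβ.1, hβ.2.le⟩) (fun x hx => ?_) (fun x hx => ?_)
      (fun x hx => ?_)
    · simp [h.dirWithin_r_zero hx]
    · simp [dirBeta_dirWithin_one h.lt h.pos h.smooth hx]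
    · rw [dirBeta_dirBeta_dirWithin_one h.lt h.pos h.smooth hx]
      simp only [zero_smul, add_zero]
      module
  · refine ((hasExpansion_const hBi).smul isCompact_base hc).congr h.pos
      (fun x hx β hβ => h.partialWithin_one hx ⟨hβ.1, hβ.2.le⟩) (fun x hx => ?_) (fun x hx => ?_)
      (fun x hx => by simp)
    · simp [dirBeta_dirWithin_one h.lt h.pos h.smooth hx]
    · simp [dirBeta_dirBeta_dirWithin_one h.lt h.pos h.smooth hx]

end MinimizingFamily

end CenteredStrip

end ElasticStrip
end

noncomputable section

open Set Filter Topology MeasureTheory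

namespace ElasticStrip

namespace CenteredStrip

namespace MinimizingFamily

variable {M : CenteredStrip} {k : ℕ∞} {Y ν s₁ s₂ β₁ : ℝ} {p : ℝ → ℝ × ℝ → Plane}
  {P : ℝ × ℝ × ℝ → Plane}

/-! ### Equilibrium at leading order -/

lemma continuousOn_flux_comp (h : MinimizingFamily M k Y ν s₁ s₂ β₁ p P) {β : ℝ}
    (hβ : β ∈ Ioc 0 β₁) (j : Fin 2) :
    ContinuousOn (fun x => M.flux Y ν β (p β) j (M.chart β x)) (base s₁ s₂) :=
  ((M.continuousOn_flux Y ν hβ.1 (hβ.2.trans h.le_one) (h.contDiffOn_one hβ) j).comp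
    (M.contDiffOn_chart β).continuousOn (M.chart_mapsTo hβ.1.le)).mono h.base_subset

lemma norm_inner_sub_le {F c v : Plane} {t C : ℝ} (hF : ‖F - t • c‖ ≤ C) :
    |inner ℝ F v - t * inner ℝ c v| ≤ C * ‖v‖ := by
  rw [← real_inner_smul_left, ← inner_sub_left, ← Real.norm_eq_abs]
  exact (norm_inner_le_norm _ _).trans (mul_le_mul_of_nonneg_right hF (norm_nonneg _))

lemma continuousOn_section {F : Type*} [TopologicalSpace F] {f : ℝ × ℝ → F}
    (hf : ContinuousOn f (base s₁ s₂)) {s : ℝ} (hs : s ∈ Icc s₁ s₂) :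
    ContinuousOn (fun r => f (s, r)) (Icc (-1) 1) :=
  hf.comp (by fun_prop) fun _ hr => ⟨hs, hr⟩

/-- The leading term of the traction on longitudinal fibers, tested with product fields. -/
lemma integral_leading_transverse (h : MinimizingFamily M k Y ν s₁ s₂ β₁ p P) {n : ℕ}
    {n₀ n₁ : ℝ × ℝ → Plane} (hn₀ : ContinuousOn n₀ (base s₁ s₂))
    (hn₁ : ContinuousOn n₁ (base s₁ s₂))
    (hb₀ : ∃ C, ∃ δ > 0, ∀ x ∈ base s₁ s₂, ∀ β ∈ Ioo 0 δ,
      ‖M.flux Y ν β (p β) 0 (M.chart β x) - β ^ n • n₀ x‖ ≤ C * β ^ (n + 1))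
    (hb₁ : ∃ C, ∃ δ > 0, ∀ x ∈ base s₁ s₂, ∀ β ∈ Ioo 0 δ,
      ‖M.flux Y ν β (p β) 1 (M.chart β x) - β ^ n • n₁ x‖ ≤ C * β ^ (n + 1))
    {χ g : ℝ → ℝ} (hχ : ContDiff ℝ ∞ χ) (hsupp : tsupport χ ⊆ Ioo s₁ s₂) (hg : ContDiff ℝ ∞ g)
    (v : Plane) :
    ∫ x in base s₁ s₂, M.B x.1 * (χ x.1 * g (M.B x.1 * x.2) * inner ℝ (n₁ x) v) = 0 := by
  -- No boundary condition is imposed on the antiderivative because the long edges are free; hence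
  -- the derivative g is an arbitrary smooth profile.
  obtain ⟨η, hη, hη'⟩ := exists_contDiff_hasDerivAt hg
  obtain ⟨C₀, δ₀, hδ₀, hC₀⟩ := hb₀
  obtain ⟨C₁, δ₁, hδ₁, hC₁⟩ := hb₁
  have hχ' : ∀ x, HasDerivAt χ (deriv χ x) x := fun x =>
    (hχ.differentiable (by simp) x).hasDerivAt
  have hBc := h.continuousOn_B
  have hBr : ContinuousOn (fun x : ℝ × ℝ => M.B x.1 * x.2) (base s₁ s₂) :=
    hBc.mul continuousOn_snd
  have hχc : ContinuousOn (fun x : ℝ × ℝ => χ x.1) (base s₁ s₂) :=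
    (hχ.continuous.comp continuous_fst).continuousOn
  have hχ'c : ContinuousOn (fun x : ℝ × ℝ => deriv χ x.1) (base s₁ s₂) :=
    ((hχ.continuous_deriv (by simp)).comp continuous_fst).continuousOn
  have hgc : ContinuousOn (fun x : ℝ × ℝ => g (M.B x.1 * x.2)) (base s₁ s₂) :=
    hg.continuous.comp_continuousOn hBr
  have hηc : ContinuousOn (fun x : ℝ × ℝ => η (M.B x.1 * x.2)) (base s₁ s₂) :=
    hη.continuous.comp_continuousOn hBr
  have hw1 := hBc.mul (hχc.mul hgc)
  have hw0 := hBc.mul (hχ'c.mul hηc)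
  obtain ⟨m₁, hm₁⟩ := isCompact_base.exists_bound_of_continuousOn hw1
  obtain ⟨m₀, hm₀⟩ := isCompact_base.exists_bound_of_continuousOn hw0
  obtain ⟨l, hl⟩ := isCompact_base.exists_bound_of_continuousOn hn₀
  have hvol : volume (base s₁ s₂) < ⊤ := isCompact_base.measure_lt_top
  set δ := min (min δ₀ δ₁) β₁ with hδ
  have hδ0 : 0 < δ := lt_min (lt_min hδ₀ hδ₁) h.pos
  have hmem : ∀ β ∈ Ioo 0 δ, β ∈ Ioo 0 δ₀ ∧ β ∈ Ioo 0 δ₁ ∧ β ∈ Ioc 0 β₁ := fun β hβ =>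
    ⟨⟨hβ.1, hβ.2.trans_le ((min_le_left _ _).trans (min_le_left _ _))⟩,
      ⟨hβ.1, hβ.2.trans_le ((min_le_left _ _).trans (min_le_right _ _))⟩,
      ⟨hβ.1, (hβ.2.trans_le (min_le_right _ _)).le⟩⟩
  refine setIntegral_leading_eq_zero (μ := volume) (n := n) (δ := δ)
    (f := fun x β => M.B x.1 * (χ x.1 * g (M.B x.1 * x.2) *
      inner ℝ (M.flux Y ν β (p β) 1 (M.chart β x)) v))
    (C := |m₁| * (C₁ * ‖v‖)) (C' := |m₀| * ((l + |C₀|) * ‖v‖) * volume.real (base s₁ s₂))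
    hvol hδ0 (fun β hβ => ?_) ?_ (fun x hx β hβ => ?_) (fun β hβ => ?_)
  · exact ContinuousOn.integrableOn_compact isCompact_base (hBc.mul ((hχc.mul hgc).mul
      ((h.continuousOn_flux_comp (hmem β hβ).2.2 1).inner continuousOn_const)))
  · exact ContinuousOn.integrableOn_compact isCompact_base (hBc.mul ((hχc.mul hgc).mul
      (hn₁.inner continuousOn_const)))
  · have k1 := norm_inner_sub_le (v := v) (hC₁ x hx β (hmem β hβ).2.1)
    have k2 := (hm₁ x hx).trans (le_abs_self m₁)
    have e : M.B x.1 * (χ x.1 * g (M.B x.1 * x.2) *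
        inner ℝ (M.flux Y ν β (p β) 1 (M.chart β x)) v)
        - β ^ n • (M.B x.1 * (χ x.1 * g (M.B x.1 * x.2) * inner ℝ (n₁ x) v))
        = (M.B x.1 * (χ x.1 * g (M.B x.1 * x.2))) *
          (inner ℝ (M.flux Y ν β (p β) 1 (M.chart β x)) v - β ^ n * inner ℝ (n₁ x) v) := by
      rw [smul_eq_mul]; ring
    rw [e, norm_mul, Real.norm_eq_abs (_ - _)]
    refine (mul_le_mul k2 k1 (abs_nonneg _) (abs_nonneg _)).trans (le_of_eq ?_)
    ring
  · have hβ0 : 0 < β := hβ.1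
    have hβ' := (hmem β hβ).2.2
    have hβ1 : β ≤ 1 := hβ'.2.trans h.le_one
    have htr := (h.isMinimizer β hβ').integral_transverse h.one_le hβ0 hβ1 hχ hχ' hη hη' v
    -- The support of χ confines the weak equation, which lives on the whole strip, to the part
    -- where the expansions are available.
    have hzero : ∀ x ∈ M.rect \ base s₁ s₂, χ x.1 = 0 ∧ deriv χ x.1 = 0 := by
      intro x hx
      have hx1 : x.1 ∉ tsupport χ := fun hmem => hx.2
        ⟨Ioo_subset_Icc_self (hsupp hmem), hx.1.2⟩
      exact ⟨image_eq_zero_of_notMem_tsupport hx1,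
        Function.notMem_support.1 fun hs => hx1 (support_deriv_subset hs)⟩
    rw [setIntegral_eq_of_subset_of_forall_sdiff_eq_zero M.isCompact_rect.measurableSet
      h.base_subset (fun x hx => by rw [(hzero x hx).1, (hzero x hx).2]; ring)] at htr
    have i1 : IntegrableOn (fun x => M.B x.1 * (deriv χ x.1 * η (M.B x.1 * x.2) *
        inner ℝ (M.flux Y ν β (p β) 0 (M.chart β x)) v)) (base s₁ s₂) :=
      ContinuousOn.integrableOn_compact isCompact_base (hBc.mul ((hχ'c.mul hηc).mul
        ((h.continuousOn_flux_comp hβ' 0).inner continuousOn_const)))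
    have i2 : IntegrableOn (fun x => M.B x.1 * (χ x.1 * g (M.B x.1 * x.2) *
        inner ℝ (M.flux Y ν β (p β) 1 (M.chart β x)) v)) (base s₁ s₂) :=
      ContinuousOn.integrableOn_compact isCompact_base (hBc.mul ((hχc.mul hgc).mul
        ((h.continuousOn_flux_comp hβ' 1).inner continuousOn_const)))
    -- The transverse flux is traded for β times the longitudinal one, which is of order βⁿ; this
    -- extra power makes the leading term integrate to zero.
    have hsplit : ∫ x in base s₁ s₂, M.B x.1 * (χ x.1 * g (M.B x.1 * x.2) *
        inner ℝ (M.flux Y ν β (p β) 1 (M.chart β x)) v)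
        = -(β * ∫ x in base s₁ s₂, M.B x.1 * (deriv χ x.1 * η (M.B x.1 * x.2) *
        inner ℝ (M.flux Y ν β (p β) 0 (M.chart β x)) v)) := by
      rw [eq_neg_iff_add_eq_zero, ← integral_const_mul, ← integral_add i2 (i1.const_mul β), ← htr]
      refine setIntegral_congr_fun isCompact_base.measurableSet fun x hx => ?_
      ring
    rw [hsplit, abs_neg, abs_mul, abs_of_pos hβ0, ← Real.norm_eq_abs]
    have hle : ∀ x ∈ base s₁ s₂, ‖M.B x.1 * (deriv χ x.1 * η (M.B x.1 * x.2) *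
        inner ℝ (M.flux Y ν β (p β) 0 (M.chart β x)) v)‖
        ≤ |m₀| * ((l + |C₀|) * ‖v‖) * β ^ n := by
      intro x hx
      have k1 := hC₀ x hx β (hmem β hβ).1
      have k2 := (hm₀ x hx).trans (le_abs_self m₀)
      have k3 : ‖M.flux Y ν β (p β) 0 (M.chart β x)‖ ≤ (l + |C₀|) * β ^ n := by
        have e := norm_add_le (β ^ n • n₀ x)
          (M.flux Y ν β (p β) 0 (M.chart β x) - β ^ n • n₀ x)
        rw [add_sub_cancel, norm_smul, Real.norm_eq_abs, abs_of_pos (pow_pos hβ0 n)] at e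
        have e1 : β ^ n * ‖n₀ x‖ ≤ β ^ n * l := by
          have := hl x hx
          gcongr
        have e2 : C₀ * β ^ (n + 1) ≤ |C₀| * β ^ n := by
          have : β ^ (n + 1) ≤ β ^ n := pow_le_pow_of_le_one hβ0.le hβ1 (Nat.le_succ n)
          exact mul_le_mul (le_abs_self C₀) this (by positivity) (abs_nonneg C₀)
        linarith
      have k4 : ‖inner ℝ (M.flux Y ν β (p β) 0 (M.chart β x)) v‖ ≤ (l + |C₀|) * β ^ n * ‖v‖ :=
        (norm_inner_le_norm _ _).trans (mul_le_mul_of_nonneg_right k3 (norm_nonneg _))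
      rw [← mul_assoc, norm_mul]
      refine (mul_le_mul k2 k4 (norm_nonneg _) (abs_nonneg _)).trans (le_of_eq ?_)
      ring
    refine (mul_le_mul_of_nonneg_left (norm_setIntegral_le_of_norm_le_const hvol hle)
      hβ0.le).trans (le_of_eq ?_)
    ring

/-- The leading term of the traction on longitudinal fibers vanishes. -/
theorem leading_traction_eq_zero (h : MinimizingFamily M k Y ν s₁ s₂ β₁ p P) {n : ℕ}
    {n₀ n₁ : ℝ × ℝ → Plane} (hn₀ : ContinuousOn n₀ (base s₁ s₂))
    (hn₁ : ContinuousOn n₁ (base s₁ s₂))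
    (hb₀ : ∃ C, ∃ δ > 0, ∀ x ∈ base s₁ s₂, ∀ β ∈ Ioo 0 δ,
      ‖M.flux Y ν β (p β) 0 (M.chart β x) - β ^ n • n₀ x‖ ≤ C * β ^ (n + 1))
    (hb₁ : ∃ C, ∃ δ > 0, ∀ x ∈ base s₁ s₂, ∀ β ∈ Ioo 0 δ,
      ‖M.flux Y ν β (p β) 1 (M.chart β x) - β ^ n • n₁ x‖ ≤ C * β ^ (n + 1)) :
    ∀ x ∈ base s₁ s₂, n₁ x = 0 := by
  have hin : ∀ v, ContinuousOn (fun x => inner ℝ (n₁ x) v) (base s₁ s₂) := fun v =>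
    hn₁.inner continuousOn_const
  suffices hv : ∀ v, ∀ s ∈ Icc s₁ s₂, ∀ r ∈ Icc (-1 : ℝ) 1, inner ℝ (n₁ (s, r)) v = 0 from
    fun x hx => inner_self_eq_zero.1 (hv (n₁ x) x.1 hx.1 x.2 hx.2)
  intro v s hs
  refine eqOn_zero_of_integral_contDiff_mul_eq_zero (by norm_num)
    (continuousOn_section (hin v) hs) fun ψ hψ _ => ?_
  have hBs := M.B_pos s (h.sub hs)
  -- The section s is fixed first and the profile rescaled by B(s), so that on this section g(B r) =
  -- ψ(r); χ then localizes at s.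
  set g : ℝ → ℝ := fun y => ψ (y / M.B s) with hg_def
  have hg : ContDiff ℝ ∞ g := hψ.comp (contDiff_id.div_const _)
  have hgc : ContinuousOn (fun x : ℝ × ℝ => g (M.B x.1 * x.2) * inner ℝ (n₁ x) v)
      (base s₁ s₂) :=
    (hg.continuous.comp_continuousOn (h.continuousOn_B.mul continuousOn_snd)).mul (hin v)
  have hB : ContinuousOn M.B (Icc s₁ s₂) := M.B_smooth.continuousOn.mono h.sub
  have key := eqOn_zero_of_integral_contDiff_mul_eq_zero h.lt
    (hB.mul (continuousOn_setIntegral_snd isCompact_Icc isCompact_Icc hgc))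
    (fun χ hχ hsupp => ?_) s hs
  · have := (mul_eq_zero.1 key).resolve_left hBs.ne'
    rw [← this]
    refine setIntegral_congr_fun measurableSet_Icc fun r _ => ?_
    have e : g (M.B s * r) = ψ r := by
      simp only [hg_def]
      congr 1
      field_simp
    simp only [e]
  · have hint := h.integral_leading_transverse hn₀ hn₁ hb₀ hb₁ hχ hsupp hg v
    rw [base, Measure.volume_eq_prod, setIntegral_prod] at hint
    · rw [← hint]
      refine setIntegral_congr_fun measurableSet_Icc fun s _ => ?_
      simp only [mul_assoc, integral_const_mul, Pi.mul_apply]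
      ring
    · rw [← Measure.volume_eq_prod]
      refine ContinuousOn.integrableOn_compact isCompact_base ?_
      have := h.continuousOn_B.mul
        (((hχ.continuous.comp continuous_fst).continuousOn (s := base s₁ s₂)).mul hgc)
      refine this.congr fun x hx => ?_
      simp only [Pi.mul_apply, Function.comp]
      ring

/-- The leading term of the resultant force on a cross section vanishes. -/
theorem leading_force_eq_zero (h : MinimizingFamily M k Y ν s₁ s₂ β₁ p P) {n : ℕ}
    {n₀ : ℝ × ℝ → Plane} (hn₀ : ContinuousOn n₀ (base s₁ s₂))
    (hb₀ : ∃ C, ∃ δ > 0, ∀ x ∈ base s₁ s₂, ∀ β ∈ Ioo 0 δ,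
      ‖M.flux Y ν β (p β) 0 (M.chart β x) - β ^ n • n₀ x‖ ≤ C * β ^ (n + 1))
    {s : ℝ} (hs : s ∈ Icc s₁ s₂) (v : Plane) :
    ∫ r in Icc (-1) 1, inner ℝ (n₀ (s, r)) v = 0 := by
  obtain ⟨C, δ, hδ, hC⟩ := hb₀
  have hmem : ∀ β ∈ Ioo 0 (min δ β₁), β ∈ Ioo 0 δ ∧ β ∈ Ioc 0 β₁ := fun β hβ =>
    ⟨⟨hβ.1, hβ.2.trans_le (min_le_left _ _)⟩, ⟨hβ.1, (hβ.2.trans_le (min_le_right _ _)).le⟩⟩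
  refine setIntegral_leading_eq_zero (μ := volume) (n := n) (δ := min δ β₁)
    (f := fun r β => inner ℝ (M.flux Y ν β (p β) 0 (M.chart β (s, r))) v) (C := C * ‖v‖) (C' := 0)
    isCompact_Icc.measure_lt_top (lt_min hδ h.pos) (fun β hβ => ?_) ?_ (fun r hr β hβ => ?_)
    (fun β hβ => ?_)
  · exact ContinuousOn.integrableOn_compact isCompact_Icc
      (continuousOn_section ((h.continuousOn_flux_comp (hmem β hβ).2 0).inner
        (continuousOn_const (c := v))) hs)
  · exact ContinuousOn.integrableOn_compact isCompact_Icc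
      (continuousOn_section (hn₀.inner (continuousOn_const (c := v))) hs)
  · refine (norm_inner_sub_le (hC (s, r) ⟨hs, hr⟩ β (hmem β hβ).1)).trans (le_of_eq ?_)
    ring
  · rw [(h.isMinimizer β (hmem β hβ).2).force_balance h.one_le hβ.1
      ((hmem β hβ).2.2.trans h.le_one) v (h.sub hs)]
    simp

/-- The leading term of the resultant moment on a cross section vanishes. -/
theorem leading_moment_eq_zero (h : MinimizingFamily M k Y ν s₁ s₂ β₁ p P) {n : ℕ}
    {n₀ m : ℝ × ℝ → Plane} (hn₀ : ContinuousOn n₀ (base s₁ s₂)) (hm : ContinuousOn m (base s₁ s₂))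
    (hb₀ : ∃ C, ∃ δ > 0, ∀ x ∈ base s₁ s₂, ∀ β ∈ Ioo 0 δ,
      ‖M.flux Y ν β (p β) 0 (M.chart β x) - β ^ n • n₀ x‖ ≤ C * β ^ (n + 1))
    (hbm : ∃ C, ∃ δ > 0, ∀ x ∈ base s₁ s₂, ∀ β ∈ Ioo 0 δ,
      ‖p β (M.chart β x) - p β (M.chart β (x.1, 0)) - β ^ 1 • m x‖ ≤ C * β ^ (1 + 1))
    {s : ℝ} (hs : s ∈ Icc s₁ s₂) :
    ∫ r in Icc (-1) 1, inner ℝ (n₀ (s, r)) (rot (m (s, r))) = 0 := by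
  obtain ⟨C, δ, hδ, hC⟩ := hb₀
  obtain ⟨C', δ', hδ', hC'⟩ := hbm
  obtain ⟨l, hl⟩ := isCompact_base.exists_bound_of_continuousOn hn₀
  obtain ⟨l', hl'⟩ := isCompact_base.exists_bound_of_continuousOn hm
  have hmem : ∀ β ∈ Ioo 0 (min (min δ δ') β₁), β ∈ Ioo 0 δ ∧ β ∈ Ioo 0 δ' ∧ β ∈ Ioc 0 β₁ :=
    fun β hβ => ⟨⟨hβ.1, hβ.2.trans_le ((min_le_left _ _).trans (min_le_left _ _))⟩,
      ⟨hβ.1, hβ.2.trans_le ((min_le_left _ _).trans (min_le_right _ _))⟩,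
      ⟨hβ.1, (hβ.2.trans_le (min_le_right _ _)).le⟩⟩
  have hpc : ∀ β ∈ Ioc 0 β₁, ContinuousOn (fun r => rot (p β (M.chart β (s, r)) -
      p β (M.chart β (s, 0)))) (Icc (-1) 1) := fun β hβ =>
    rot.continuous.comp_continuousOn ((continuousOn_section
      (((h.contDiffOn_one hβ).continuousOn.comp (M.contDiffOn_chart β).continuousOn
        (M.chart_mapsTo hβ.1.le)).mono h.base_subset) hs).sub continuousOn_const)
  -- The lever arm measured from the center curve is of order β, whence n + 1.
  refine setIntegral_leading_eq_zero (μ := volume) (n := n + 1) (δ := min (min δ δ') β₁)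
    (f := fun r β => inner ℝ (M.flux Y ν β (p β) 0 (M.chart β (s, r)))
      (rot (p β (M.chart β (s, r)) - p β (M.chart β (s, 0)))))
    (C := |C| * (‖rot‖ * (l' + |C'|)) + l * (‖rot‖ * |C'|)) (C' := 0)
    isCompact_Icc.measure_lt_top (lt_min (lt_min hδ hδ') h.pos) (fun β hβ => ?_) ?_
    (fun r hr β hβ => ?_) (fun β hβ => ?_)
  · exact ContinuousOn.integrableOn_compact isCompact_Icc
      ((continuousOn_section (h.continuousOn_flux_comp (hmem β hβ).2.2 0) hs).inner
        (hpc β (hmem β hβ).2.2))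
  · exact ContinuousOn.integrableOn_compact isCompact_Icc
      ((continuousOn_section hn₀ hs).inner
        (rot.continuous.comp_continuousOn (continuousOn_section hm hs)))
  · have hβ0 : 0 < β := hβ.1
    have hβ1 : β ≤ 1 := (hmem β hβ).2.2.2.trans h.le_one
    set F := M.flux Y ν β (p β) 0 (M.chart β (s, r))
    set d := p β (M.chart β (s, r)) - p β (M.chart β (s, 0))
    have k1 : ‖F - β ^ n • n₀ (s, r)‖ ≤ |C| * β ^ (n + 1) :=
      (hC (s, r) ⟨hs, hr⟩ β (hmem β hβ).1).trans
        (mul_le_mul_of_nonneg_right (le_abs_self C) (by positivity))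
    have k2 : ‖d - β • m (s, r)‖ ≤ |C'| * β ^ 2 := by
      have := hC' (s, r) ⟨hs, hr⟩ β (hmem β hβ).2.1
      rw [pow_one] at this
      exact this.trans (mul_le_mul_of_nonneg_right (le_abs_self C') (by positivity))
    have k3 := hl (s, r) ⟨hs, hr⟩
    have k4 := hl' (s, r) ⟨hs, hr⟩
    have k5 : ‖d‖ ≤ (l' + |C'|) * β := by
      have e := norm_add_le (β • m (s, r)) (d - β • m (s, r))
      rw [add_sub_cancel, norm_smul, Real.norm_eq_abs, abs_of_pos hβ0] at e
      have e1 : β * ‖m (s, r)‖ ≤ β * l' := by gcongr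
      have e2 : |C'| * β ^ 2 ≤ |C'| * β := by
        gcongr
        simpa using pow_le_pow_of_le_one hβ0.le hβ1 (show 1 ≤ 2 by norm_num)
      linarith
    have e : inner ℝ F (rot d) - β ^ (n + 1) • inner ℝ (n₀ (s, r)) (rot (m (s, r)))
        = inner ℝ (F - β ^ n • n₀ (s, r)) (rot d)
          + β ^ n * inner ℝ (n₀ (s, r)) (rot (d - β • m (s, r))) := by
      simp only [inner_sub_left, map_sub, map_smul, inner_sub_right, real_inner_smul_left,
        real_inner_smul_right, smul_eq_mul]
      ring
    rw [e]
    have j1 : ‖inner ℝ (F - β ^ n • n₀ (s, r)) (rot d)‖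
        ≤ (|C| * β ^ (n + 1)) * (‖rot‖ * ((l' + |C'|) * β)) :=
      (norm_inner_le_norm _ _).trans (mul_le_mul k1
        ((rot.le_opNorm d).trans (mul_le_mul_of_nonneg_left k5 (norm_nonneg _)))
        (norm_nonneg _) (by positivity))
    have j2 : ‖inner ℝ (n₀ (s, r)) (rot (d - β • m (s, r)))‖ ≤ l * (‖rot‖ * (|C'| * β ^ 2)) :=
      (norm_inner_le_norm _ _).trans (mul_le_mul k3
        ((rot.le_opNorm _).trans (mul_le_mul_of_nonneg_left k2 (norm_nonneg _)))
        (norm_nonneg _) ((norm_nonneg _).trans k3))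
    have j3 : ‖β ^ n * inner ℝ (n₀ (s, r)) (rot (d - β • m (s, r)))‖
        ≤ β ^ n * (l * (‖rot‖ * (|C'| * β ^ 2))) := by
      rw [norm_mul, Real.norm_eq_abs, abs_of_pos (pow_pos hβ0 n)]
      gcongr
    refine (norm_add_le _ _).trans ((add_le_add j1 j3).trans (le_of_eq ?_))
    ring
  · have hβ' := (hmem β hβ).2.2
    have hβ1 := hβ'.2.trans h.le_one
    -- Force balance allows the pole of the moment to be moved from the origin to the center point
    -- of the section.
    have e1 := (h.isMinimizer β hβ').moment_balance h.one_le hβ.1 hβ1 (h.sub hs)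
    have e2 := (h.isMinimizer β hβ').force_balance h.one_le hβ.1 hβ1
      (rot (p β (M.chart β (s, 0)))) (h.sub hs)
    have hfl := continuousOn_section (h.continuousOn_flux_comp hβ' 0) hs
    have hp : ContinuousOn (fun r => rot (p β (M.chart β (s, r)))) (Icc (-1) 1) :=
      rot.continuous.comp_continuousOn (continuousOn_section
      (((h.contDiffOn_one hβ').continuousOn.comp (M.contDiffOn_chart β).continuousOn
        (M.chart_mapsTo hβ'.1.le)).mono h.base_subset) hs)
    simp only [map_sub, inner_sub_right]
    rw [integral_sub, e1, e2]
    · simp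
    · exact ContinuousOn.integrableOn_compact isCompact_Icc (hfl.inner hp)
    · exact ContinuousOn.integrableOn_compact isCompact_Icc (hfl.inner continuousOn_const)

end MinimizingFamily

end CenteredStrip

end ElasticStrip
end

noncomputable section

open Set Filter Topology MeasureTheory

namespace ElasticStrip

/-! ### Calculus on coordinate lines -/

section Lines

variable {E : Type*} [NormedAddCommGroup E] [NormedSpace ℝ E] {s₁ s₂ : ℝ} {f : ℝ × ℝ → E}

lemma hasDerivWithinAt_snd (hf : DifferentiableOn ℝ f (base s₁ s₂)) {s r : ℝ}
    (hs : s ∈ Icc s₁ s₂) (hr : r ∈ Icc (-1 : ℝ) 1) :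
    HasDerivWithinAt (fun r => f (s, r)) (partialWithin (base s₁ s₂) 1 f (s, r)) (Icc (-1) 1) r := by
  have h1 : HasDerivWithinAt (fun r : ℝ => (s, r)) ((0 : ℝ), (1 : ℝ)) (Icc (-1) 1) r :=
    (hasDerivWithinAt_const _ _ _).prodMk (hasDerivWithinAt_id _ _)
  exact (hf (s, r) ⟨hs, hr⟩).hasFDerivWithinAt.comp_hasDerivWithinAt r h1
    (fun _ ht => ⟨hs, ht⟩ : MapsTo (fun r => (s, r)) (Icc (-1) 1) (base s₁ s₂))

lemma hasDerivWithinAt_fst (hf : DifferentiableOn ℝ f (base s₁ s₂)) {s r : ℝ}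
    (hs : s ∈ Icc s₁ s₂) (hr : r ∈ Icc (-1 : ℝ) 1) :
    HasDerivWithinAt (fun s => f (s, r)) (partialWithin (base s₁ s₂) 0 f (s, r)) (Icc s₁ s₂) s := by
  have h1 : HasDerivWithinAt (fun s : ℝ => (s, r)) ((1 : ℝ), (0 : ℝ)) (Icc s₁ s₂) s :=
    (hasDerivWithinAt_id _ _).prodMk (hasDerivWithinAt_const _ _ _)
  exact HasFDerivWithinAt.comp_hasDerivWithinAt (f := fun s : ℝ => (s, r)) (t := base s₁ s₂) s
    (hf (s, r) ⟨hs, hr⟩).hasFDerivWithinAt h1 fun _ ht => ⟨ht, hr⟩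

/-- A function whose transverse derivative does not depend on `r` is affine in `r`. -/
lemma eq_affine_of_partialWithin_one (hf : DifferentiableOn ℝ f (base s₁ s₂)) {c : E} {s : ℝ}
    (hs : s ∈ Icc s₁ s₂)
    (h : ∀ r ∈ Icc (-1 : ℝ) 1, partialWithin (base s₁ s₂) 1 f (s, r) = c) {r : ℝ}
    (hr : r ∈ Icc (-1 : ℝ) 1) : f (s, r) = f (s, 0) + r • c := by
  have hd : ∀ t ∈ Icc (-1 : ℝ) 1, HasDerivWithinAt (fun t => f (s, t) - t • c) 0 (Icc (-1) 1) t := by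
    intro t ht
    have h1 := (hasDerivWithinAt_snd hf hs ht).sub ((hasDerivWithinAt_id t (Icc (-1) 1)).smul_const c)
    rw [h t ht, one_smul, sub_self] at h1
    exact h1
  have h2 := (convex_Icc (-1 : ℝ) 1).norm_image_sub_le_of_norm_hasDerivWithin_le (C := 0) hd
    (by simp) (x := 0) (y := r) (by norm_num) hr
  simp only [zero_mul, norm_le_zero_iff, zero_smul, sub_zero] at h2
  rw [sub_right_comm, sub_eq_zero] at h2
  rw [← h2, add_sub_cancel]

lemma partialWithin_zero_eq_of_const (hs₁₂ : s₁ < s₂) (hf : DifferentiableOn ℝ f (base s₁ s₂))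
    {r r' : ℝ} (hr : r ∈ Icc (-1 : ℝ) 1) (hr' : r' ∈ Icc (-1 : ℝ) 1)
    (h : ∀ s ∈ Icc s₁ s₂, f (s, r) = f (s, r')) {s : ℝ} (hs : s ∈ Icc s₁ s₂) :
    partialWithin (base s₁ s₂) 0 f (s, r) = partialWithin (base s₁ s₂) 0 f (s, r') :=
  (uniqueDiffOn_Icc hs₁₂ s hs).eq_deriv _ (hasDerivWithinAt_fst hf hs hr)
    ((hasDerivWithinAt_fst hf hs hr').congr h (h s hs))

/-- Mixed derivatives commute: if ∂ᵣf does not depend on r, neither does ∂ᵣ∂ₛf. Applied to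
coefficients of the map, this bounds the degree in r of the strain. -/
lemma partialWithin_zero_affine (hs₁₂ : s₁ < s₂) (hf : ContDiffOn ℝ ∞ f (base s₁ s₂))
    (h : ∀ s ∈ Icc s₁ s₂, ∀ r ∈ Icc (-1 : ℝ) 1, partialWithin (base s₁ s₂) 1 f (s, r)
      = partialWithin (base s₁ s₂) 1 f (s, 0)) {s r : ℝ} (hs : s ∈ Icc s₁ s₂)
    (hr : r ∈ Icc (-1 : ℝ) 1) :
    partialWithin (base s₁ s₂) 0 f (s, r) = partialWithin (base s₁ s₂) 0 f (s, 0)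
      + r • partialWithin (base s₁ s₂) 0 (partialWithin (base s₁ s₂) 1 f) (s, 0) := by
  have hU := uniqueDiffOn_base hs₁₂
  have hf0 := CenteredStrip.partialWithin_smooth hU hf 0
  have hf1 := CenteredStrip.partialWithin_smooth hU hf 1
  refine eq_affine_of_partialWithin_one (hf0.differentiableOn (by simp)) hs (fun t ht => ?_) hr
  have hcomm := dirWithin_comm hU (base_subset_closure_interior hs₁₂) hf (coordVec 1) (coordVec 0)
    (x := (s, t)) ⟨hs, ht⟩
  refine Eq.trans hcomm ?_
  exact partialWithin_zero_eq_of_const hs₁₂ (hf1.differentiableOn (by simp)) ht (by norm_num)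
    (fun s hs => h s hs t ht) hs

end Lines

/-! ### Orthonormal pairs in the plane -/

/-- Lagrange's identity: the squared determinant is |a|²|b|² - (a·b)². The orientation is left
undetermined, so the determinant is known only up to sign. -/
lemma sq_det_eq_one {a b : Plane} (ha : inner ℝ a a = (1 : ℝ)) (hb : inner ℝ b b = (1 : ℝ))
    (hab : inner ℝ a b = (0 : ℝ)) : inner ℝ a (rot b) ^ 2 = (1 : ℝ) := by
  simp only [inner_plane, rot_apply_zero, rot_apply_one] at *
  linear_combination (b 0 * b 0 + b 1 * b 1) * ha + hb - (a 0 * b 0 + a 1 * b 1) * hab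

lemma eq_zero_of_inner_eq_zero {a b v : Plane} (ha : inner ℝ a a = (1 : ℝ))
    (hb : inner ℝ b b = (1 : ℝ)) (hab : inner ℝ a b = (0 : ℝ)) (hva : inner ℝ v a = (0 : ℝ))
    (hvb : inner ℝ v b = (0 : ℝ)) : v = 0 := by
  have hdet := sq_det_eq_one ha hb hab
  simp only [inner_plane, rot_apply_zero, rot_apply_one] at *
  ext i
  fin_cases i
  · simp only [Fin.zero_eta, PiLp.zero_apply]
    linear_combination (-v 0) * hdet
      - (a 0 * -b 1 + a 1 * b 0) * (b 1 * hva - a 1 * hvb)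
  · simp only [Fin.mk_one, PiLp.zero_apply]
    linear_combination (-v 1) * hdet
      + (a 0 * -b 1 + a 1 * b 0) * (b 0 * hva - a 0 * hvb)

/-! ### Moments of quadratic polynomials -/

lemma setIntegral_poly (c₀ c₁ c₂ c₃ : ℝ) :
    ∫ r in Icc (-1 : ℝ) 1, (c₀ + c₁ * r + c₂ * r ^ 2 + c₃ * r ^ 3) = 2 * c₀ + 2 / 3 * c₂ := by
  rw [integral_Icc_eq_integral_Ioc, ← intervalIntegral.integral_of_le (by norm_num)]
  have hd : ∀ r ∈ uIcc (-1 : ℝ) 1, HasDerivAt (fun r : ℝ => c₀ * r + c₁ / 2 * r ^ 2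
      + c₂ / 3 * r ^ 3 + c₃ / 4 * r ^ 4) (c₀ + c₁ * r + c₂ * r ^ 2 + c₃ * r ^ 3) r := by
    intro r _
    have := (((((hasDerivAt_id r).const_mul c₀).add ((hasDerivAt_pow 2 r).const_mul (c₁ / 2))).add
      ((hasDerivAt_pow 3 r).const_mul (c₂ / 3))).add ((hasDerivAt_pow 4 r).const_mul (c₃ / 4)))
    refine this.congr_deriv ?_
    norm_num
    ring
  rw [intervalIntegral.integral_eq_sub_of_hasDerivAt hd
    (Continuous.intervalIntegrable (by fun_prop) _ _)]
  ring

/-- A quadratic polynomial with vanishing mean and first moment on `[-1, 1]`. -/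
lemma quadratic_eq_of_moments {f : ℝ → ℝ} {c d e : ℝ}
    (hf : ∀ r ∈ Icc (-1 : ℝ) 1, f r = c + d * r + e * r ^ 2)
    (h0 : ∫ r in Icc (-1 : ℝ) 1, f r = 0) (h1 : ∫ r in Icc (-1 : ℝ) 1, r * f r = 0) :
    ∀ r ∈ Icc (-1 : ℝ) 1, f r = e * (r ^ 2 - 1 / 3) := by
  have e0 : ∫ r in Icc (-1 : ℝ) 1, f r
      = ∫ r in Icc (-1 : ℝ) 1, (c + d * r + e * r ^ 2 + 0 * r ^ 3) :=
    setIntegral_congr_fun measurableSet_Icc fun r hr => by simp [hf r hr]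
  have e1 : ∫ r in Icc (-1 : ℝ) 1, r * f r
      = ∫ r in Icc (-1 : ℝ) 1, (0 + c * r + d * r ^ 2 + e * r ^ 3) :=
    setIntegral_congr_fun measurableSet_Icc fun r hr => by simp only [hf r hr]; ring
  rw [e0, setIntegral_poly] at h0
  rw [e1, setIntegral_poly] at h1
  intro r hr
  rw [hf r hr]
  linear_combination 1 / 2 * h0 + 3 / 2 * r * h1

end ElasticStrip
end

noncomputable section

open Set Filter Topology MeasureTheory

namespace ElasticStrip

namespace CenteredStrip

namespace MinimizingFamily

variable {M : CenteredStrip} {k : ℕ∞} {Y ν s₁ s₂ β₁ : ℝ} {p : ℝ → ℝ × ℝ → Plane}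
  {P : ℝ × ℝ × ℝ → Plane}

/-! ### Expansions of strain, stress and flux -/

lemma chart_mem (h : MinimizingFamily M k Y ν s₁ s₂ β₁ p P) {x : ℝ × ℝ} (hx : x ∈ base s₁ s₂)
    {β : ℝ} (hβ : β ∈ Ioo 0 β₁) : M.chart β x ∈ M.D 1 :=
  M.D_subset (hβ.2.le.trans h.le_one) (M.chart_mapsTo hβ.1.le (h.base_subset hx))

/-- The product rule for inner products gives all coefficients. Only the longitudinal strain sees
the reference metric beyond constants, through the expansion of G. -/
lemma hasExpansion_strain (h : MinimizingFamily M k Y ν s₁ s₂ β₁ p P)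
    {a₀ a₁ a₂ b₀ b₁ b₂ : ℝ × ℝ → Plane}
    (ha : HasExpansion (base s₁ s₂)
      (fun x β => partialWithin (M.D β) 0 (p β) (M.chart β x)) a₀ a₁ a₂)
    (hb : HasExpansion (base s₁ s₂)
      (fun x β => partialWithin (M.D β) 1 (p β) (M.chart β x)) b₀ b₁ b₂) :
    HasExpansion (base s₁ s₂) (fun x β => M.strain β (p β) 0 0 (M.chart β x))
      (fun x => (inner ℝ (a₀ x) (a₀ x) - 1) / 2)
      (fun x => (2 * inner ℝ (a₀ x) (a₁ x) - M.G' (x.1, 0) * (M.B x.1 * x.2)) / 2)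
      (fun x => (2 * inner ℝ (a₀ x) (a₂ x) + inner ℝ (a₁ x) (a₁ x)
        - 1 / 2 * (M.G'' (x.1, 0) * (M.B x.1 * x.2) ^ 2)) / 2) ∧
    HasExpansion (base s₁ s₂) (fun x β => M.strain β (p β) 0 1 (M.chart β x))
      (fun x => inner ℝ (a₀ x) (b₀ x) / 2)
      (fun x => (inner ℝ (a₀ x) (b₁ x) + inner ℝ (a₁ x) (b₀ x)) / 2)
      (fun x => (inner ℝ (a₀ x) (b₂ x) + inner ℝ (a₁ x) (b₁ x) + inner ℝ (a₂ x) (b₀ x)) / 2) ∧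
    HasExpansion (base s₁ s₂) (fun x β => M.strain β (p β) 1 1 (M.chart β x))
      (fun x => (inner ℝ (b₀ x) (b₀ x) - 1) / 2)
      (fun x => inner ℝ (b₀ x) (b₁ x))
      (fun x => inner ℝ (b₀ x) (b₂ x) + inner ℝ (b₁ x) (b₁ x) / 2) := by
  have hK := isCompact_base (s₁ := s₁) (s₂ := s₂)
  refine ⟨?_, ?_, ?_⟩
  · refine (((ha.inner hK ha).sub (M.hasExpansion_G h.lt h.sub h.pos h.le_one)).const_smul
      (1 / 2)).congr h.pos (fun x hx β hβ => ?_) (fun x hx => ?_) (fun x hx => ?_) (fun x hx => ?_)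
    · simp only [strain, inducedMetric, G, smul_eq_mul]; ring
    · simp only [smul_eq_mul]; ring
    · rw [real_inner_comm (a₀ x) (a₁ x), smul_eq_mul]; ring
    · rw [real_inner_comm (a₀ x) (a₂ x), smul_eq_mul]; ring
  · refine ((ha.inner hK hb).const_smul (1 / 2)).congr h.pos (fun x hx β hβ => ?_)
      (fun x hx => ?_) (fun x hx => ?_) (fun x hx => ?_)
    · simp only [strain, inducedMetric, M.g01 (h.chart_mem hx hβ), smul_eq_mul]; ring
    all_goals simp only [smul_eq_mul]; ring
  · refine (((hb.inner hK hb).sub (hasExpansion_const (continuousOn_const (c := (1 : ℝ))))).const_smul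
      (1 / 2)).congr h.pos (fun x hx β hβ => ?_) (fun x hx => ?_) (fun x hx => ?_) (fun x hx => ?_)
    · simp only [strain, inducedMetric, M.g11 (h.chart_mem hx hβ), smul_eq_mul]; ring
    · simp only [smul_eq_mul]; ring
    · rw [real_inner_comm (b₀ x) (b₁ x), smul_eq_mul]; ring
    · rw [real_inner_comm (b₀ x) (b₂ x), smul_eq_mul]; ring

/-- The strain vanishes in the limit `β → 0`. -/
lemma strain_zero (h : MinimizingFamily M k Y ν s₁ s₂ β₁ p P) {x₀ x₁ x₂ z₀ z₁ z₂ y₀ y₁ y₂ : ℝ × ℝ → ℝ}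
    (hx : HasExpansion (base s₁ s₂) (fun x β => M.strain β (p β) 0 0 (M.chart β x)) x₀ x₁ x₂)
    (hz : HasExpansion (base s₁ s₂) (fun x β => M.strain β (p β) 0 1 (M.chart β x)) z₀ z₁ z₂)
    (hy : HasExpansion (base s₁ s₂) (fun x β => M.strain β (p β) 1 1 (M.chart β x)) y₀ y₁ y₂) :
    ∀ x ∈ base s₁ s₂, x₀ x = 0 ∧ z₀ x = 0 ∧ y₀ x = 0 := by
  obtain ⟨C, δ, hδ, hC⟩ := M.exists_integral_strain_sq_le h.one_le h.Y_pos h.neg_one_lt h.lt_one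
    h.sub
  have hmem : ∀ β ∈ Ioo 0 (min δ β₁), β ∈ Ioo 0 δ ∧ β ∈ Ioc 0 β₁ := fun β hβ =>
    ⟨⟨hβ.1, hβ.2.trans_le (min_le_left _ _)⟩, ⟨hβ.1, (hβ.2.trans_le (min_le_right _ _)).le⟩⟩
  have hcs : ∀ β ∈ Ioo 0 (min δ β₁), ∀ i j,
      ContinuousOn (fun x => M.strain β (p β) i j (M.chart β x)) (base s₁ s₂) := fun β hβ i j =>
    ((M.continuousOn_strain hβ.1 ((hmem β hβ).2.2.trans h.le_one) (h.contDiffOn_one (hmem β hβ).2)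
      i j).comp (M.contDiffOn_chart β).continuousOn (M.chart_mapsTo hβ.1.le)).mono h.base_subset
  have hle : ∀ β ∈ Ioo 0 (min δ β₁), ∀ f : ℝ × ℝ → ℝ, ContinuousOn f (base s₁ s₂) →
      (∀ x, f x ^ 2 ≤ M.strain β (p β) 0 0 (M.chart β x) ^ 2
        + M.strain β (p β) 0 1 (M.chart β x) ^ 2 + M.strain β (p β) 1 1 (M.chart β x) ^ 2) →
      ∫ x in base s₁ s₂, f x ^ 2 ≤ |C| * β := by
    intro β hβ f hf hfle
    have hβ0 : 0 < β := hβ.1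
    have hβ1 : β ≤ 1 := (hmem β hβ).2.2.trans h.le_one
    refine (setIntegral_mono_on (ContinuousOn.integrableOn_compact isCompact_base (hf.pow 2))
      (ContinuousOn.integrableOn_compact isCompact_base ((((hcs β hβ 0 0).pow 2).add
        ((hcs β hβ 0 1).pow 2)).add ((hcs β hβ 1 1).pow 2))) isCompact_base.measurableSet
      fun x _ => hfle x).trans ((hC β (hmem β hβ).1 (p β) (h.isMinimizer β (hmem β hβ).2)).trans ?_)
    have k1 : β ^ 2 ≤ β := by
      simpa using pow_le_pow_of_le_one hβ0.le hβ1 (show 1 ≤ 2 by norm_num)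
    exact mul_le_mul (le_abs_self C) k1 (by positivity) (abs_nonneg C)
  have hpos : 0 < min δ β₁ := lt_min hδ h.pos
  intro x hxm
  refine ⟨hx.eq_zero_of_integral_sq_le h.lt hpos (fun β hβ => hcs β hβ 0 0)
    (fun β hβ => hle β hβ _ (hcs β hβ 0 0) fun x => ?_) x hxm,
    hz.eq_zero_of_integral_sq_le h.lt hpos (fun β hβ => hcs β hβ 0 1)
    (fun β hβ => hle β hβ _ (hcs β hβ 0 1) fun x => ?_) x hxm,
    hy.eq_zero_of_integral_sq_le h.lt hpos (fun β hβ => hcs β hβ 1 1)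
    (fun β hβ => hle β hβ _ (hcs β hβ 1 1) fun x => ?_) x hxm⟩ <;>
  · have k1 := sq_nonneg (M.strain β (p β) 0 0 (M.chart β x))
    have k2 := sq_nonneg (M.strain β (p β) 0 1 (M.chart β x))
    have k3 := sq_nonneg (M.strain β (p β) 1 1 (M.chart β x))
    linarith

/-- For a strain without zeroth-order term, the stress law at leading order is that of the Euclidean
metric. The corrections from 1/G, with first coefficient w, multiply only first-order strains and
disappear once these vanish. -/
lemma hasExpansion_stress (h : MinimizingFamily M k Y ν s₁ s₂ β₁ p P)
    {x₁ x₂ z₁ z₂ y₁ y₂ : ℝ × ℝ → ℝ}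
    (hx : HasExpansion (base s₁ s₂) (fun x β => M.strain β (p β) 0 0 (M.chart β x))
      (fun _ => 0) x₁ x₂)
    (hz : HasExpansion (base s₁ s₂) (fun x β => M.strain β (p β) 0 1 (M.chart β x))
      (fun _ => 0) z₁ z₂)
    (hy : HasExpansion (base s₁ s₂) (fun x β => M.strain β (p β) 1 1 (M.chart β x))
      (fun _ => 0) y₁ y₂) :
    ∃ w : ℝ × ℝ → ℝ,
    HasExpansion (base s₁ s₂) (fun x β => M.stress Y ν β (p β) 0 0 (M.chart β x)) (fun _ => 0)
      (fun x => lameLambda Y ν * (x₁ x + y₁ x) + 2 * lameMu Y ν * x₁ x)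
      (fun x => lameLambda Y ν * (x₂ x + y₂ x) + 2 * lameMu Y ν * x₂ x
        + w x * (lameLambda Y ν * (2 * x₁ x + y₁ x) + 4 * lameMu Y ν * x₁ x)) ∧
    HasExpansion (base s₁ s₂) (fun x β => M.stress Y ν β (p β) 0 1 (M.chart β x)) (fun _ => 0)
      (fun x => 2 * lameMu Y ν * z₁ x) (fun x => 2 * lameMu Y ν * (z₂ x + w x * z₁ x)) ∧
    HasExpansion (base s₁ s₂) (fun x β => M.stress Y ν β (p β) 1 0 (M.chart β x)) (fun _ => 0)
      (fun x => 2 * lameMu Y ν * z₁ x) (fun x => 2 * lameMu Y ν * (z₂ x + w x * z₁ x)) ∧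
    HasExpansion (base s₁ s₂) (fun x β => M.stress Y ν β (p β) 1 1 (M.chart β x)) (fun _ => 0)
      (fun x => lameLambda Y ν * (x₁ x + y₁ x) + 2 * lameMu Y ν * y₁ x)
      (fun x => lameLambda Y ν * (x₂ x + y₂ x) + 2 * lameMu Y ν * y₂ x
        + w x * (lameLambda Y ν * x₁ x)) := by
  have hK := isCompact_base (s₁ := s₁) (s₂ := s₂)
  obtain ⟨w, w₂, hw⟩ := M.hasExpansion_inv_G h.lt h.sub h.pos h.le_one
  have hwx := hw.mul hK hx
  have ht := (hwx.add hy).const_smul (lameLambda Y ν)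
  have h01 : HasExpansion (base s₁ s₂)
      (fun x β => 2 * lameMu Y ν * ((M.G (M.chart β x))⁻¹ * M.strain β (p β) 0 1 (M.chart β x)))
      (fun _ => 0) (fun x => 2 * lameMu Y ν * z₁ x)
      (fun x => 2 * lameMu Y ν * (z₂ x + w x * z₁ x)) := by
    refine ((hw.mul hK hz).const_smul (2 * lameMu Y ν)).congr h.pos (fun x hx β hβ => rfl)
      (fun x hx => ?_) (fun x hx => ?_) (fun x hx => ?_) <;> simp
  refine ⟨w, ?_, ?_, ?_, ?_⟩
  · refine (hw.mul hK (ht.add (hwx.const_smul (2 * lameMu Y ν)))).congr h.pos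
      (fun x hx β hβ => M.stress_00 Y ν β (p β) (h.chart_mem hx hβ)) (fun x hx => ?_)
      (fun x hx => ?_) (fun x hx => ?_)
    all_goals simp
    ring
  · exact h01.congr h.pos (fun x hx β hβ => M.stress_01 Y ν β (p β) (h.chart_mem hx hβ))
      (fun _ _ => rfl) (fun _ _ => rfl) (fun _ _ => rfl)
  · exact h01.congr h.pos (fun x hx β hβ => M.stress_10 Y ν β (p β) (h.chart_mem hx hβ))
      (fun _ _ => rfl) (fun _ _ => rfl) (fun _ _ => rfl)
  · refine (ht.add (hy.const_smul (2 * lameMu Y ν))).congr h.pos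
      (fun x hx β hβ => M.stress_11 Y ν β (p β) (h.chart_mem hx hβ)) (fun x hx => ?_)
      (fun x hx => ?_) (fun x hx => ?_)
    all_goals simp
    ring

/-- At the order where the stress starts, √G and the frame enter only through their limits; all
other terms contain a lower-order stress. -/
lemma hasExpansion_flux (h : MinimizingFamily M k Y ν s₁ s₂ β₁ p P)
    {a₀ a₁ a₂ b₀ b₁ b₂ : ℝ × ℝ → Plane} {j : Fin 2} {σ₁ σ₂ τ₁ τ₂ : ℝ × ℝ → ℝ}
    (ha : HasExpansion (base s₁ s₂)
      (fun x β => partialWithin (M.D β) 0 (p β) (M.chart β x)) a₀ a₁ a₂)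
    (hb : HasExpansion (base s₁ s₂)
      (fun x β => partialWithin (M.D β) 1 (p β) (M.chart β x)) b₀ b₁ b₂)
    (hσ : HasExpansion (base s₁ s₂) (fun x β => M.stress Y ν β (p β) 0 j (M.chart β x))
      (fun _ => 0) σ₁ σ₂)
    (hτ : HasExpansion (base s₁ s₂) (fun x β => M.stress Y ν β (p β) 1 j (M.chart β x))
      (fun _ => 0) τ₁ τ₂) :
    ∃ w : ℝ × ℝ → ℝ,
    HasExpansion (base s₁ s₂) (fun x β => M.flux Y ν β (p β) j (M.chart β x)) (fun _ => 0)
      (fun x => σ₁ x • a₀ x + τ₁ x • b₀ x)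
      (fun x => σ₂ x • a₀ x + τ₂ x • b₀ x + (σ₁ x • a₁ x + τ₁ x • b₁ x)
        + w x • (σ₁ x • a₀ x + τ₁ x • b₀ x)) := by
  have hK := isCompact_base (s₁ := s₁) (s₂ := s₂)
  obtain ⟨w, w₂, hw⟩ := M.hasExpansion_sqrt_G h.lt h.sub h.pos h.le_one
  refine ⟨w, (hw.smul hK ((hσ.smul hK ha).add (hτ.smul hK hb))).congr h.pos
    (fun x hx β hβ => rfl) (fun x hx => ?_) (fun x hx => ?_) (fun x hx => ?_)⟩
  · simp
  · simp
  · simp only [zero_smul, zero_add, add_zero, one_smul, smul_zero]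
    module

/-- Equilibrium determines the leading term of the strain. -/
theorem leading_strain (h : MinimizingFamily M k Y ν s₁ s₂ β₁ p P) {n : ℕ}
    {a₀ b₀ : ℝ × ℝ → Plane} {x y z : ℝ × ℝ → ℝ} (ha₀ : ContinuousOn a₀ (base s₁ s₂))
    (hb₀ : ContinuousOn b₀ (base s₁ s₂)) (hx : ContinuousOn x (base s₁ s₂))
    (hy : ContinuousOn y (base s₁ s₂)) (hz : ContinuousOn z (base s₁ s₂))
    (haa : ∀ q ∈ base s₁ s₂, inner ℝ (a₀ q) (a₀ q) = (1 : ℝ))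
    (hbb : ∀ q ∈ base s₁ s₂, inner ℝ (b₀ q) (b₀ q) = (1 : ℝ))
    (hab : ∀ q ∈ base s₁ s₂, inner ℝ (a₀ q) (b₀ q) = (0 : ℝ))
    (har : ∀ q ∈ base s₁ s₂, a₀ q = a₀ (q.1, 0)) (hbr : ∀ q ∈ base s₁ s₂, b₀ q = b₀ (q.1, 0))
    (hf₀ : ∃ C, ∃ δ > 0, ∀ q ∈ base s₁ s₂, ∀ β ∈ Ioo 0 δ,
      ‖M.flux Y ν β (p β) 0 (M.chart β q)
        - β ^ n • ((lameLambda Y ν * (x q + y q) + 2 * lameMu Y ν * x q) • a₀ q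
          + (2 * lameMu Y ν * z q) • b₀ q)‖ ≤ C * β ^ (n + 1))
    (hf₁ : ∃ C, ∃ δ > 0, ∀ q ∈ base s₁ s₂, ∀ β ∈ Ioo 0 δ,
      ‖M.flux Y ν β (p β) 1 (M.chart β q)
        - β ^ n • ((2 * lameMu Y ν * z q) • a₀ q
          + (lameLambda Y ν * (x q + y q) + 2 * lameMu Y ν * y q) • b₀ q)‖ ≤ C * β ^ (n + 1))
    (hm : ∃ C, ∃ δ > 0, ∀ q ∈ base s₁ s₂, ∀ β ∈ Ioo 0 δ,
      ‖p β (M.chart β q) - p β (M.chart β (q.1, 0)) - β ^ 1 • ((q.2 * M.B q.1) • b₀ q)‖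
        ≤ C * β ^ (1 + 1))
    {c d e : ℝ → ℝ} (hquad : ∀ s ∈ Icc s₁ s₂, ∀ r ∈ Icc (-1 : ℝ) 1,
      x (s, r) = c s + d s * r + e s * r ^ 2) :
    ∀ q ∈ base s₁ s₂, z q = 0 ∧ lameLambda Y ν * (x q + y q) + 2 * lameMu Y ν * y q = 0
      ∧ y q = -ν * x q ∧ x q = e q.1 * (q.2 ^ 2 - 1 / 3) := by
  have hν1 : 0 < 1 + ν := by linarith [h.neg_one_lt]
  have hν2 : 0 < 1 - ν := by linarith [h.lt_one]
  have hY := h.Y_pos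
  have hμ : lameMu Y ν ≠ 0 := by rw [lameMu]; positivity
  have hS00c : ContinuousOn (fun q => lameLambda Y ν * (x q + y q) + 2 * lameMu Y ν * x q)
      (base s₁ s₂) := by fun_prop
  have hS01c : ContinuousOn (fun q => 2 * lameMu Y ν * z q) (base s₁ s₂) := by fun_prop
  have hS11c : ContinuousOn (fun q => lameLambda Y ν * (x q + y q) + 2 * lameMu Y ν * y q)
      (base s₁ s₂) := by fun_prop
  have hn₀ := (hS00c.smul ha₀).add (hS01c.smul hb₀)
  have hn₁ := (hS01c.smul ha₀).add (hS11c.smul hb₀)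
  -- The leading traction is a combination of the orthonormal vectors a₀ and b₀, so both its stress
  -- components vanish.
  have htr := h.leading_traction_eq_zero hn₀ hn₁ hf₀ hf₁
  have hz0 : ∀ q ∈ base s₁ s₂, z q = 0 := by
    intro q hq
    have := congrArg (fun v => inner ℝ (a₀ q) v) (htr q hq)
    simp only [Pi.add_apply, Pi.smul_apply', inner_add_right, real_inner_smul_right, haa q hq,
      hab q hq, inner_zero_right, mul_one, mul_zero, add_zero] at this
    simpa [hμ] using this
  have hS11 : ∀ q ∈ base s₁ s₂, lameLambda Y ν * (x q + y q) + 2 * lameMu Y ν * y q = 0 := by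
    intro q hq
    have := congrArg (fun v => inner ℝ (b₀ q) v) (htr q hq)
    simpa only [Pi.add_apply, Pi.smul_apply', inner_add_right, real_inner_smul_right, hbb q hq,
      real_inner_comm (a₀ q) (b₀ q), hab q hq, inner_zero_right, mul_one, mul_zero,
      zero_add] using this
  -- Uniaxial stress: S²² = 0 reads νx + y = 0 after clearing the Lamé denominators, and S¹¹ then
  -- collapses to Y x.
  have hyx : ∀ q ∈ base s₁ s₂, y q = -ν * x q := by
    intro q hq
    have := hS11 q hq
    rw [lameLambda, lameMu] at this
    field_simp at this
    have h1 : Y * (y q + ν * x q) = 0 := by linear_combination this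
    have h2 := (mul_eq_zero.1 h1).resolve_left hY.ne'
    linarith
  have hS00 : ∀ q ∈ base s₁ s₂,
      lameLambda Y ν * (x q + y q) + 2 * lameMu Y ν * x q = Y * x q := by
    intro q hq
    rw [hyx q hq, lameLambda, lameMu]
    field_simp
    ring
  refine fun q hq => ⟨hz0 q hq, hS11 q hq, hyx q hq, ?_⟩
  obtain ⟨s, r⟩ := q
  have hs : s ∈ Icc s₁ s₂ := hq.1
  have h0m : ∀ r ∈ Icc (-1 : ℝ) 1, (s, r) ∈ base s₁ s₂ := fun r hr => ⟨hs, hr⟩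
  have h00 : (s, (0 : ℝ)) ∈ base s₁ s₂ := h0m 0 (by norm_num)
  refine quadratic_eq_of_moments (f := fun r => x (s, r)) (hquad s hs) ?_ ?_ r hq.2
  · have hF := h.leading_force_eq_zero hn₀ hf₀ hs (a₀ (s, 0))
    have e : ∫ r in Icc (-1 : ℝ) 1, Y * x (s, r) = 0 := by
      refine Eq.trans ?_ hF
      refine setIntegral_congr_fun measurableSet_Icc fun r hr => ?_
      simp only [Pi.add_apply, Pi.smul_apply', inner_add_left, real_inner_smul_left,
        hz0 _ (h0m r hr), hS00 _ (h0m r hr), har _ (h0m r hr), haa _ h00]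
      ring
    rw [integral_const_mul] at e
    exact (mul_eq_zero.1 e).resolve_left hY.ne'
  · have hmc : ContinuousOn (fun q : ℝ × ℝ => (q.2 * M.B q.1) • b₀ q) (base s₁ s₂) :=
      (continuousOn_snd.mul h.continuousOn_B).smul hb₀
    have hF := h.leading_moment_eq_zero hn₀ hmc hf₀ hm hs
    -- The lever arm is r B b₀, so the moment density is r x times a factor containing the
    -- determinant of the frame, which is nonzero by orthonormality.
    have hκ := sq_det_eq_one (haa _ h00) (hbb _ h00) (hab _ h00)
    have hκ0 : inner ℝ (a₀ (s, 0)) (rot (b₀ (s, 0))) ≠ 0 := fun h0 => by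
      rw [h0] at hκ; norm_num at hκ
    have hB := (h.B_pos h00).ne'
    have e : ∫ r in Icc (-1 : ℝ) 1, (Y * M.B s * inner ℝ (a₀ (s, 0)) (rot (b₀ (s, 0))))
        * (r * x (s, r)) = 0 := by
      refine Eq.trans ?_ hF
      refine setIntegral_congr_fun measurableSet_Icc fun r hr => ?_
      simp only [Pi.add_apply, Pi.smul_apply', inner_add_left, real_inner_smul_left, map_smul,
        real_inner_smul_right, hz0 _ (h0m r hr), hS00 _ (h0m r hr), har _ (h0m r hr),
        hbr _ (h0m r hr)]
      ring
    rw [integral_const_mul] at e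
    exact (mul_eq_zero.1 e).resolve_left (mul_ne_zero (mul_ne_zero hY.ne' hB) hκ0)

end MinimizingFamily

end CenteredStrip

end ElasticStrip
end

noncomputable section

open Set Filter Topology MeasureTheory

namespace ElasticStrip

namespace CenteredStrip

namespace MinimizingFamily

variable {M : CenteredStrip} {k : ℕ∞} {Y ν s₁ s₂ β₁ : ℝ} {p : ℝ → ℝ × ℝ → Plane}
  {P : ℝ × ℝ × ℝ → Plane}

/-! ### The strain to second order -/

section

variable {a₀ a₁ a₂ b₀ b₁ b₂ : ℝ × ℝ → Plane} {x₁ x₂ y₁ y₂ z₁ z₂ : ℝ × ℝ → ℝ} {c d e : ℝ → ℝ}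

/-- The equilibrium argument with n = 1, the strain having no zeroth-order term. -/
lemma strain_first_order (h : MinimizingFamily M k Y ν s₁ s₂ β₁ p P)
    (ha : HasExpansion (base s₁ s₂)
      (fun x β => partialWithin (M.D β) 0 (p β) (M.chart β x)) a₀ a₁ a₂)
    (hb : HasExpansion (base s₁ s₂)
      (fun x β => partialWithin (M.D β) 1 (p β) (M.chart β x)) b₀ b₁ b₂)
    (hx : HasExpansion (base s₁ s₂) (fun x β => M.strain β (p β) 0 0 (M.chart β x))
      (fun _ => 0) x₁ x₂)
    (hz : HasExpansion (base s₁ s₂) (fun x β => M.strain β (p β) 0 1 (M.chart β x))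
      (fun _ => 0) z₁ z₂)
    (hy : HasExpansion (base s₁ s₂) (fun x β => M.strain β (p β) 1 1 (M.chart β x))
      (fun _ => 0) y₁ y₂)
    (haa : ∀ q ∈ base s₁ s₂, inner ℝ (a₀ q) (a₀ q) = (1 : ℝ))
    (hbb : ∀ q ∈ base s₁ s₂, inner ℝ (b₀ q) (b₀ q) = (1 : ℝ))
    (hab : ∀ q ∈ base s₁ s₂, inner ℝ (a₀ q) (b₀ q) = (0 : ℝ))
    (har : ∀ q ∈ base s₁ s₂, a₀ q = a₀ (q.1, 0)) (hbr : ∀ q ∈ base s₁ s₂, b₀ q = b₀ (q.1, 0))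
    (hm : ∃ C, ∃ δ > 0, ∀ q ∈ base s₁ s₂, ∀ β ∈ Ioo 0 δ,
      ‖p β (M.chart β q) - p β (M.chart β (q.1, 0)) - β ^ 1 • ((q.2 * M.B q.1) • b₀ q)‖
        ≤ C * β ^ (1 + 1))
    (hquad : ∀ s ∈ Icc s₁ s₂, ∀ r ∈ Icc (-1 : ℝ) 1,
      x₁ (s, r) = c s + d s * r + e s * r ^ 2) :
    ∀ q ∈ base s₁ s₂, z₁ q = 0 ∧ y₁ q = -ν * x₁ q ∧ x₁ q = e q.1 * (q.2 ^ 2 - 1 / 3) := by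
  obtain ⟨w, h00, h01, h10, h11⟩ := h.hasExpansion_stress hx hz hy
  obtain ⟨w₀, hf₀⟩ := h.hasExpansion_flux ha hb h00 h10
  obtain ⟨w₁, hf₁⟩ := h.hasExpansion_flux ha hb h01 h11
  have hK := isCompact_base (s₁ := s₁) (s₂ := s₂)
  exact fun q hq => (h.leading_strain ha.cont₀ hb.cont₀ hx.cont₁ hy.cont₁ hz.cont₁ haa hbb hab
    har hbr (hf₀.bound_two hK fun _ _ => rfl) (hf₁.bound_two hK fun _ _ => rfl) hm hquad q
    hq).imp_right And.right

/-- The same argument with n = 2: once the first-order strain is zero, the lower-order contributions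
to stress and flux drop out. -/
lemma strain_second_order (h : MinimizingFamily M k Y ν s₁ s₂ β₁ p P)
    (ha : HasExpansion (base s₁ s₂)
      (fun x β => partialWithin (M.D β) 0 (p β) (M.chart β x)) a₀ a₁ a₂)
    (hb : HasExpansion (base s₁ s₂)
      (fun x β => partialWithin (M.D β) 1 (p β) (M.chart β x)) b₀ b₁ b₂)
    (hx : HasExpansion (base s₁ s₂) (fun x β => M.strain β (p β) 0 0 (M.chart β x))
      (fun _ => 0) (fun _ => 0) x₂)
    (hz : HasExpansion (base s₁ s₂) (fun x β => M.strain β (p β) 0 1 (M.chart β x))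
      (fun _ => 0) (fun _ => 0) z₂)
    (hy : HasExpansion (base s₁ s₂) (fun x β => M.strain β (p β) 1 1 (M.chart β x))
      (fun _ => 0) (fun _ => 0) y₂)
    (haa : ∀ q ∈ base s₁ s₂, inner ℝ (a₀ q) (a₀ q) = (1 : ℝ))
    (hbb : ∀ q ∈ base s₁ s₂, inner ℝ (b₀ q) (b₀ q) = (1 : ℝ))
    (hab : ∀ q ∈ base s₁ s₂, inner ℝ (a₀ q) (b₀ q) = (0 : ℝ))
    (har : ∀ q ∈ base s₁ s₂, a₀ q = a₀ (q.1, 0)) (hbr : ∀ q ∈ base s₁ s₂, b₀ q = b₀ (q.1, 0))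
    (hm : ∃ C, ∃ δ > 0, ∀ q ∈ base s₁ s₂, ∀ β ∈ Ioo 0 δ,
      ‖p β (M.chart β q) - p β (M.chart β (q.1, 0)) - β ^ 1 • ((q.2 * M.B q.1) • b₀ q)‖
        ≤ C * β ^ (1 + 1))
    (hquad : ∀ s ∈ Icc s₁ s₂, ∀ r ∈ Icc (-1 : ℝ) 1,
      x₂ (s, r) = c s + d s * r + e s * r ^ 2) :
    ∀ q ∈ base s₁ s₂, z₂ q = 0 ∧ y₂ q = -ν * x₂ q ∧ x₂ q = e q.1 * (q.2 ^ 2 - 1 / 3) := by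
  obtain ⟨w, h00, h01, h10, h11⟩ := h.hasExpansion_stress hx hz hy
  obtain ⟨w₀, hf₀⟩ := h.hasExpansion_flux ha hb h00 h10
  obtain ⟨w₁, hf₁⟩ := h.hasExpansion_flux ha hb h01 h11
  have h0 := hf₀.bound_three (fun _ _ => rfl) fun _ _ => by simp
  have h1 := hf₁.bound_three (fun _ _ => rfl) fun _ _ => by simp
  simp only [mul_zero, add_zero, zero_smul, smul_zero] at h0 h1
  exact fun q hq => (h.leading_strain ha.cont₀ hb.cont₀ hx.cont₂ hy.cont₂ hz.cont₂ haa hbb hab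
    har hbr h0 h1 hm hquad q hq).imp_right And.right

end

/-- The Gaussian curvature of the reference metric and the breadth determine the strain to second
order. -/
theorem hasExpansion_strain_minimizer (h : MinimizingFamily M k Y ν s₁ s₂ β₁ p P) :
    HasExpansion (base s₁ s₂) (fun x β => M.strain β (p β) 0 0 (M.chart β x)) (fun _ => 0)
      (fun _ => 0) (fun x => 1 / 2 * M.K x.1 * M.B x.1 ^ 2 * (x.2 ^ 2 - 1 / 3)) ∧
    HasExpansion (base s₁ s₂) (fun x β => M.strain β (p β) 0 1 (M.chart β x)) (fun _ => 0)
      (fun _ => 0) (fun _ => 0) ∧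
    HasExpansion (base s₁ s₂) (fun x β => M.strain β (p β) 1 1 (M.chart β x)) (fun _ => 0)
      (fun _ => 0) (fun x => -ν * (1 / 2 * M.K x.1 * M.B x.1 ^ 2 * (x.2 ^ 2 - 1 / 3))) := by
  obtain ⟨p₀, p₁, p₂, b₂, hp₀, hp₁, hp₂, hp₀r, hp, ha, hb⟩ := h.exists_expansions
  obtain ⟨hx, hz, hy⟩ := h.hasExpansion_strain ha hb
  have hlim := h.strain_zero hx hz hy
  set a₀ := partialWithin (base s₁ s₂) 0 p₀ with ha₀
  set q := partialWithin (base s₁ s₂) 1 p₁ with hq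
  have hU := uniqueDiffOn_base h.lt
  have hqs : ContDiffOn ℝ ∞ q (base s₁ s₂) := CenteredStrip.partialWithin_smooth hU hp₁ 1
  have hm0 : ∀ x ∈ base s₁ s₂, (x.1, (0 : ℝ)) ∈ base s₁ s₂ := fun x hx =>
    ⟨hx.1, by norm_num⟩
  have hr0 : (0 : ℝ) ∈ Icc (-1 : ℝ) 1 := by norm_num
  have haa : ∀ x ∈ base s₁ s₂, inner ℝ (a₀ x) (a₀ x) = (1 : ℝ) := fun x hx => by
    linarith [(hlim x hx).1]
  have hab : ∀ x ∈ base s₁ s₂, inner ℝ (a₀ x) ((M.B x.1)⁻¹ • q x) = (0 : ℝ) := fun x hx => by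
    linarith [(hlim x hx).2.1]
  have hbb : ∀ x ∈ base s₁ s₂, inner ℝ ((M.B x.1)⁻¹ • q x) ((M.B x.1)⁻¹ • q x) = (1 : ℝ) :=
    fun x hx => by linarith [(hlim x hx).2.2]
  have haq : ∀ x ∈ base s₁ s₂, inner ℝ (a₀ x) (q x) = (0 : ℝ) := fun x hx => by
    have := hab x hx
    rw [real_inner_smul_right] at this
    exact (mul_eq_zero.1 this).resolve_left (inv_ne_zero (h.B_pos hx).ne')
  have hqq : ∀ x ∈ base s₁ s₂, inner ℝ (q x) (q x) = M.B x.1 ^ 2 := fun x hx => by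
    have := hbb x hx
    rw [real_inner_smul_right, real_inner_smul_left] at this
    have hB := (h.B_pos hx).ne'
    field_simp at this
    exact this
  have hp₀c : ∀ x ∈ base s₁ s₂, p₀ x = p₀ (x.1, 0) := fun x hx => by
    simpa using eq_affine_of_partialWithin_one (hp₀.differentiableOn (by simp)) hx.1
      (fun r hr => hp₀r (x.1, r) ⟨hx.1, hr⟩) hx.2
  have har : ∀ x ∈ base s₁ s₂, a₀ x = a₀ (x.1, 0) := fun x hx =>
    partialWithin_zero_eq_of_const h.lt (hp₀.differentiableOn (by simp)) hx.2 hr0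
      (fun s hs => hp₀c (s, x.2) ⟨hs, hx.2⟩) hx.1
  have hqd : DifferentiableOn ℝ q (base s₁ s₂) := hqs.differentiableOn (by simp)
  -- q = B b₀ has length B(s) and is orthogonal to a₀(s), neither of which depends on r. So ∂ᵣq is
  -- orthogonal to both q and a₀, hence zero.
  have hq1 : ∀ x ∈ base s₁ s₂, partialWithin (base s₁ s₂) 1 q x = 0 := by
    rintro ⟨s, r⟩ hx
    have hd := hasDerivWithinAt_snd hqd hx.1 hx.2
    have hu := uniqueDiffOn_Icc (show (-1 : ℝ) < 1 by norm_num) r hx.2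
    have e1 := hu.eq_deriv _ (hd.inner ℝ hd) ((hasDerivWithinAt_const r (Icc (-1) 1)
      (M.B s ^ 2)).congr (fun t ht => hqq (s, t) ⟨hx.1, ht⟩) (hqq (s, r) hx))
    have e2 := hu.eq_deriv _ ((hasDerivWithinAt_const r (Icc (-1) 1) (a₀ (s, 0))).inner ℝ hd)
      ((hasDerivWithinAt_const r (Icc (-1) 1) (0 : ℝ)).congr (fun t ht => by
        rw [← har (s, t) ⟨hx.1, ht⟩]; exact haq (s, t) ⟨hx.1, ht⟩)
        (by rw [← har (s, r) hx]; exact haq (s, r) hx))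
    rw [inner_zero_left, add_zero, ← har (s, r) hx] at e2
    rw [real_inner_comm, ← two_mul] at e1
    refine eq_zero_of_inner_eq_zero (haa _ hx) (hbb _ hx) (hab _ hx)
      ((real_inner_comm _ _).trans e2) ?_
    rw [real_inner_smul_right]
    have : inner ℝ (partialWithin (base s₁ s₂) 1 q (s, r)) (q (s, r)) = (0 : ℝ) := by linarith
    rw [this, mul_zero]
  have hqr : ∀ x ∈ base s₁ s₂, q x = q (x.1, 0) := fun x hx => by
    simpa using eq_affine_of_partialWithin_one hqd hx.1
      (fun r hr => hq1 (x.1, r) ⟨hx.1, hr⟩) hx.2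
  have hbr : ∀ x ∈ base s₁ s₂, (M.B x.1)⁻¹ • q x = (M.B x.1)⁻¹ • q (x.1, 0) := fun x hx => by
    rw [hqr x hx]
  -- p₀ is independent of r and p₁ is affine in r with slope q = B b₀; this is the lever arm in the
  -- moment balance.
  have hm := ((hp.sub (hp.comp (φ := fun x => (x.1, 0)) (by fun_prop) hm0)).congr h.pos
    (d₀ := fun _ => 0) (d₁ := fun x => (x.2 * M.B x.1) • (M.B x.1)⁻¹ • q x)
    (fun _ _ _ _ => rfl) (fun x hx => by rw [hp₀c x hx, sub_self]) (fun x hx => by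
      have hB := (h.B_pos hx).ne'
      have := eq_affine_of_partialWithin_one (hp₁.differentiableOn (by simp))
        (c := q (x.1, 0)) hx.1 (fun r hr => hqr (x.1, r) ⟨hx.1, hr⟩) hx.2
      rw [this, hqr x hx, smul_smul, mul_assoc, mul_inv_cancel₀ hB, mul_one, add_sub_cancel_left])
    (fun _ _ => rfl)).bound_two isCompact_base fun _ _ => rfl
  -- the first order
  have hx' := hx.congr (d₀ := fun _ => 0) h.pos (fun _ _ _ _ => rfl)
    (fun x hx => ((hlim x hx).1).symm) (fun _ _ => rfl) fun _ _ => rfl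
  have hz' := hz.congr (d₀ := fun _ => 0) h.pos (fun _ _ _ _ => rfl)
    (fun x hx => ((hlim x hx).2.1).symm) (fun _ _ => rfl) fun _ _ => rfl
  have hy' := hy.congr (d₀ := fun _ => 0) h.pos (fun _ _ _ _ => rfl)
    (fun x hx => ((hlim x hx).2.2).symm) (fun _ _ => rfl) fun _ _ => rfl
  obtain ⟨A, hA⟩ : ∃ A : ℝ → Plane, A = fun s => partialWithin (base s₁ s₂) 0 p₁ (s, 0) :=
    ⟨_, rfl⟩
  obtain ⟨D, hD⟩ : ∃ D : ℝ → Plane, D = fun s => partialWithin (base s₁ s₂) 0 q (s, 0)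
    - (M.dB s / M.B s) • q (s, 0) := ⟨_, rfl⟩
  have ha₁ : ∀ s ∈ Icc s₁ s₂, ∀ r ∈ Icc (-1 : ℝ) 1,
      partialWithin (base s₁ s₂) 0 p₁ (s, r) - (M.dB s / M.B s * r) • q (s, r)
        = A s + r • D s := fun s hs r hr => by
    rw [partialWithin_zero_affine h.lt hp₁ (fun s hs r hr => hqr (s, r) ⟨hs, hr⟩) hs hr,
      hqr (s, r) ⟨hs, hr⟩, hA, hD]
    module
  -- The first-order longitudinal strain is affine in r, so e = 0 and the two moment conditions
  -- annihilate it.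
  have h1 := h.strain_first_order ha hb hx' hz' hy' haa hbb hab har hbr hm
    (c := fun s => inner ℝ (a₀ (s, 0)) (A s))
    (d := fun s => inner ℝ (a₀ (s, 0)) (D s) - M.G' (s, 0) * M.B s / 2) (e := fun _ => 0)
    (fun s hs r hr => by
      simp only [ha₁ s hs r hr, har (s, r) ⟨hs, hr⟩, inner_add_right, real_inner_smul_right]
      ring)
  simp only [zero_mul] at h1
  have hx₁ := fun x hx => (h1 x hx).2.2
  have hz₁ := fun x hx => (h1 x hx).1
  have hy₁ := fun x hx => (h1 x hx).2.1.trans (by rw [(h1 x hx).2.2, mul_zero])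
  -- the limit frame and its first variation
  have hDa : ∀ s ∈ Icc s₁ s₂, D s = (M.G' (s, 0) * M.B s / 2) • a₀ (s, 0) := by
    intro s hs
    have hs0 : (s, (0 : ℝ)) ∈ base s₁ s₂ := ⟨hs, hr0⟩
    have hB := (h.B_pos hs0).ne'
    rw [← sub_eq_zero]
    refine eq_zero_of_inner_eq_zero (haa _ hs0) (hbb _ hs0) (hab _ hs0) ?_ ?_
    -- Comparing the vanishing affine strain at r = 0 and r = 1 isolates its slope, which gives the
    -- component of D along a₀.
    · have e0 := hx₁ (s, 0) hs0
      have e1 := hx₁ (s, 1) ⟨hs, by norm_num⟩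
      simp only [ha₁ s hs 0 hr0, ha₁ s hs 1 (by norm_num), har (s, 1) ⟨hs, by norm_num⟩,
        inner_add_right, real_inner_smul_right] at e0 e1
      rw [inner_sub_left, real_inner_smul_left, haa _ hs0, real_inner_comm]
      linarith
    -- Differentiating |q|² = B² in s gives ⟨∂ₛq, q⟩ = B B', exactly offset by the term (B'/B) q in
    -- D; so D has no component along b₀.
    · have hd := hasDerivWithinAt_fst hqd hs hr0
      have e1 := (uniqueDiffOn_Icc h.lt s hs).eq_deriv _ (hd.inner ℝ hd)
        ((((M.hasDerivWithinAt_B (h.sub hs)).mono h.sub).pow 2).congr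
          (fun t ht => hqq (t, 0) ⟨ht, hr0⟩) (hqq (s, 0) hs0))
      rw [real_inner_comm, ← two_mul] at e1
      have e2 : inner ℝ (partialWithin (base s₁ s₂) 0 q (s, 0)) (q (s, 0))
          = M.B s * M.dB s := by
        norm_num at e1
        linarith
      rw [inner_sub_left, real_inner_smul_left, hab _ hs0, hD, inner_sub_left,
        real_inner_smul_left, real_inner_smul_right, real_inner_smul_right, e2, hqq _ hs0]
      field_simp
      ring
  -- Vanishing first-order shear and transverse strain fix both components of b₁. The term with r D
  -- drops out of the shear because D is parallel to a₀, so b₁ does not depend on r.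
  have hb₁ : ∀ x ∈ base s₁ s₂, (M.B x.1)⁻¹ • (1 / 2 : ℝ) • partialWithin (base s₁ s₂) 1 p₂ x
      = -inner ℝ (A x.1) ((M.B x.1)⁻¹ • q (x.1, 0)) • a₀ (x.1, 0) := by
    intro x hx
    have e0 := hz₁ x hx
    have e1 := hy₁ x hx
    simp only [ha₁ x.1 hx.1 x.2 hx.2] at e0
    rw [hDa x.1 hx.1, inner_add_left, real_inner_smul_left, real_inner_smul_left, ← har x hx,
      hab x hx] at e0
    generalize (M.B x.1)⁻¹ • (1 / 2 : ℝ) • partialWithin (base s₁ s₂) 1 p₂ x = v at e0 e1 ⊢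
    rw [← har x hx, ← hqr x hx, ← sub_eq_zero]
    refine eq_zero_of_inner_eq_zero (haa _ hx) (hbb _ hx) (hab _ hx) ?_ ?_
    · rw [inner_sub_left, real_inner_smul_left, haa _ hx, real_inner_comm]
      linarith
    · rw [inner_sub_left, real_inner_smul_left, hab _ hx, real_inner_comm, e1]
      ring
  -- Consequently p₂ is affine in r, and so is the second-order coefficient a₂ of ∂₁p.
  have hp₂r : ∀ s ∈ Icc s₁ s₂, ∀ r ∈ Icc (-1 : ℝ) 1, partialWithin (base s₁ s₂) 1 p₂ (s, r)
      = partialWithin (base s₁ s₂) 1 p₂ (s, 0) := by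
    intro s hs r hr
    have e := (hb₁ (s, r) ⟨hs, hr⟩).trans (hb₁ (s, 0) ⟨hs, hr0⟩).symm
    have hB := (h.B_pos (x := (s, r)) ⟨hs, hr⟩).ne'
    exact smul_right_injective Plane (by norm_num : (1 / 2 : ℝ) ≠ 0)
      (smul_right_injective Plane (inv_ne_zero hB) e)
  obtain ⟨A₂, hA₂⟩ : ∃ A₂ : ℝ → Plane,
    A₂ = fun s => (1 / 2 : ℝ) • partialWithin (base s₁ s₂) 0 p₂ (s, 0) := ⟨_, rfl⟩
  obtain ⟨D₂, hD₂⟩ : ∃ D₂ : ℝ → Plane, D₂ = fun s =>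
    (1 / 2 : ℝ) • (partialWithin (base s₁ s₂) 0 (partialWithin (base s₁ s₂) 1 p₂) (s, 0)
      - (M.dB s / M.B s) • partialWithin (base s₁ s₂) 1 p₂ (s, 0)) := ⟨_, rfl⟩
  have ha₂ : ∀ s ∈ Icc s₁ s₂, ∀ r ∈ Icc (-1 : ℝ) 1,
      (1 / 2 : ℝ) • (partialWithin (base s₁ s₂) 0 p₂ (s, r)
        - (M.dB s / M.B s * r) • partialWithin (base s₁ s₂) 1 p₂ (s, r))
        = A₂ s + r • D₂ s := fun s hs r hr => by
    rw [partialWithin_zero_affine h.lt hp₂ hp₂r hs hr, hp₂r s hs r hr, hA₂, hD₂]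
    module
  -- the second order
  have hx'' := hx'.congr (d₁ := fun _ => 0) h.pos (fun _ _ _ _ => rfl) (fun _ _ => rfl)
    (fun x hx => (hx₁ x hx).symm) fun _ _ => rfl
  have hz'' := hz'.congr (d₁ := fun _ => 0) h.pos (fun _ _ _ _ => rfl) (fun _ _ => rfl)
    (fun x hx => (hz₁ x hx).symm) fun _ _ => rfl
  have hy'' := hy'.congr (d₁ := fun _ => 0) h.pos (fun _ _ _ _ => rfl) (fun _ _ => rfl)
    (fun x hx => (hy₁ x hx).symm) fun _ _ => rfl
  -- The r² coefficient is |D|²/2 - G''B²/4 with |D| = |G'|B/2, which is KB²/2 by `K_eq`. The value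
  -- of A, a rotation and stretch of the center curve, affects only lower powers of r.
  have h2 := h.strain_second_order ha hb hx'' hz'' hy'' haa hbb hab har hbr hm
    (c := fun s => inner ℝ (a₀ (s, 0)) (A₂ s) + inner ℝ (A s) (A s) / 2)
    (d := fun s => inner ℝ (a₀ (s, 0)) (D₂ s) + inner ℝ (A s) (D s))
    (e := fun s => 1 / 2 * M.K s * M.B s ^ 2)
    (fun s hs r hr => by
      have e1 : inner ℝ (D s) (D s) = (M.G' (s, 0) * M.B s / 2) ^ 2 := by
        rw [hDa s hs, real_inner_smul_left, real_inner_smul_right, haa (s, 0) ⟨hs, hr0⟩]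
        ring
      simp only [ha₁ s hs r hr, ha₂ s hs r hr, har (s, r) ⟨hs, hr⟩, inner_add_right,
        inner_add_left, real_inner_smul_right, real_inner_smul_left, e1,
        real_inner_comm (A s) (D s), M.K_eq (h.sub hs)]
      ring)
  refine ⟨hx''.congr h.pos (fun _ _ _ _ => rfl) (fun _ _ => rfl) (fun _ _ => rfl)
    fun x hx => ((h2 x hx).2.2).symm, hz''.congr h.pos (fun _ _ _ _ => rfl) (fun _ _ => rfl)
    (fun _ _ => rfl) fun x hx => ((h2 x hx).1).symm, hy''.congr h.pos (fun _ _ _ _ => rfl)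
    (fun _ _ => rfl) (fun _ _ => rfl) fun x hx => ?_⟩
  rw [(h2 x hx).2.1]
  exact congrArg (-ν * ·) (h2 x hx).2.2.symm

end MinimizingFamily

end CenteredStrip

end ElasticStrip
end

noncomputable section

open Set Filter Topology MeasureTheory

namespace ElasticStrip

lemma HasExpansion.exists_abs_le {K : Set (ℝ × ℝ)} {f : ℝ × ℝ → ℝ → ℝ}
    (h : HasExpansion K f (fun _ => 0) (fun _ => 0) (fun _ => 0)) :
    ∃ C, ∃ δ > 0, ∀ x ∈ K, ∀ β ∈ Ioo 0 δ, |f x β| ≤ C * β ^ 3 := by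
  simpa using h.bound

namespace CenteredStrip

variable (M : CenteredStrip)

/-! ### Components in the orthonormal frame -/

section Frame

variable {β : ℝ} (p : ℝ × ℝ → Plane) {u : ℝ × ℝ}

lemma frameStress_zero_one (Y ν : ℝ) :
    M.frameStress Y ν β p 0 1 u = √(M.G u) * M.stress Y ν β p 0 1 u := by
  simp [frameStress, coframe, G]

lemma frameStress_one_zero (Y ν : ℝ) :
    M.frameStress Y ν β p 1 0 u = √(M.G u) * M.stress Y ν β p 1 0 u := by
  simp [frameStress, coframe, G]

lemma frameStress_one_one (Y ν : ℝ) : M.frameStress Y ν β p 1 1 u = M.stress Y ν β p 1 1 u := by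
  simp [frameStress, coframe]

lemma frameStrain_zero_zero (hu : u ∈ M.D 1) :
    M.frameStrain β p 0 0 u = (M.G u)⁻¹ * M.strain β p 0 0 u := by
  have h := Real.mul_self_sqrt (M.G_pos hu).le
  simp only [G] at h
  simp [frameStrain, frame, G, ← mul_inv, h]

lemma frameStrain_one_one : M.frameStrain β p 1 1 u = M.strain β p 1 1 u := by
  simp [frameStrain, frame]

end Frame

/-! ### Expansions of the frame components -/

namespace MinimizingFamily

variable {M} {k : ℕ∞} {Y ν s₁ s₂ β₁ : ℝ} {p : ℝ → ℝ × ℝ → Plane} {P : ℝ × ℝ × ℝ → Plane}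

/-- Normalizing e₁ multiplies by 1/G = 1 + O(β), which does not change a term starting at order β².
-/
lemma hasExpansion_frameStrain_zero_zero (h : MinimizingFamily M k Y ν s₁ s₂ β₁ p P) :
    HasExpansion (base s₁ s₂) (fun x β => M.frameStrain β (p β) 0 0 (M.chart β x)) (fun _ => 0)
      (fun _ => 0) (fun x => 1 / 2 * M.K x.1 * M.B x.1 ^ 2 * (x.2 ^ 2 - 1 / 3)) := by
  obtain ⟨w, w₂, hw⟩ := M.hasExpansion_inv_G h.lt h.sub h.pos h.le_one
  refine (hw.mul isCompact_base h.hasExpansion_strain_minimizer.1).congr h.pos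
    (fun x hx β hβ => M.frameStrain_zero_zero (p β) (h.chart_mem hx hβ)) (fun x hx => ?_)
    (fun x hx => ?_) (fun x hx => ?_) <;> simp

lemma hasExpansion_frameStrain_one_one (h : MinimizingFamily M k Y ν s₁ s₂ β₁ p P) :
    HasExpansion (base s₁ s₂) (fun x β => M.frameStrain β (p β) 1 1 (M.chart β x)
      - (-ν * M.frameStrain β (p β) 0 0 (M.chart β x))) (fun _ => 0) (fun _ => 0)
      (fun _ => 0) := by
  refine (h.hasExpansion_strain_minimizer.2.2.sub
    (h.hasExpansion_frameStrain_zero_zero.const_smul (-ν))).congr h.pos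
    (fun x hx β hβ => by rw [frameStrain_one_one, smul_eq_mul]) (fun x hx => ?_)
    (fun x hx => ?_) (fun x hx => ?_) <;> simp

lemma hasExpansion_frameStress (h : MinimizingFamily M k Y ν s₁ s₂ β₁ p P) :
    HasExpansion (base s₁ s₂) (fun x β => M.frameStress Y ν β (p β) 0 1 (M.chart β x))
      (fun _ => 0) (fun _ => 0) (fun _ => 0) ∧
    HasExpansion (base s₁ s₂) (fun x β => M.frameStress Y ν β (p β) 1 0 (M.chart β x))
      (fun _ => 0) (fun _ => 0) (fun _ => 0) ∧
    HasExpansion (base s₁ s₂) (fun x β => M.frameStress Y ν β (p β) 1 1 (M.chart β x))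
      (fun _ => 0) (fun _ => 0) (fun _ => 0) := by
  obtain ⟨hx, hz, hy⟩ := h.hasExpansion_strain_minimizer
  obtain ⟨w, w₂, hw⟩ := M.hasExpansion_sqrt_G h.lt h.sub h.pos h.le_one
  obtain ⟨_, -, h01, h10, h11⟩ := h.hasExpansion_stress hx hz hy
  have hν1 : 1 + ν ≠ 0 := by linarith [h.neg_one_lt]
  have hν2 : 1 - ν ≠ 0 := by linarith [h.lt_one]
  refine ⟨(hw.mul isCompact_base h01).congr h.pos
      (fun x _ β _ => M.frameStress_zero_one (p β) Y ν) (fun x hx => ?_) (fun x hx => ?_)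
      (fun x hx => ?_),
    (hw.mul isCompact_base h10).congr h.pos
      (fun x _ β _ => M.frameStress_one_zero (p β) Y ν) (fun x hx => ?_) (fun x hx => ?_)
      (fun x hx => ?_),
    h11.congr h.pos (fun x _ β _ => M.frameStress_one_one (p β) Y ν) (fun x hx => ?_)
      (fun x hx => ?_) (fun x hx => ?_)⟩
  any_goals simp
  -- What remains is the second-order coefficient of S²²; it vanishes because E₂₂ = -ν E₁₁ is the
  -- uniaxial relation.
  rw [lameLambda, lameMu]
  field_simp
  ring

end MinimizingFamily

/-! ### Invariance under isometries of the plane -/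

section Isometry

variable {β : ℝ} (R : Plane ≃ᵃⁱ[ℝ] Plane) {p : ℝ × ℝ → Plane}

lemma isometry_apply (v : Plane) : R v = R.linearIsometryEquiv v + R 0 := by
  simpa using R.map_vadd 0 v

lemma partialWithin_isometry (hβ : 0 < β) {u : ℝ × ℝ} (hu : u ∈ M.D β) (i : Fin 2) :
    partialWithin (M.D β) i (fun v => R (p v)) u
      = R.linearIsometryEquiv (partialWithin (M.D β) i p u) := by
  have h := R.linearIsometryEquiv.comp_fderivWithin (f := p) (M.uniqueDiffOn_D hβ u hu)
  simp only [partialWithin, isometry_apply R (p _)]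
  rw [fderivWithin_add_const]
  exact congrArg (fun L => L (coordVec i)) h

/-- The linear part of an isometry preserves the inner products that make up the induced metric. -/
lemma strain_isometry (hβ : 0 < β) {u : ℝ × ℝ} (hu : u ∈ M.D β) (i j : Fin 2) :
    M.strain β (fun v => R (p v)) i j u = M.strain β p i j u := by
  simp only [strain, inducedMetric, M.partialWithin_isometry R hβ hu,
    LinearIsometryEquiv.inner_map_map]

lemma stress_isometry (Y ν : ℝ) (hβ : 0 < β) {u : ℝ × ℝ} (hu : u ∈ M.D β) (i j : Fin 2) :
    M.stress Y ν β (fun v => R (p v)) i j u = M.stress Y ν β p i j u := by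
  simp only [stress, M.strain_isometry R hβ hu]

lemma energy_isometry (Y ν : ℝ) (hβ : 0 < β) :
    M.energy Y ν β (fun v => R (p v)) = M.energy Y ν β p :=
  setIntegral_congr_fun (M.isCompact_D hβ).measurableSet fun u hu => by
    simp only [M.strain_isometry R hβ hu]

variable {M}

lemma IsPlaneEmbedding.isometry {k : ℕ∞} (hβ : 0 < β) (hp : M.IsPlaneEmbedding k β p) :
    M.IsPlaneEmbedding k β (fun v => R (p v)) where
  contDiffOn := by
    simp only [isometry_apply R (p _)]
    exact (R.linearIsometryEquiv.contDiff.comp_contDiffOn hp.contDiffOn).add contDiffOn_const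
  injOn := R.injective.comp_injOn hp.injOn
  immersion u hu := by
    simp only [M.partialWithin_isometry R hβ hu]
    exact (hp.immersion u hu).map' (R.linearIsometryEquiv.toLinearEquiv : Plane →ₗ[ℝ] Plane)
      (LinearEquiv.ker _)

lemma IsMinimizer.isometry {k : ℕ∞} {Y ν : ℝ} (hβ : 0 < β) (hp : M.IsMinimizer k Y ν β p) :
    M.IsMinimizer k Y ν β (fun v => R (p v)) :=
  ⟨hp.embedding.isometry R hβ, fun q hq => (M.energy_isometry R Y ν hβ).trans_le (hp.le q hq)⟩

end Isometry

/-! ### Compact parts of the strip -/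

/-- J is an interval up to its endpoints. The two points at thirds of I keep the enclosing interval
nondegenerate even if T is empty or a single point. -/
lemma exists_Icc_of_isCompact {J T : Set ℝ} (hJ : interior M.I ⊆ J) (hJ' : J ⊆ M.I) (hT : T ⊆ J)
    (hTc : IsCompact T) :
    ∃ s₁ s₂, s₁ < s₂ ∧ T ⊆ Icc s₁ s₂ ∧ Icc s₁ s₂ ⊆ J := by
  rw [I, interior_Icc] at hJ
  have hab := M.hab
  have key : ∀ s₁ ∈ J, ∀ s₂ ∈ J, Icc s₁ s₂ ⊆ J := by
    intro s₁ h₁ s₂ h₂ x hx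
    rcases hx.1.eq_or_lt with rfl | hx1
    · exact h₁
    rcases hx.2.eq_or_lt with rfl | hx2
    · exact h₂
    exact hJ ⟨(hJ' h₁).1.trans_lt hx1, hx2.trans_le (hJ' h₂).2⟩
  have hm₁ : (2 * M.a + M.b) / 3 ∈ J := hJ ⟨by linarith, by linarith⟩
  have hm₂ : (M.a + 2 * M.b) / 3 ∈ J := hJ ⟨by linarith, by linarith⟩
  have hm : (2 * M.a + M.b) / 3 < (M.a + 2 * M.b) / 3 := by linarith
  rcases T.eq_empty_or_nonempty with rfl | hne
  · exact ⟨_, _, hm, empty_subset _, key _ hm₁ _ hm₂⟩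
  refine ⟨min (sInf T) ((2 * M.a + M.b) / 3), max (sSup T) ((M.a + 2 * M.b) / 3),
    (min_le_right _ _).trans_lt (hm.trans_le (le_max_right _ _)), fun t ht =>
    ⟨(min_le_left _ _).trans (csInf_le hTc.bddBelow ht),
      (le_csSup hTc.bddAbove ht).trans (le_max_left _ _)⟩, key _ ?_ _ ?_⟩
  · rcases min_choice (sInf T) ((2 * M.a + M.b) / 3) with e | e <;> rw [e]
    exacts [hT (hTc.sInf_mem hne), hm₁]
  · rcases max_choice (sSup T) ((M.a + 2 * M.b) / 3) with e | e <;> rw [e]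
    exacts [hT (hTc.sSup_mem hne), hm₂]

variable {M}

/-- The isometries in the smoothness hypothesis are absorbed into the embeddings, which stay
minimizers with unchanged strain and stress; no regularity of the isometries in β is needed. Compact
sets T are handled by enclosing intervals. -/
lemma isBigOBreadth_of_hasExpansion {J : Set ℝ} (hJ : interior M.I ⊆ J) (hJ' : J ⊆ M.I) {n : ℕ∞}
    (hn : 1 ≤ n) {Y ν β₀ : ℝ} (hY : 0 < Y) (hν : -1 < ν) (hν' : ν < 1) (hβ₀ : 0 < β₀)
    (hβ₀' : β₀ ≤ 1) {p : ℝ → ℝ × ℝ → Plane} (hmin : ∀ β ∈ Ioo 0 β₀, M.IsMinimizer n Y ν β (p β))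
    (hsmooth : M.IsSmoothFamily J β₀ p) {F : ℝ → (ℝ × ℝ → Plane) → ℝ × ℝ → ℝ}
    {f : ℝ → ℝ → ℝ → ℝ} (hf : ∀ β s r, f β s r = F β (p β) (s, r))
    (hF : ∀ (R : Plane ≃ᵃⁱ[ℝ] Plane) (q : ℝ × ℝ → Plane) β x, 0 < β → x ∈ M.rect →
      F β (fun v => R (q v)) x = F β q x)
    (hexp : ∀ s₁ s₂ β₁ q P, MinimizingFamily M n Y ν s₁ s₂ β₁ q P →
      HasExpansion (base s₁ s₂) (fun x β => F β (q β) x) (fun _ => 0) (fun _ => 0) (fun _ => 0)) :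
    IsBigOBreadth J 3 f := by
  intro T hT hTc
  obtain ⟨s₁, s₂, hs, hTs, hsJ⟩ := M.exists_Icc_of_isCompact hJ hJ' hT hTc
  obtain ⟨R, P, hP, hRP⟩ := hsmooth
  -- Smoothness is given on the half-open range [0, β₀); halving yields a closed box, where
  -- compactness applies.
  have hlt : β₀ / 2 < β₀ := by linarith
  have hfam : MinimizingFamily M n Y ν s₁ s₂ (β₀ / 2) (fun β v => R β (p β v)) P :=
    { one_le := hn
      Y_pos := hY
      neg_one_lt := hν
      lt_one := hν'
      lt := hs
      sub := hsJ.trans hJ'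
      pos := by linarith
      le_one := by linarith
      smooth := hP.mono (prod_mono hsJ (prod_mono Subset.rfl fun β hβ =>
        ⟨hβ.1, hβ.2.trans_lt hlt⟩))
      isMinimizer := fun β hβ =>
        (hmin β ⟨hβ.1, hβ.2.trans_lt hlt⟩).isometry (R β) hβ.1
      eq := fun x hx β hβ =>
        (hRP x.1 (hsJ hx.1) x.2 hx.2 β ⟨hβ.1, hβ.2.trans_lt hlt⟩).symm }
  obtain ⟨C, δ, hδ, hC⟩ := (hexp _ _ _ _ _ hfam).exists_abs_le
  refine ⟨C, δ, hδ, fun β hβ s hs r hr => ?_⟩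
  have := hC (s, r) ⟨hTs hs, hr⟩ β hβ
  rwa [hF (R β) (p β) β (s, r) hβ.1 ⟨hJ' (hT hs), hr⟩, ← hf] at this

end CenteredStrip

end ElasticStrip
end

/-! ### The main theorem -/

open ElasticStrip CenteredStrip in
theorem mainTheorem1 (M : ElasticStrip.CenteredStrip)
    (Y ν : ℝ) (hY : 0 < Y) (hν : -1 < ν) (hν' : ν < 1)
    (k : ℕ∞) (hk : 1 ≤ k)
    (J : Set ℝ) (hJ : interior M.I ⊆ J) (hJ' : J ⊆ M.I)
    (β₀ : ℝ) (hβ₀ : 0 < β₀) (hβ₀' : β₀ ≤ 1)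
    (p : ℝ → ℝ × ℝ → ElasticStrip.Plane)
    (hmin : ∀ β ∈ Set.Ioo 0 β₀, M.IsMinimizer k Y ν β (p β))
    (hsmooth : M.IsSmoothFamily J β₀ p) :
    ElasticStrip.IsBigOBreadth J 3
        (fun β s r => M.frameStress Y ν β (p β) 0 1 (M.pt β s r)) ∧
    ElasticStrip.IsBigOBreadth J 3
        (fun β s r => M.frameStress Y ν β (p β) 1 0 (M.pt β s r)) ∧
    ElasticStrip.IsBigOBreadth J 3
        (fun β s r => M.frameStress Y ν β (p β) 1 1 (M.pt β s r)) ∧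
    ElasticStrip.IsBigOBreadth J 3
        (fun β s r => M.frameStrain β (p β) 0 0 (M.pt β s r)
          - 1 / 2 * M.K s * (β * M.B s) ^ 2 * (r ^ 2 - 1 / 3)) ∧
    ElasticStrip.IsBigOBreadth J 3
        (fun β s r => M.frameStrain β (p β) 1 1 (M.pt β s r)
          - (-ν * M.frameStrain β (p β) 0 0 (M.pt β s r))) := by
  have hstress : ∀ i j (R : Plane ≃ᵃⁱ[ℝ] Plane) (q : ℝ × ℝ → Plane) β x, 0 < β → x ∈ M.rect →
      M.frameStress Y ν β (fun v => R (q v)) i j (M.chart β x)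
        = M.frameStress Y ν β q i j (M.chart β x) := fun i j R q β x hβ hx => by
    simp only [frameStress, M.stress_isometry R Y ν hβ (M.chart_mapsTo hβ.le hx)]
  have hstrain : ∀ i j (R : Plane ≃ᵃⁱ[ℝ] Plane) (q : ℝ × ℝ → Plane) β x, 0 < β → x ∈ M.rect →
      M.frameStrain β (fun v => R (q v)) i j (M.chart β x)
        = M.frameStrain β q i j (M.chart β x) := fun i j R q β x hβ hx => by
    simp only [frameStrain, M.strain_isometry R hβ (M.chart_mapsTo hβ.le hx)]
  refine ⟨isBigOBreadth_of_hasExpansion hJ hJ' hk hY hν hν' hβ₀ hβ₀' hmin hsmooth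
      (F := fun β q x => M.frameStress Y ν β q 0 1 (M.chart β x)) (fun _ _ _ => rfl)
      (hstress 0 1) fun _ _ _ _ _ h => h.hasExpansion_frameStress.1,
    isBigOBreadth_of_hasExpansion hJ hJ' hk hY hν hν' hβ₀ hβ₀' hmin hsmooth
      (F := fun β q x => M.frameStress Y ν β q 1 0 (M.chart β x)) (fun _ _ _ => rfl)
      (hstress 1 0) fun _ _ _ _ _ h => h.hasExpansion_frameStress.2.1,
    isBigOBreadth_of_hasExpansion hJ hJ' hk hY hν hν' hβ₀ hβ₀' hmin hsmooth
      (F := fun β q x => M.frameStress Y ν β q 1 1 (M.chart β x)) (fun _ _ _ => rfl)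
      (hstress 1 1) fun _ _ _ _ _ h => h.hasExpansion_frameStress.2.2,
    isBigOBreadth_of_hasExpansion hJ hJ' hk hY hν hν' hβ₀ hβ₀' hmin hsmooth
      (F := fun β q x => M.frameStrain β q 0 0 (M.chart β x)
        - 1 / 2 * M.K x.1 * (β * M.B x.1) ^ 2 * (x.2 ^ 2 - 1 / 3)) (fun _ _ _ => rfl)
      (fun R q β x hβ hx => by simp only [hstrain 0 0 R q β x hβ hx])
      fun s₁ s₂ β₁ q P h => ?_,
    isBigOBreadth_of_hasExpansion hJ hJ' hk hY hν hν' hβ₀ hβ₀' hmin hsmooth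
      (F := fun β q x => M.frameStrain β q 1 1 (M.chart β x)
        - (-ν * M.frameStrain β q 0 0 (M.chart β x))) (fun _ _ _ => rfl)
      (fun R q β x hβ hx => by simp only [hstrain 0 0 R q β x hβ hx, hstrain 1 1 R q β x hβ hx])
      fun _ _ _ _ _ h => h.hasExpansion_frameStrain_one_one⟩
  -- Here the second-order term has been subtracted beforehand, so the remainder bound becomes an
  -- expansion with zero coefficients.
  obtain ⟨C, δ, hδ, hC⟩ := h.hasExpansion_frameStrain_zero_zero.bound
  refine ⟨continuousOn_const, continuousOn_const, continuousOn_const, C, δ, hδ,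
    fun x hx β hβ => le_of_eq_of_le ?_ (hC x hx β hβ)⟩
  congr 1
  simp only [smul_eq_mul]
  ring
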